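/- Setting. Let $\Gamma$ be a connected oriented graph with vertex set $V$ and edge set $E$ (multiple edges and loops allowed, finite or infinite), each vertex having finite degree. Let $E_v^-$, $E_v^+$ be the sets of edges starting, respectively ending, at $v$, and $E_v=E_v^-\cup E_v^+$. To each $v\in V$ associate a Riemann sphere $S_v=\mathbb C\cup\{\infty\}$ with standard coordinate $z$. For each edge $e$ from $v$ to $v'$ let $p_e^-\in S_v$, $p_e^+\in S_{v'}$ be points different from $\infty$, and let $z_e^\pm:D_e^\pm\to D(0,\rho)$ be biholomorphic maps from neighbourhoods $D_e^-\subset S_v$, $D_e^+\subset S_{v'}$ of these points, with $z_e^\pm(p_e^\pm)=0$. The coordinates are admissible: $\rho>0$ does not depend on $e$; for each $v$ the discs $D_e^-$ ($e\in E_v^-$) and $D_e^+$ ($e\in E_v^+$) are pairwise disjoint; and there are constants $c_1,c_2>0$ with $c_1|z_e^\pm(z)|\le|z-p_e^\pm|\le c_2|z_e^\pm(z)|$ for all $e\in E$ and $z\in D_e^\pm$. For $\mathbf t=(t_e)_{e\in E}$ with $|t_e|<\rho^2$, $\Sigma_{\mathbf t}$ is the (possibly noded) Riemann surface obtained from the disjoint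 union of the $S_v$ as follows. For every $e$ with $t_e\ne0$, remove the discs $|z_e^\pm|\le|t_e|/\rho$ and identify the remaining points $z\in D_e^-$ and $z'\in D_e^+$ whenever $z_e^-(z)\,z_e^+(z')=t_e$. For every $e$ with $t_e=0$, identify $p_e^-$ with $p_e^+$ (a node). A regular differential on $\Sigma_{\mathbf t}$ is a differential that is holomorphic away from the nodes and has at each node at most simple poles at $p_e^-$ and $p_e^+$, with opposite residues. The cycle $\gamma_e$ is the homology class of $\partial D_e^+$, that is, of any positively oriented circle $|z_e^+|=r$ with $|t_e|/\rho<r<\rho$. Let $\|\cdot\|_E$, $\|\cdot\|_V$ be norms defined on linear subspaces $\mathcal B_E\subset\mathbb C^E$, $\mathcal B_V\subset\mathbb C^V$. They are admissible: (1) $\mathcal B_E$ and $\mathcal B_V$ are Banach spaces; (2) the norms are monotonic: if $\alpha'\in\mathcal B_E$ and $|\alpha_e|\le|\alpha_e'|$ for all $e$, then $\alpha\in\mathcal B_E$ and $\|\alpha\|_E\le\|\alpha'\|_E$, and likewise for $\|\cdot\|_V$; (3) $(\alpha_e)_e\mapsto(\sum_{e\in E_v}|\alpha_e|)_v$ is bounded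 from $\mathcal B_E$ to $\mathcal B_V$; (4) $(u_v)_v\mapsto(|u_v|+|u_{v'}|)_{e=vv'}$ is bounded from $\mathcal B_V$ to $\mathcal B_E$; (5) the space of families $(\lambda_{e,n})_{e\in E,n\in\mathbb N}$ for which $\|(\sup_n|\lambda_{e,n}|)_e\|_E$ is defined is a Banach space with this norm. Fix $0<\epsilon\le\rho c_1$, let $\Omega_{v,\epsilon}$ be $S_v$ minus the discs $D(p_e^-,\epsilon)$, $e\in E_v^-$, and $D(p_e^+,\epsilon)$, $e\in E_v^+$, and let $\mathcal H^1(\Sigma_{\mathbf t})$ be the space of regular differentials $\omega$ on $\Sigma_{\mathbf t}$ such that $\left(\sup_{\Omega_{v,\epsilon}}\left|\frac{\omega}{dz}\right|\right)_{v\in V}\in\mathcal B_V$, with the norm $\|\omega\|_\Omega=\left\|\left(\sup_{\Omega_{v,\epsilon}}\left|\frac{\omega}{dz}\right|\right)_{v}\right\|_V$. Theorem. There is $\delta\in(0,\rho^2)$ such that for all $\mathbf t\in\mathbb C^E$ with $\|\mathbf t\|_\infty=\sup_e|t_e|\le\delta$, the map $\omega\mapsto\left(\int_{\gamma_e}\omega\right)_{e\in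 E}$ is an isomorphism of Banach spaces (a bounded linear bijection with bounded inverse between complete normed spaces) from $\mathcal H^1(\Sigma_{\mathbf t})$ onto the subspace of those $\alpha\in\mathcal B_E$ with $\sum_{e\in E_v^-}\alpha_e=\sum_{e\in E_v^+}\alpha_e$ for every $v\in V$. -/

import Mathlib

open Topology

/-! ### Oriented multigraphs -/

/-- An oriented multigraph with vertex set `V` and edge set `E` (multiple edges and edges from a
vertex to itself are allowed), all of whose vertices have finite degree. The edge `e` goes from
`src e` to `tgt e`. -/
structure OrientedMultigraph (V E : Type*) where
  src : E → V
  tgt : E → V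
  finite_degree : ∀ v, {e | src e = v ∨ tgt e = v}.Finite

/-- The two ends of an edge: `minus` is its starting point, `plus` its endpoint. -/
inductive Side
  | minus
  | plus

namespace OrientedMultigraph

variable {V E : Type*} (G : OrientedMultigraph V E)

/-- The vertex at an end of an edge. -/
def vertex (e : E) : Side → V
  | Side.minus => G.src e
  | Side.plus => G.tgt e

/-- The set of edges starting at `v`. -/
noncomputable def outEdges (v : V) : Finset E :=
  Set.Finite.toFinset (s := {e | G.src e = v}) ((G.finite_degree v).subset fun _ h => Or.inl h)

/-- The set of edges ending at `v`. -/
noncomputable def inEdges (v : V) : Finset E :=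
  Set.Finite.toFinset (s := {e | G.tgt e = v}) ((G.finite_degree v).subset fun _ h => Or.inr h)

/-- The set of edges adjacent to `v` (an edge from `v` to itself occurs once). -/
noncomputable def edgesAt (v : V) : Finset E := (G.finite_degree v).toFinset

/-- Any two vertices are joined by a path, regardless of the orientation of the edges. -/
def Connected : Prop :=
  ∀ v w, Relation.EqvGen (fun a b => ∃ e, G.src e = a ∧ G.tgt e = b) v w

end OrientedMultigraph

/-! ### Monotonic norms on spaces of sequences -/

/-- A monotonic norm on a linear subspace `space` of `ℂ^ι`: if `b` belongs to the subspace and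
`|a i| ≤ |b i|` for all `i`, then the norm of `a` is defined as well (that is, `a` belongs to the
subspace) and `‖a‖ ≤ ‖b‖`. -/
structure MonotoneNorm (ι : Type*) where
  space : Submodule ℂ (ι → ℂ)
  norm : Seminorm ℂ space
  eq_zero_of_norm_eq_zero : ∀ x, norm x = 0 → x = 0
  mono : ∀ (a : ι → ℂ) (b : space), (∀ i, ‖a i‖ ≤ ‖b.1 i‖) →
    ∃ ha : a ∈ space, norm ⟨a, ha⟩ ≤ norm b

namespace MonotoneNorm

variable {ι : Type*} (N : MonotoneNorm ι)

/-- The subspace on which the norm is defined, as a normed space with that norm (and not with the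
topology of pointwise convergence). -/
def Space : Type _ := N.space

noncomputable instance : AddCommGroup N.Space := inferInstanceAs (AddCommGroup N.space)

noncomputable instance : Module ℂ N.Space := inferInstanceAs (Module ℂ N.space)

noncomputable instance : NormedAddCommGroup N.Space :=
  AddGroupNorm.toNormedAddCommGroup (E := N.Space)
    { toFun := N.norm
      map_zero' := map_zero N.norm
      add_le' := map_add_le_add N.norm
      neg' := map_neg_eq_map N.norm
      eq_zero_of_map_eq_zero' := N.eq_zero_of_norm_eq_zero }

noncomputable instance : NormedSpace ℂ N.Space where
  norm_smul_le c x := (map_smul_eq_mul N.norm c x).le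

/-- The linear map sending an element of the space to its sequence of coordinates. -/
def coords : N.Space →ₗ[ℂ] (ι → ℂ) := N.space.subtype

variable (T : ι → Type*)

/-- The sequence `(sup_{τ ∈ T i} |x i τ|)_i`. -/
noncomputable def supSeq {T : ι → Type*} (x : (i : ι) → T i → ℂ) : ι → ℂ :=
  fun i => ((⨆ τ, ‖x i τ‖ : ℝ) : ℂ)

theorem norm_supSeq {T : ι → Type*} (x : (i : ι) → T i → ℂ) (i : ι) :
    ‖supSeq x i‖ = ⨆ τ, ‖x i τ‖ := by
  rw [supSeq, Complex.norm_real, Real.norm_of_nonneg (Real.iSup_nonneg fun _ => norm_nonneg _)]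

theorem norm_supSeq_add_le {T : ι → Type*} {x y : (i : ι) → T i → ℂ}
    (hx : ∀ i, BddAbove (Set.range fun τ => ‖x i τ‖))
    (hy : ∀ i, BddAbove (Set.range fun τ => ‖y i τ‖)) (i : ι) :
    ‖supSeq (x + y) i‖ ≤ ‖(supSeq x + supSeq y) i‖ := by
  have hs : (supSeq x + supSeq y) i = (((⨆ τ, ‖x i τ‖) + ⨆ τ, ‖y i τ‖ : ℝ) : ℂ) := by
    simp [supSeq]
  have hx0 : 0 ≤ ⨆ τ, ‖x i τ‖ := Real.iSup_nonneg fun _ => norm_nonneg _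
  have hy0 : 0 ≤ ⨆ τ, ‖y i τ‖ := Real.iSup_nonneg fun _ => norm_nonneg _
  rw [norm_supSeq, hs, Complex.norm_real, Real.norm_of_nonneg (add_nonneg hx0 hy0)]
  exact Real.iSup_le (fun τ => (norm_add_le _ _).trans
    (add_le_add (le_ciSup (hx i) τ) (le_ciSup (hy i) τ))) (add_nonneg hx0 hy0)

theorem supSeq_smul {T : ι → Type*} (c : ℂ) (x : (i : ι) → T i → ℂ) :
    supSeq (c • x) = (‖c‖ : ℂ) • supSeq x := by
  funext i
  simp only [supSeq, Pi.smul_apply, smul_eq_mul, norm_mul]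
  rw [← Real.mul_iSup_of_nonneg (norm_nonneg c), Complex.ofReal_mul]

/-- The space of families `x = (x i τ)`, `i ∈ ι`, `τ ∈ T i`, for which
`‖(sup_τ |x i τ|)_i‖` is defined. -/
noncomputable def supSpace : Submodule ℂ ((i : ι) → T i → ℂ) where
  carrier := {x | (∀ i, BddAbove (Set.range fun τ => ‖x i τ‖)) ∧ supSeq x ∈ N.space}
  zero_mem' := by
    refine ⟨fun i => ⟨0, ?_⟩, ?_⟩
    · rintro _ ⟨τ, rfl⟩
      simp
    · have : supSeq (0 : (i : ι) → T i → ℂ) = 0 := by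
        funext i
        simp [supSeq]
      rw [this]
      exact N.space.zero_mem
  add_mem' := by
    rintro x y ⟨hx, hx'⟩ ⟨hy, hy'⟩
    refine ⟨fun i => ?_, ?_⟩
    · obtain ⟨a, ha⟩ := hx i
      obtain ⟨b, hb⟩ := hy i
      refine ⟨a + b, ?_⟩
      rintro _ ⟨τ, rfl⟩
      exact (norm_add_le _ _).trans (add_le_add (ha ⟨τ, rfl⟩) (hb ⟨τ, rfl⟩))
    · exact (N.mono _ ⟨_, N.space.add_mem hx' hy'⟩ (norm_supSeq_add_le hx hy)).1
  smul_mem' := by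
    rintro c x ⟨hx, hx'⟩
    refine ⟨fun i => ?_, ?_⟩
    · obtain ⟨a, ha⟩ := hx i
      refine ⟨‖c‖ * a, ?_⟩
      rintro _ ⟨τ, rfl⟩
      have := mul_le_mul_of_nonneg_left (ha ⟨τ, rfl⟩) (norm_nonneg c)
      simpa using this
    · rw [supSeq_smul]
      exact N.space.smul_mem _ hx'

/-- The norm `‖(sup_τ |x i τ|)_i‖`. -/
noncomputable def supNorm : Seminorm ℂ (N.supSpace T) :=
  Seminorm.of (fun x => N.norm ⟨supSeq x.1, x.2.2⟩)
    (fun x y => ((N.mono _ ⟨_, N.space.add_mem x.2.2 y.2.2⟩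
        (norm_supSeq_add_le x.2.1 y.2.1)).2).trans
      (map_add_le_add N.norm ⟨supSeq x.1, x.2.2⟩ ⟨supSeq y.1, y.2.2⟩))
    (fun c x => by
      have h : (⟨supSeq (c • x).1, (c • x).2.2⟩ : N.space)
          = (‖c‖ : ℂ) • ⟨supSeq x.1, x.2.2⟩ := Subtype.ext (supSeq_smul c x.1)
      rw [h, map_smul_eq_mul]
      simp)

/-- The space `supSpace` as a normed space with the norm `supNorm`. -/
def SupSpace : Type _ := N.supSpace T

noncomputable instance : AddCommGroup (N.SupSpace T) := inferInstanceAs (AddCommGroup (N.supSpace T))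

noncomputable instance : Module ℂ (N.SupSpace T) := inferInstanceAs (Module ℂ (N.supSpace T))

noncomputable instance : SeminormedAddCommGroup (N.SupSpace T) :=
  AddGroupSeminorm.toSeminormedAddCommGroup (E := N.SupSpace T) (N.supNorm T).toAddGroupSeminorm

noncomputable instance : NormedSpace ℂ (N.SupSpace T) where
  norm_smul_le c x := (map_smul_eq_mul (N.supNorm T) c x).le

end MonotoneNorm

/-- Admissible pairs of norms, the monotonicity being part of `MonotoneNorm`. -/
structure AdmissibleNorms {V E : Type*} (G : OrientedMultigraph V E)
    (NE : MonotoneNorm E) (NV : MonotoneNorm V) : Prop where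
  complete_edges : CompleteSpace NE.Space
  complete_vertices : CompleteSpace NV.Space
  /-- `α ↦ (∑_{e ∈ E_v} |α_e|)_v` is bounded. -/
  edges_to_vertices : ∃ C : ℝ, ∀ α : NE.space,
    ∃ h : (fun v => ((∑ e ∈ G.edgesAt v, ‖α.1 e‖ : ℝ) : ℂ)) ∈ NV.space,
      NV.norm ⟨_, h⟩ ≤ C * NE.norm α
  /-- `u ↦ (|u_v| + |u_{v'}|)_{e = vv'}` is bounded. -/
  vertices_to_edges : ∃ C : ℝ, ∀ u : NV.space,
    ∃ h : (fun e => ((‖u.1 (G.src e)‖ + ‖u.1 (G.tgt e)‖ : ℝ) : ℂ)) ∈ NE.space,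
      NE.norm ⟨_, h⟩ ≤ C * NV.norm u
  /-- The sequences `(λ_{e,n})` with the norm `‖(sup_n |λ_{e,n}|)_e‖` form a Banach space. -/
  complete_sequences : CompleteSpace (NE.SupSpace fun _ => ℕ)

/-- The subspace of those `α` with `∑_{e ∈ E_v^-} α_e = ∑_{e ∈ E_v^+} α_e` for all vertices `v`,
where `E_v^-` are the edges starting at `v` and `E_v^+` the edges ending at `v`. -/
noncomputable def compatibleSubspace {V E : Type*} (G : OrientedMultigraph V E)
    (NE : MonotoneNorm E) : Submodule ℂ NE.Space where
  carrier := {α | ∀ v, ∑ e ∈ G.outEdges v, NE.coords α e = ∑ e ∈ G.inEdges v, NE.coords α e}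
  zero_mem' := by
    intro v
    simp
  add_mem' := by
    intro α β hα hβ v
    simp only [map_add, Pi.add_apply, Finset.sum_add_distrib, hα v, hβ v]
  smul_mem' := by
    intro c α hα v
    simp only [map_smul, Pi.smul_apply, ← Finset.smul_sum, hα v]

/-! ### Coordinates used to open the nodes -/

/-- The points `p_e^±` and the local coordinates `z_e^± : D_e^± → ℂ`, where `D_e^±` is the source
of the partial homeomorphism `z e ±`. The sphere at the vertex `v` is `ℂ ∪ {∞}` with the standard
coordinate; the points and (in the admissible case, where they are bounded) the discs lie
in `ℂ`. -/
structure NodeCoordinates (E : Type*) where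
  p : E → Side → ℂ
  z : E → Side → OpenPartialHomeomorph ℂ ℂ

/-- Admissible coordinates, with radius `ρ` and comparison constants `c₁`, `c₂`. -/
structure AdmissibleCoordinates {V E : Type*} (G : OrientedMultigraph V E)
    (X : NodeCoordinates E) (ρ c₁ c₂ : ℝ) : Prop where
  rho_pos : 0 < ρ
  c₁_pos : 0 < c₁
  c₂_pos : 0 < c₂
  center_mem : ∀ e s, X.p e s ∈ (X.z e s).source
  map_center : ∀ e s, X.z e s (X.p e s) = 0
  target_eq : ∀ e s, (X.z e s).target = Metric.ball 0 ρ
  holomorphic : ∀ e s, DifferentiableOn ℂ (X.z e s) (X.z e s).source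
  holomorphic_symm : ∀ e s, DifferentiableOn ℂ (X.z e s).symm (X.z e s).target
  disjoint : ∀ e s e' s', G.vertex e s = G.vertex e' s' → (e, s) ≠ (e', s') →
    Disjoint (X.z e s).source (X.z e' s').source
  comparison : ∀ e s, ∀ x ∈ (X.z e s).source,
    c₁ * ‖X.z e s x‖ ≤ ‖x - X.p e s‖ ∧ ‖x - X.p e s‖ ≤ c₂ * ‖X.z e s x‖

/-! ### Regular differentials on the surface obtained by opening the nodes -/

/-- `f(x) dx` has at `a` at most a simple pole, with residue `c`. -/
def HasSimplePole (f : ℂ → ℂ) (a c : ℂ) : Prop :=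
  ∃ g : ℂ → ℂ, AnalyticAt ℂ g a ∧ ∀ᶠ x in 𝓝[≠] a, f x = c / (x - a) + g x

/-- `f(x) dx` is holomorphic at `∞`: in the coordinate `w = 1 / x` it is `-f(1/w) / w² dw`. -/
def HolomorphicAtInfty (f : ℂ → ℂ) : Prop :=
  ∃ g : ℂ → ℂ, AnalyticAt ℂ g 0 ∧ ∀ᶠ w in 𝓝[≠] (0 : ℂ), -f w⁻¹ / w ^ 2 = g w

namespace NodeCoordinates

variable {V E : Type*} (G : OrientedMultigraph V E) (X : NodeCoordinates E) (ρ : ℝ) (t : E → ℂ)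

/-- The finite points of the part of the sphere at `v` that is kept when the nodes are opened:
the discs `|z_e^±| ≤ |t_e| / ρ` are removed. If `t_e = 0` then that disc is just `{p_e^±}`, and
what is removed is the node. -/
def piece (v : V) : Set ℂ :=
  {x | ∀ e s, G.vertex e s = v → x ∈ (X.z e s).source → ‖t e‖ / ρ < ‖X.z e s x‖}

/-- The gluing map `φ_e` from `D_e^-` to `D_e^+`, characterized by `z_e^-(x) z_e^+(φ_e(x)) = t_e`.
The point `x` of the annulus `|t_e| / ρ < |z_e^-| < ρ` is identified with `φ_e(x)`. -/
noncomputable def glue (e : E) (x : ℂ) : ℂ :=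
  (X.z e Side.plus).symm (t e / X.z e Side.minus x)

/-- Regular differentials `ω` on the (possibly noded) Riemann surface `Σ_t` obtained from the
disjoint union of the pieces (with the points at infinity) by gluing along the maps `φ_e` for
`t_e ≠ 0` and identifying `p_e^-` with `p_e^+` for `t_e = 0`. The differential is given by its
coefficient `f v = ω / dx` with respect to the standard coordinate `x` of each piece; these
coordinates, with `1 / x`, form an atlas of `Σ_t` minus the nodes, with the `φ_e` as changes of
coordinates. Outside the piece, the coefficient is set to zero. -/
structure IsRegularDifferential (f : V → ℂ → ℂ) : Prop where
  eq_zero : ∀ v, ∀ x ∉ piece G X ρ t v, f v x = 0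
  holomorphic : ∀ v, DifferentiableOn ℂ (f v) (piece G X ρ t v)
  holomorphic_infty : ∀ v, HolomorphicAtInfty (f v)
  /-- `φ_e^* ω = ω` -/
  glued : ∀ e, t e ≠ 0 → ∀ x ∈ (X.z e Side.minus).source, ‖t e‖ / ρ < ‖X.z e Side.minus x‖ →
    f (G.src e) x = f (G.tgt e) (X.glue t e x) * deriv (X.glue t e) x
  /-- At a node there are simple poles (or none) with opposite residues. -/
  node : ∀ e, t e = 0 → ∃ c, HasSimplePole (f (G.src e)) (X.p e Side.minus) (-c) ∧
    HasSimplePole (f (G.tgt e)) (X.p e Side.plus) c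

/-- The vector space of regular differentials on `Σ_t`. -/
def regularDifferentials : Submodule ℂ (V → ℂ → ℂ) where
  carrier := {f | IsRegularDifferential G X ρ t f}
  zero_mem' :=
    { eq_zero := fun _ _ _ => rfl
      holomorphic := fun _ => differentiableOn_const 0
      holomorphic_infty := fun _ => ⟨fun _ => 0, analyticAt_const, .of_forall fun w => by simp⟩
      glued := fun e _ x _ _ => by simp
      node := fun e _ => ⟨0, ⟨fun _ => 0, analyticAt_const, .of_forall fun x => by simp⟩,
        ⟨fun _ => 0, analyticAt_const, .of_forall fun x => by simp⟩⟩ }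
  add_mem' := by
    intro f f' h h'
    refine ⟨fun v x hx => ?_, fun v => (h.holomorphic v).add (h'.holomorphic v), fun v => ?_,
      fun e he x hx hx' => ?_, fun e he => ?_⟩
    · simp [h.eq_zero v x hx, h'.eq_zero v x hx]
    · obtain ⟨g, hg, hfg⟩ := h.holomorphic_infty v
      obtain ⟨g', hg', hfg'⟩ := h'.holomorphic_infty v
      refine ⟨g + g', hg.add hg', ?_⟩
      filter_upwards [hfg, hfg'] with w h1 h2
      simp only [Pi.add_apply, ← h1, ← h2]
      ring
    · simp only [Pi.add_apply, h.glued e he x hx hx', h'.glued e he x hx hx']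
      ring
    · obtain ⟨c, ⟨a, ha, hfa⟩, ⟨b, hb, hfb⟩⟩ := h.node e he
      obtain ⟨c', ⟨a', ha', hfa'⟩, ⟨b', hb', hfb'⟩⟩ := h'.node e he
      refine ⟨c + c', ⟨a + a', ha.add ha', ?_⟩, ⟨b + b', hb.add hb', ?_⟩⟩
      · filter_upwards [hfa, hfa'] with w h1 h2
        simp only [Pi.add_apply, h1, h2]
        ring
      · filter_upwards [hfb, hfb'] with w h1 h2
        simp only [Pi.add_apply, h1, h2]
        ring
  smul_mem' := by
    intro k f h
    refine ⟨fun v x hx => ?_, fun v => (h.holomorphic v).const_smul k, fun v => ?_,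
      fun e he x hx hx' => ?_, fun e he => ?_⟩
    · simp [h.eq_zero v x hx]
    · obtain ⟨g, hg, hfg⟩ := h.holomorphic_infty v
      refine ⟨k • g, hg.const_smul, ?_⟩
      filter_upwards [hfg] with w h1
      simp only [Pi.smul_apply, smul_eq_mul, ← h1]
      ring
    · simp only [Pi.smul_apply, smul_eq_mul, h.glued e he x hx hx']
      ring
    · obtain ⟨c, ⟨a, ha, hfa⟩, ⟨b, hb, hfb⟩⟩ := h.node e he
      refine ⟨k * c, ⟨k • a, ha.const_smul, ?_⟩, ⟨k • b, hb.const_smul, ?_⟩⟩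
      · filter_upwards [hfa] with w h1
        simp only [Pi.smul_apply, smul_eq_mul, h1]
        ring
      · filter_upwards [hfb] with w h1
        simp only [Pi.smul_apply, smul_eq_mul, h1]
        ring

/-- The finite points of `Ω_{v,ε}`, the sphere at `v` minus the open discs `D(p_e^±, ε)`. At the
point `∞` of `Ω_{v,ε}` the quotient `ω / dx` vanishes, so it does not contribute to the sup. -/
def Omega (ε : ℝ) (v : V) : Set ℂ :=
  {x | ∀ e s, G.vertex e s = v → ε ≤ ‖x - X.p e s‖}

/-- The restriction `(f_v) ↦ (f_v|_{Ω_{v,ε}})`. -/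
def restrictOmega (ε : ℝ) : (V → ℂ → ℂ) →ₗ[ℂ] ((v : V) → Omega G X ε v → ℂ) where
  toFun f v x := f v x
  map_add' _ _ := rfl
  map_smul' _ _ := rfl

variable (ε : ℝ) (NV : MonotoneNorm V)

/-- The space `H¹(Σ_t)` of regular differentials `ω` on `Σ_t` for which the norm
`‖(sup_{Ω_{v,ε}} |ω / dx|)_v‖_V` is defined. -/
noncomputable def h1 : Submodule ℂ (V → ℂ → ℂ) :=
  regularDifferentials G X ρ t ⊓ (NV.supSpace fun v => Omega G X ε v).comap (restrictOmega G X ε)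

/-- `H¹(Σ_t)` as a type, to be equipped with the norm `‖(sup_{Ω_{v,ε}} |ω / dx|)_v‖_V`. -/
def H1 : Type _ := h1 G X ρ t ε NV

noncomputable instance : AddCommGroup (H1 G X ρ t ε NV) :=
  inferInstanceAs (AddCommGroup (h1 G X ρ t ε NV))

noncomputable instance : Module ℂ (H1 G X ρ t ε NV) :=
  inferInstanceAs (Module ℂ (h1 G X ρ t ε NV))

/-- The linear map sending `ω` to its coefficients `ω / dx` on the pieces. -/
noncomputable def H1.coeff : H1 G X ρ t ε NV →ₗ[ℂ] (V → ℂ → ℂ) := (h1 G X ρ t ε NV).subtype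

/-- The restriction of `ω` to the domains `Ω_{v,ε}`. -/
noncomputable def H1.restrict :
    H1 G X ρ t ε NV →ₗ[ℂ] NV.SupSpace fun v => Omega G X ε v :=
  LinearMap.codRestrict (NV.supSpace fun v => Omega G X ε v)
    ((restrictOmega G X ε).comp (h1 G X ρ t ε NV).subtype) fun ω => ω.2.2

/-- The norm is `‖ω‖ = ‖(sup_{Ω_{v,ε}} |ω / dx|)_v‖_V`. -/
noncomputable instance : SeminormedAddCommGroup (H1 G X ρ t ε NV) :=
  SeminormedAddCommGroup.induced (H1 G X ρ t ε NV) (NV.SupSpace fun v => Omega G X ε v)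
    (H1.restrict G X ρ t ε NV)

noncomputable instance : NormedSpace ℂ (H1 G X ρ t ε NV) :=
  NormedSpace.induced ℂ (H1 G X ρ t ε NV) (NV.SupSpace fun v => Omega G X ε v)
    (H1.restrict G X ρ t ε NV)

/-- The integral of the differential with coefficients `f` over the cycle `|z_e^+| = r` of `D_e^+`,
positively oriented, where `|t_e| / ρ < r < ρ`. All these cycles represent the homology class
`γ_e` of the boundary of `D_e^+`. -/
noncomputable def period (f : V → ℂ → ℂ) (e : E) (r : ℝ) : ℂ :=
  ∮ w in C(0, r), f (G.tgt e) ((X.z e Side.plus).symm w) * deriv (X.z e Side.plus).symm w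

end NodeCoordinates

/-! Let `h` be a half-edge, that is, an end of an edge `e`, and let `h'` be the opposite end. In the
coordinate w of `h` a regular differential reads (c_h / w − (t_e / w²) R_{h'}(t_e / w) + R_h(w)) dw,
with residues c_h = −c_{h'} and with R_h holomorphic on |w| < ρ. The middle term is the pullback of
R_{h'}(w') dw' under w' = t_e / w. For t_e ≠ 0 this is therefore the Laurent decomposition on the
annulus, each regular part being read in the coordinate of its own end; for t_e = 0 it says that the
pole is at most simple.

By Liouville's theorem the differential on the sphere at v is recovered from its principal parts:
outside the discs |z_h| ≤ r it is the sum, over the half-edges at v, of the Cauchy transforms of the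
principal parts along |z_h| = r. Inside the circle of `h` the same sum, written in the coordinate w,
equals R_h. Regular differentials thus correspond to pairs (c, R) solving an equation R = T(c, R),
linear in (c, R), such that the residues at each vertex sum to zero, which is regularity at
infinity. Since the period over γ_e is 2πi times the residue at the plus end, this is the condition
that defines the target space.

R enters T only through the factor t_e, so this dependence has size O(δ). It couples an edge only to
edges sharing a vertex with it, and such sums are bounded on B_E by admissibility of the norms.
Sizes of R are measured by the norm in B_E of its suprema over |w| ≤ τ. For small δ, independent of
t, the equation can then be solved for every admissible c (surjectivity), and R is bounded by c, so
that ω on Ω is bounded by the periods (injectivity and bounded inverse). Conversely, the circles |x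
− p_h| = ε lie in Ω, so ω on Ω bounds c and R up to O(δ) terms that are absorbed. Hence the periods
are bounded, and R has finite norm, without which the absorption argument for the inverse would be
void. Completeness of the source is inherited from the closed subspace of B_E.

The proof is carried by `deriv_mul_cauchyTransform_jump`, `exists_laurent_decomposition`,
`GluingData.isRegularDifferential`, `IsRegularDifferential.exists_gluingData`,
`exists_nextRegular_eq` and `GluingData.exists_bound`, assembled in `exists_period_equiv`. -/

/-! ### Cauchy transforms along images of circles -/

open Metric Set Filter in
/-- A circle integral depending holomorphically on a parameter, with a linear denominator. -/
theorem differentiableAt_circleIntegral_div {A B P : ℂ → ℂ} {r : ℝ} (hr : 0 ≤ r)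
    (hA : ContinuousOn A (sphere 0 r)) (hB : ContinuousOn B (sphere 0 r))
    (hP : ContinuousOn P (sphere 0 r)) {w₀ : ℂ} (h : ∀ u ∈ sphere (0 : ℂ) r, A u + w₀ * B u ≠ 0) :
    DifferentiableAt ℂ (fun w => ∮ u in C(0, r), P u / (A u + w * B u)) w₀ := by
  have hm : ∀ θ, circleMap 0 r θ ∈ sphere (0 : ℂ) r := fun θ => circleMap_mem_sphere 0 hr θ
  have hcomp : ∀ {f : ℂ → ℂ}, ContinuousOn f (sphere 0 r) →
      Continuous fun θ => f (circleMap 0 r θ) := fun hf =>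
    hf.comp_continuous (continuous_circleMap 0 r) hm
  set a := fun θ => A (circleMap 0 r θ)
  set b := fun θ => B (circleMap 0 r θ)
  set p := fun θ => deriv (circleMap 0 r) θ * P (circleMap 0 r θ)
  have ha : Continuous a := hcomp hA
  have hb : Continuous b := hcomp hB
  have hp : Continuous p := by
    refine Continuous.mul ?_ (hcomp hP)
    rw [show deriv (circleMap 0 r) = fun θ => circleMap 0 r θ * Complex.I from
      funext (deriv_circleMap 0 r)]
    exact (continuous_circleMap 0 r).mul continuous_const
  have heq : (fun w => ∮ u in C(0, r), P u / (A u + w * B u)) =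
      fun w => ∫ θ in (0 : ℝ)..2 * Real.pi, p θ / (a θ + w * b θ) := by
    funext w
    simp only [circleIntegral, smul_eq_mul, a, b, p]
    exact intervalIntegral.integral_congr fun θ _ => by ring
  rw [heq]
  have hopen : IsOpen {x : ℂ × ℝ | a x.2 + x.1 * b x.2 ≠ 0} :=
    isOpen_ne_fun (by fun_prop) continuous_const
  -- Compactness of the circle keeps the denominators nonzero for all w in one closed disc around
  -- w₀. There the w-derivative of the integrand has a common bound, as differentiation under the
  -- integral requires.
  have htube : ∀ᶠ w in 𝓝 w₀, ∀ θ ∈ Icc (0 : ℝ) (2 * Real.pi), a θ + w * b θ ≠ 0 := by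
    refine isCompact_Icc.eventually_forall_of_forall_eventually fun θ _ => ?_
    exact hopen.mem_nhds (h _ (hm θ))
  obtain ⟨η, hη, hball⟩ := Metric.nhds_basis_closedBall.eventually_iff.1 htube
  have hF' : ContinuousOn (fun x : ℂ × ℝ => -(p x.2 * b x.2) / (a x.2 + x.1 * b x.2) ^ 2)
      (closedBall w₀ η ×ˢ Icc (0 : ℝ) (2 * Real.pi)) := by
    refine ContinuousOn.div (by fun_prop) (by fun_prop) fun x hx => pow_ne_zero 2 (hball hx.1 _ hx.2)
  obtain ⟨M, hM⟩ := ((isCompact_closedBall w₀ η).prod isCompact_Icc).exists_bound_of_continuousOn hF'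
  have hI : uIoc (0 : ℝ) (2 * Real.pi) ⊆ Icc 0 (2 * Real.pi) := by
    rw [uIoc_of_le Real.two_pi_pos.le]
    exact Ioc_subset_Icc_self
  have hcont : ∀ w ∈ closedBall w₀ η, ContinuousOn (fun θ => p θ / (a θ + w * b θ))
      (Icc 0 (2 * Real.pi)) := fun w hw =>
    ContinuousOn.div (by fun_prop) (by fun_prop) fun θ hθ => hball hw _ hθ
  have := intervalIntegral.hasDerivAt_integral_of_dominated_loc_of_deriv_le
    (μ := MeasureTheory.volume) (a := 0) (b := 2 * Real.pi)
    (F := fun w θ => p θ / (a θ + w * b θ))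
    (F' := fun w θ => -(p θ * b θ) / (a θ + w * b θ) ^ 2) (x₀ := w₀)
    (s := closedBall w₀ η) (bound := fun _ => M) (closedBall_mem_nhds w₀ hη) ?_ ?_ ?_ ?_ ?_ ?_
  · exact this.2.differentiableAt
  · filter_upwards [closedBall_mem_nhds w₀ hη] with w hw
    exact ((hcont w hw).mono hI).aestronglyMeasurable measurableSet_uIoc
  · refine ContinuousOn.intervalIntegrable ?_
    rw [uIcc_of_le Real.two_pi_pos.le]
    exact hcont w₀ (mem_closedBall_self hη.le)
  · refine ContinuousOn.aestronglyMeasurable ?_ measurableSet_uIoc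
    refine ContinuousOn.div (by fun_prop) (by fun_prop) fun θ hθ => pow_ne_zero 2
      (hball (mem_closedBall_self hη.le) _ (hI hθ))
  · exact Eventually.of_forall fun θ hθ w hw => hM (w, θ) ⟨hw, hI hθ⟩
  · exact intervalIntegrable_const
  · refine Eventually.of_forall fun θ hθ w hw => ?_
    have hne := hball hw _ (hI hθ)
    have h1 : HasDerivAt (fun w => a θ + w * b θ) (b θ) w := by
      simpa using ((hasDerivAt_id w).mul_const (b θ)).const_add (a θ)
    have h2 := (hasDerivAt_const w (p θ)).div h1 hne
    simpa using! h2

/-- The Cauchy transform of `P(u) du` along the image under `φ` of the circle `|u| = r`. -/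
noncomputable def cauchyTransform (φ P : ℂ → ℂ) (r : ℝ) (x : ℂ) : ℂ :=
  (2 * Real.pi * Complex.I)⁻¹ * ∮ u in C(0, r), P u / (x - φ u)

section CauchyTransform

open Metric Set Filter Complex

variable {φ P : ℂ → ℂ} {r : ℝ}

theorem differentiableAt_cauchyTransform (hr : 0 ≤ r) (hφ : ContinuousOn φ (sphere 0 r))
    (hP : ContinuousOn P (sphere 0 r)) {x : ℂ} (hx : ∀ u ∈ sphere (0 : ℂ) r, x ≠ φ u) :
    DifferentiableAt ℂ (cauchyTransform φ P r) x := by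
  refine DifferentiableAt.const_mul ?_ _
  have h := differentiableAt_circleIntegral_div (A := fun u => -φ u) (B := fun _ => 1) hr hφ.neg
    continuousOn_const hP (w₀ := x) (fun u hu => by
      have := sub_ne_zero.2 (hx u hu)
      rwa [mul_one, neg_add_eq_sub])
  simpa only [mul_one, neg_add_eq_sub] using h

theorem circleIntegrable_cauchyTransform (hr : 0 ≤ r) (hφ : ContinuousOn φ (sphere 0 r))
    (hP : ContinuousOn P (sphere 0 r)) {x : ℂ} (hx : ∀ u ∈ sphere (0 : ℂ) r, x ≠ φ u) :
    CircleIntegrable (fun u => P u / (x - φ u)) 0 r :=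
  (hP.div (continuousOn_const.sub hφ) fun u hu => sub_ne_zero.2 (hx u hu)).circleIntegrable hr

theorem norm_cauchyTransform_le {M d : ℝ} (hr : 0 ≤ r) (hd : 0 < d) {x : ℂ}
    (hP : ∀ u ∈ sphere (0 : ℂ) r, ‖P u‖ ≤ M) (hx : ∀ u ∈ sphere (0 : ℂ) r, d ≤ ‖x - φ u‖) :
    ‖cauchyTransform φ P r x‖ ≤ r * M / d := by
  have h := circleIntegral.norm_two_pi_i_inv_smul_integral_le_of_norm_le_const
    (f := fun u => P u / (x - φ u)) (c := 0) (R := r) (C := M / d) hr fun u hu => by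
      rw [norm_div]
      exact div_le_div₀ ((norm_nonneg _).trans (hP u hu)) (hP u hu) hd (hx u hu)
  rw [smul_eq_mul] at h
  exact h.trans_eq (mul_div_assoc _ _ _).symm

theorem circleIntegral_eq_of_differentiableOn {f : ℂ → ℂ} {r₁ r₂ : ℝ} (h₁ : 0 < r₁) (h : r₁ ≤ r₂)
    (hf : ∀ u, r₁ ≤ ‖u‖ → ‖u‖ ≤ r₂ → DifferentiableAt ℂ f u) :
    (∮ u in C(0, r₁), f u) = ∮ u in C(0, r₂), f u := by
  refine (circleIntegral_eq_of_differentiable_on_annulus_off_countable h₁ h countable_empty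
    (fun u hu => (hf u ?_ ?_).continuousAt.continuousWithinAt) fun u hu => hf u ?_ ?_).symm
  · simpa using hu.2
  · simpa using hu.1
  · have := hu.1.2
    simp only [mem_closedBall, dist_zero_right, not_le] at this
    exact this.le
  · have := hu.1.1
    simp only [mem_ball, dist_zero_right] at this
    exact this.le

theorem cauchyTransform_eq_of_differentiableOn {r₁ r₂ : ℝ} (h₁ : 0 < r₁) (h : r₁ ≤ r₂)
    (hφ : ∀ u, r₁ ≤ ‖u‖ → ‖u‖ ≤ r₂ → DifferentiableAt ℂ φ u)
    (hP : ∀ u, r₁ ≤ ‖u‖ → ‖u‖ ≤ r₂ → DifferentiableAt ℂ P u) {x : ℂ}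
    (hx : ∀ u, r₁ ≤ ‖u‖ → ‖u‖ ≤ r₂ → x ≠ φ u) :
    cauchyTransform φ P r₁ x = cauchyTransform φ P r₂ x := by
  unfold cauchyTransform
  congr 1
  exact circleIntegral_eq_of_differentiableOn h₁ h fun u hu hu' =>
    (hP u hu hu').div ((differentiableAt_const x).sub (hφ u hu hu')) (sub_ne_zero.2 (hx u hu hu'))

/-- An injective holomorphic function has no critical points; here for a function with a
holomorphic left inverse. -/
theorem deriv_mul_deriv_of_leftInverse {ψ : ℂ → ℂ} {w : ℂ} (hφ : DifferentiableAt ℂ φ w)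
    (hψ : DifferentiableAt ℂ ψ (φ w)) (h : ∀ᶠ u in 𝓝 w, ψ (φ u) = u) :
    deriv ψ (φ w) * deriv φ w = 1 := by
  have h1 : HasDerivAt (fun u => ψ (φ u)) (deriv ψ (φ w) * deriv φ w) w :=
    hψ.hasDerivAt.comp w hφ.hasDerivAt
  have h2 : HasDerivAt (fun u => ψ (φ u)) 1 w :=
    (hasDerivAt_id w).congr_of_eventuallyEq (h.mono fun u hu => hu)
  exact h1.unique h2

theorem integral_sub_inv_eq_zero {w : ℂ} (hr : 0 ≤ r) (hw : r < ‖w‖) :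
    (∮ u in C(0, r), (u - w)⁻¹) = 0 := by
  refine circleIntegral_eq_zero_of_differentiable_on_off_countable hr countable_empty ?_ ?_
  · refine ContinuousOn.inv₀ (by fun_prop) fun u hu => sub_ne_zero.2 ?_
    rintro rfl
    rw [mem_closedBall, dist_zero_right] at hu
    exact absurd hu hw.not_ge
  · intro u hu
    refine DifferentiableAt.inv (by fun_prop) (sub_ne_zero.2 ?_)
    rintro rfl
    have := hu.1
    rw [mem_ball, dist_zero_right] at this
    exact absurd this.le hw.not_ge

/-- The jump of the Cauchy transform across a circle. -/
theorem deriv_mul_cauchyTransform_jump {ρ a r₁ r₂ : ℝ} (ha : 0 ≤ a) (har : a < r₁)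
    (hrρ : r₂ < ρ) (hφ : DifferentiableOn ℂ φ (ball 0 ρ)) (hinj : InjOn φ (ball 0 ρ))
    (hder : ∀ u ∈ ball (0 : ℂ) ρ, deriv φ u ≠ 0)
    (hP : ∀ u, a < ‖u‖ → ‖u‖ < ρ → DifferentiableAt ℂ P u) {w : ℂ} (hw₁ : r₁ < ‖w‖)
    (hw₂ : ‖w‖ < r₂) :
    deriv φ w * cauchyTransform φ P r₁ (φ w) =
      deriv φ w * cauchyTransform φ P r₂ (φ w) + P w := by
  have hr₁ : 0 < r₁ := ha.trans_lt har
  have hwρ : w ∈ ball (0 : ℂ) ρ := by simpa using hw₂.trans hrρ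
  -- Since φ u − φ w = (u − w) g(u), the integrand is −h(u) / (u − w) with h = P / g. As P is
  -- holomorphic only on an annulus, h(u) / (u − w) is split into `dslope h w u`, which has the same
  -- integral over both circles, and h(w) / (u − w), whose integral is 0 over the inner circle and
  -- 2πi h(w) over the outer one.
  set g := dslope φ w
  have hg : DifferentiableOn ℂ g (ball 0 ρ) :=
    (Complex.differentiableOn_dslope (isOpen_ball.mem_nhds hwρ)).2 hφ
  have hg0 : ∀ u ∈ ball (0 : ℂ) ρ, g u ≠ 0 := by
    intro u hu
    rcases eq_or_ne u w with rfl | hne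
    · simpa [g] using hder u hu
    · rw [show g u = slope φ w u from dslope_of_ne φ hne, slope_def_field]
      exact div_ne_zero (sub_ne_zero.2 fun h => hne (hinj hu hwρ h)) (sub_ne_zero.2 hne)
  set S := {u : ℂ | a < ‖u‖ ∧ ‖u‖ < ρ}
  have hS : IsOpen S := (isOpen_lt continuous_const continuous_norm).inter
    (isOpen_lt continuous_norm continuous_const)
  have hwS : w ∈ S := ⟨har.trans hw₁, hw₂.trans hrρ⟩
  have hSb : ∀ u ∈ S, u ∈ ball (0 : ℂ) ρ := fun u hu => by simpa using hu.2
  set h := fun u => P u / g u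
  have hh : DifferentiableOn ℂ h S := fun u hu =>
    ((hP u hu.1 hu.2).div (hg.differentiableAt (isOpen_ball.mem_nhds (hSb u hu)))
      (hg0 u (hSb u hu))).differentiableWithinAt
  have hk : DifferentiableOn ℂ (dslope h w) S :=
    (Complex.differentiableOn_dslope (hS.mem_nhds hwS)).2 hh
  have hkint : (∮ u in C(0, r₁), dslope h w u) = ∮ u in C(0, r₂), dslope h w u :=
    circleIntegral_eq_of_differentiableOn hr₁ (hw₁.trans hw₂).le fun u hu hu' =>
      hk.differentiableAt (hS.mem_nhds ⟨har.trans_le hu, hu'.trans_lt hrρ⟩)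
  have key : ∀ r, r₁ ≤ r → r ≤ r₂ → r ≠ ‖w‖ → (∮ u in C(0, r), P u / (φ w - φ u)) =
      -(∮ u in C(0, r), dslope h w u) - h w * ∮ u in C(0, r), (u - w)⁻¹ := by
    intro r h1 h2 h3
    have hr : 0 ≤ r := hr₁.le.trans h1
    have hsS : sphere (0 : ℂ) r ⊆ S := fun u hu => by
      rw [mem_sphere_zero_iff_norm] at hu
      exact ⟨by rw [hu]; exact har.trans_le h1, by rw [hu]; exact h2.trans_lt hrρ⟩
    have hne : ∀ u ∈ sphere (0 : ℂ) r, u ≠ w := by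
      rintro u hu rfl
      exact h3 (mem_sphere_zero_iff_norm.1 hu).symm
    rw [← circleIntegral.integral_const_mul, ← neg_add', ← circleIntegral.integral_add,
      ← neg_one_mul, ← circleIntegral.integral_const_mul]
    · refine circleIntegral.integral_congr hr fun u hu => ?_
      have hne' := sub_ne_zero.2 (hne u hu)
      have hgu := hg0 u (hSb u (hsS hu))
      have hgu' : φ u - φ w = (u - w) * g u := by
        simpa [smul_eq_mul] using (sub_smul_dslope φ w u).symm
      have : φ w - φ u = -((u - w) * g u) := by rw [← hgu']; ring
      simp only [this, dslope_of_ne h (hne u hu), slope_def_field, h]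
      have hgw := hg0 w hwρ
      field_simp
      ring
    · exact (hk.continuousOn.mono hsS).circleIntegrable hr
    · refine ContinuousOn.circleIntegrable hr (continuousOn_const.mul (ContinuousOn.inv₀
        (by fun_prop) fun u hu => sub_ne_zero.2 (hne u hu)))
  have hgw : g w = deriv φ w := dslope_same φ w
  have hd := hder w hwρ
  unfold cauchyTransform
  rw [key r₁ le_rfl (hw₁.trans hw₂).le hw₁.ne, key r₂ (hw₁.trans hw₂).le le_rfl hw₂.ne', hkint,
    integral_sub_inv_eq_zero hr₁.le hw₁, circleIntegral.integral_sub_inv_of_mem_ball (by simpa)]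
  have hpi : (2 * Real.pi * I : ℂ) ≠ 0 := Complex.two_pi_I_ne_zero
  simp only [h, hgw]
  field_simp
  ring

end CauchyTransform

/-! ### Principal parts, Laurent decompositions and simple poles -/

section CauchyTransform

open Metric Set Filter Complex

variable {φ P : ℂ → ℂ} {r : ℝ}

/-- The behaviour of the Cauchy transform at infinity. -/
theorem cauchyTransform_inv {w : ℂ} (hw : w ≠ 0) :
    cauchyTransform φ P r w⁻¹ =
      w * ((2 * Real.pi * I)⁻¹ * ∮ u in C(0, r), P u / (1 + w * -φ u)) := by
  rw [cauchyTransform, mul_left_comm, ← circleIntegral.integral_const_mul w]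
  congr 2
  funext u
  rw [show (1 + w * -φ u) = w * (w⁻¹ - φ u) by field_simp; ring, mul_div_assoc',
    mul_div_mul_left _ _ hw]

/-- Cauchy's formula at the centre: u ↦ c / (x − φ u) is holomorphic on the closed disc because x
avoids its image under φ. -/
theorem cauchyTransform_div {c x : ℂ} {ρ : ℝ} (hr : 0 < r) (hrρ : r < ρ)
    (hφ : DifferentiableOn ℂ φ (ball 0 ρ)) (hx : ∀ u, ‖u‖ ≤ r → x ≠ φ u) :
    cauchyTransform φ (fun u => c / u) r x = c / (x - φ 0) := by
  have hd : ∀ u, ‖u‖ ≤ r → DifferentiableAt ℂ (fun u => c / (x - φ u)) u := fun u hu =>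
    (differentiableAt_const c).div ((differentiableAt_const x).sub
      (hφ.differentiableAt (isOpen_ball.mem_nhds (by simpa using hu.trans_lt hrρ))))
      (sub_ne_zero.2 (hx u hu))
  have h := circleIntegral_sub_center_inv_smul_of_differentiable_on_off_countable hr
    (f := fun u => c / (x - φ u)) (c := 0) countable_empty
    (fun u hu => (hd u (by simpa using hu)).continuousAt.continuousWithinAt)
    (fun u hu => hd u (by simpa using (mem_ball_zero_iff.1 hu.1).le))
  have e : (fun u : ℂ => c / u / (x - φ u)) = fun u => (u - 0)⁻¹ • (c / (x - φ u)) := by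
    funext u
    rw [sub_zero, smul_eq_mul]
    ring
  rw [cauchyTransform, e, h, smul_eq_mul, inv_mul_cancel_left₀ Complex.two_pi_I_ne_zero]

/-- The principal part, in one coordinate of an opened node, of a differential with residue `c`
whose regular part in the other coordinate is `R(w) dw`. -/
noncomputable def principalPart (c t : ℂ) (R : ℂ → ℂ) (u : ℂ) : ℂ :=
  c / u - t / u ^ 2 * R (t / u)

theorem principalPart_zero (c : ℂ) (R : ℂ → ℂ) (u : ℂ) : principalPart c 0 R u = c / u := by
  simp [principalPart]

theorem norm_div_lt_of_div_lt {t u : ℂ} {ρ : ℝ} (hρ : 0 < ρ) (hu : ‖t‖ / ρ < ‖u‖) :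
    ‖t / u‖ < ρ := by
  have hu0 : 0 < ‖u‖ := (div_nonneg (norm_nonneg t) hρ.le).trans_lt hu
  rw [norm_div, div_lt_iff₀ hu0]
  rwa [div_lt_iff₀ hρ, mul_comm] at hu

theorem ne_zero_of_div_lt {t u : ℂ} {ρ : ℝ} (hρ : 0 < ρ) (hu : ‖t‖ / ρ < ‖u‖) : u ≠ 0 :=
  norm_pos_iff.1 ((div_nonneg (norm_nonneg t) hρ.le).trans_lt hu)

theorem differentiableAt_singular {t u : ℂ} {R : ℂ → ℂ} {ρ : ℝ} (hρ : 0 < ρ)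
    (hR : DifferentiableOn ℂ R (ball 0 ρ)) (hu : ‖t‖ / ρ < ‖u‖) :
    DifferentiableAt ℂ (fun u => t / u ^ 2 * R (t / u)) u := by
  have hu0 := ne_zero_of_div_lt hρ hu
  have h1 : DifferentiableAt ℂ (fun u => t / u) u :=
    (differentiableAt_const t).div differentiableAt_id hu0
  have h2 : DifferentiableAt ℂ R (t / u) :=
    hR.differentiableAt (isOpen_ball.mem_nhds (by simpa using norm_div_lt_of_div_lt hρ hu))
  have h3 : DifferentiableAt ℂ (fun u : ℂ => u ^ 2) u := by fun_prop
  exact ((differentiableAt_const t).div h3 (pow_ne_zero 2 hu0)).mul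
    (h2.comp u h1)

theorem differentiableAt_principalPart {c t u : ℂ} {R : ℂ → ℂ} {ρ : ℝ} (hρ : 0 < ρ)
    (hR : DifferentiableOn ℂ R (ball 0 ρ)) (hu : ‖t‖ / ρ < ‖u‖) :
    DifferentiableAt ℂ (principalPart c t R) u :=
  ((differentiableAt_const c).div differentiableAt_id (ne_zero_of_div_lt hρ hu)).sub
    (differentiableAt_singular hρ hR hu)

/-- The source of smallness: the singular part is bounded by δ times the supremum of R, and only
over the small disc |w| ≤ τ, because |t / u| ≤ τ on the circle |u| = r. -/
theorem norm_singular_le {t u : ℂ} {R : ℂ → ℂ} {A δ τ : ℝ} (hr : 0 < r) (hu : ‖u‖ = r)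
    (ht : ‖t‖ ≤ δ) (hδ : δ ≤ r * τ) (hR : ∀ w, ‖w‖ ≤ τ → ‖R w‖ ≤ A) :
    ‖t / u ^ 2 * R (t / u)‖ ≤ δ * A / r ^ 2 := by
  have h1 : ‖t / u‖ ≤ τ := by
    rw [norm_div, hu, div_le_iff₀ hr, mul_comm]
    exact ht.trans hδ
  rw [norm_mul, norm_div, norm_pow, hu, div_mul_eq_mul_div]
  gcongr
  · exact (norm_nonneg _).trans ht
  · exact hR _ h1

theorem norm_principalPart_le {c t u : ℂ} {R : ℂ → ℂ} {A δ τ : ℝ} (hr : 0 < r) (hu : ‖u‖ = r)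
    (ht : ‖t‖ ≤ δ) (hδ : δ ≤ r * τ) (hR : ∀ w, ‖w‖ ≤ τ → ‖R w‖ ≤ A) :
    ‖principalPart c t R u‖ ≤ ‖c‖ / r + δ * A / r ^ 2 := by
  refine (norm_sub_le _ _).trans (add_le_add ?_ (norm_singular_le hr hu ht hδ hR))
  rw [norm_div, hu]

/-- The integrand is holomorphic for |u| > |t| / ρ and O(|u|⁻²) at infinity. The integral over |u| =
s is therefore O(1 / s), while it does not depend on s ≥ r. -/
theorem circleIntegral_singular {t : ℂ} {R : ℂ → ℂ} {ρ : ℝ} (hρ : 0 < ρ)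
    (hR : DifferentiableOn ℂ R (ball 0 ρ)) (hr : ‖t‖ / ρ < r) :
    (∮ u in C(0, r), t / u ^ 2 * R (t / u)) = 0 := by
  have hr0 : 0 < r := (div_nonneg (norm_nonneg t) hρ.le).trans_lt hr
  have hlt : ‖t‖ / r < ρ := by
    rw [div_lt_iff₀ hρ] at hr
    rwa [div_lt_iff₀ hr0, mul_comm]
  obtain ⟨M, hM⟩ := (isCompact_closedBall (0 : ℂ) (‖t‖ / r)).exists_bound_of_continuousOn
    (hR.continuousOn.mono (closedBall_subset_ball hlt))
  have hbound : ∀ s, r ≤ s →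
      ‖∮ u in C(0, r), t / u ^ 2 * R (t / u)‖ ≤ (2 * Real.pi * (‖t‖ * M)) / s := by
    intro s hs
    have hs0 : 0 < s := hr0.trans_le hs
    rw [circleIntegral_eq_of_differentiableOn hr0 hs fun u hu _ =>
      differentiableAt_singular hρ hR (hr.trans_le hu)]
    refine (circleIntegral.norm_integral_le_of_norm_le_const (C := ‖t‖ * M / s ^ 2) hs0.le
      fun u hu => ?_).trans_eq (by field_simp)
    rw [mem_sphere_zero_iff_norm] at hu
    refine norm_singular_le (τ := ‖t‖ / r) hs0 hu le_rfl ?_ fun w hw => hM w (by simpa using hw)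
    rw [mul_div_assoc', le_div_iff₀ hr0, mul_comm s]
    gcongr
  have hlim : Tendsto (fun s : ℝ => (2 * Real.pi * (‖t‖ * M)) / s) atTop (𝓝 0) :=
    tendsto_const_nhds.div_atTop tendsto_id
  refine norm_le_zero_iff.1 (ge_of_tendsto hlim ?_)
  filter_upwards [eventually_ge_atTop r] with s hs using hbound s hs

theorem circleIntegral_principalPart {c t : ℂ} {R : ℂ → ℂ} {ρ : ℝ} (hρ : 0 < ρ)
    (hR : DifferentiableOn ℂ R (ball 0 ρ)) (hr : ‖t‖ / ρ < r) :
    (∮ u in C(0, r), principalPart c t R u) = 2 * Real.pi * I * c := by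
  have hr0 : 0 < r := (div_nonneg (norm_nonneg t) hρ.le).trans_lt hr
  have hne : ∀ u ∈ sphere (0 : ℂ) r, u ≠ 0 := fun u hu => by
    rw [mem_sphere_zero_iff_norm] at hu
    exact norm_pos_iff.1 (hu ▸ hr0)
  unfold principalPart
  rw [circleIntegral.integral_sub, circleIntegral_singular hρ hR hr, sub_zero]
  · have := circleIntegral.integral_sub_center_inv (0 : ℂ) hr0.ne'
    simp only [sub_zero] at this
    simp only [div_eq_mul_inv, circleIntegral.integral_const_mul, this]
    ring
  · exact (continuousOn_const.div continuousOn_id hne).circleIntegrable hr0.le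
  · refine ContinuousOn.circleIntegrable hr0.le fun u hu => ?_
    refine (differentiableAt_singular hρ hR ?_).continuousAt.continuousWithinAt
    rwa [mem_sphere_zero_iff_norm.1 hu]

/-- Gluing holomorphic functions on discs of increasing radii. -/
theorem exists_differentiableOn_ball_of_radii {a ρ : ℝ} (ha : a < ρ) {F : ℝ → ℂ → ℂ}
    (hF : ∀ s, a < s → s < ρ → ∀ w, ‖w‖ < s → DifferentiableAt ℂ (F s) w)
    (hEq : ∀ s s' w, a < s → s ≤ s' → s' < ρ → ‖w‖ < s → F s w = F s' w) :
    ∃ R : ℂ → ℂ, DifferentiableOn ℂ R (ball 0 ρ) ∧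
      ∀ s w, a < s → s < ρ → ‖w‖ < s → R w = F s w := by
  -- The midpoint between max(a, |w|) and ρ is a radius admissible for w, and any other admissible
  -- radius gives the same value.
  have key : ∀ s w, a < s → s < ρ → ‖w‖ < s → F ((max a ‖w‖ + ρ) / 2) w = F s w := by
    intro s w hs hs' hw
    have hmax : max a ‖w‖ < s := max_lt hs hw
    have h1 := le_max_left a ‖w‖
    have h2 := le_max_right a ‖w‖
    rcases le_total s ((max a ‖w‖ + ρ) / 2) with h | h
    · exact (hEq _ _ _ hs h (by linarith) hw).symm
    · exact hEq _ _ _ (by linarith) h hs' (by linarith)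
  refine ⟨fun w => F ((max a ‖w‖ + ρ) / 2) w, fun w hw => ?_, key⟩
  rw [mem_ball_zero_iff] at hw
  obtain ⟨s, hs, hsρ⟩ := exists_between (max_lt ha hw)
  have hs1 : a < s := (le_max_left _ _).trans_lt hs
  have hs2 : ‖w‖ < s := (le_max_right _ _).trans_lt hs
  refine DifferentiableAt.differentiableWithinAt
    ((hF s hs1 hsρ w hs2).congr_of_eventuallyEq ?_)
  filter_upwards [continuous_norm.continuousAt.eventually_lt continuousAt_const hs2] with x hx
  exact key s x hs1 hsρ hx

/-- The Laurent decomposition of a differential on an annulus given in two coordinates `u`, `v` with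
`u * v = t`. -/
theorem exists_laurent_decomposition {t : ℂ} {ρ : ℝ} (hρ : 0 < ρ) (ht : t ≠ 0) (htρ : ‖t‖ < ρ ^ 2)
    {g₁ g₂ : ℂ → ℂ} (h₁ : ∀ u, ‖t‖ / ρ < ‖u‖ → ‖u‖ < ρ → DifferentiableAt ℂ g₁ u)
    (h₁₂ : ∀ u, ‖t‖ / ρ < ‖u‖ → ‖u‖ < ρ → g₂ u = -(t / u ^ 2) * g₁ (t / u)) :
    ∃ (c : ℂ) (R₁ R₂ : ℂ → ℂ), DifferentiableOn ℂ R₁ (ball 0 ρ) ∧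
      DifferentiableOn ℂ R₂ (ball 0 ρ) ∧
      (∀ u, ‖t‖ / ρ < ‖u‖ → ‖u‖ < ρ → g₁ u = principalPart c t R₂ u + R₁ u) ∧
      ∀ u, ‖t‖ / ρ < ‖u‖ → ‖u‖ < ρ → g₂ u = principalPart (-c) t R₁ u + R₂ u := by
  set a := ‖t‖ / ρ with ha
  have htn : 0 < ‖t‖ := norm_pos_iff.2 ht
  have ha0 : 0 < a := div_pos htn hρ
  have haρ : a < ρ := by
    rw [ha, div_lt_iff₀ hρ]
    nlinarith
  have hid : DifferentiableOn ℂ (fun u : ℂ => u) (ball 0 ρ) := differentiableOn_id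
  have hg₁c : ∀ s, a < s → s < ρ → ContinuousOn g₁ (sphere 0 s) := fun s hs hs' u hu => by
    rw [mem_sphere_zero_iff_norm] at hu
    exact (h₁ u (hu ▸ hs) (hu ▸ hs')).continuousAt.continuousWithinAt
  -- The part regular inside. The sign is due to the kernel 1 / (x − u) of the transform, opposite
  -- to the one in Cauchy's formula.
  obtain ⟨R₁, hR₁, hR₁eq⟩ := exists_differentiableOn_ball_of_radii haρ
    (F := fun s w => -cauchyTransform (fun u => u) g₁ s w)
    (fun s hs hs' w hw => (differentiableAt_cauchyTransform (ha0.trans hs).le continuousOn_id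
      (hg₁c s hs hs') fun u hu h => by
        rw [mem_sphere_zero_iff_norm, ← show w = u from h] at hu
        exact hw.ne hu).neg)
    (fun s s' w hs hss hs' hw => congrArg Neg.neg (cauchyTransform_eq_of_differentiableOn
      (ha0.trans hs) hss (fun u _ _ => differentiableAt_id)
      (fun u hu hu' => h₁ u (hs.trans_le hu) (hu'.trans_lt hs'))
      fun u hu _ h => by rw [← show w = u from h] at hu; exact hw.not_ge hu))
  have hconv : ∀ s, a < s → s < ρ → a < ‖t‖ / s ∧ ‖t‖ / s < ρ := by
    intro s hs hs'
    have hs0 := ha0.trans hs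
    constructor
    · exact div_lt_div_of_pos_left htn hs0 hs'
    · rw [div_lt_iff₀ hs0]
      rw [ha, div_lt_iff₀ hρ] at hs
      linarith
  have hden : ∀ s v u, a < s → ‖v‖ < s → ‖u‖ ≤ ‖t‖ / s → (1 : ℂ) + v * -(u / t) ≠ 0 := by
    intro s v u hs hv hu h
    have hs0 := ha0.trans hs
    have h1 : v * (u / t) = 1 := by linear_combination -h
    have h2 : ‖v‖ * (‖u‖ / ‖t‖) = 1 := by rw [← norm_div, ← norm_mul, h1, norm_one]
    have h3 : ‖u‖ / ‖t‖ ≤ 1 / s := by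
      rw [div_le_div_iff₀ htn hs0]
      rw [le_div_iff₀ hs0] at hu
      linarith
    have h4 : ‖v‖ * (‖u‖ / ‖t‖) ≤ ‖v‖ * (1 / s) := by gcongr
    rw [h2, mul_one_div, le_div_iff₀ hs0] at h4
    linarith
  -- The part regular outside is u⁻¹ H(t / u). In the variable v = t / u the circle |u| = |t| / s
  -- becomes |v| = s, so H is again built from discs of increasing radii.
  obtain ⟨H, hH, hHeq⟩ := exists_differentiableOn_ball_of_radii haρ
    (F := fun s v => (2 * Real.pi * I)⁻¹ * ∮ u in C(0, ‖t‖ / s), g₁ u / (1 + v * -(u / t)))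
    (fun s hs hs' v hv => (differentiableAt_circleIntegral_div (A := fun _ => 1)
      (B := fun u => -(u / t)) (ha0.trans (hconv s hs hs').1).le
      continuousOn_const (by fun_prop) (hg₁c _ (hconv s hs hs').1 (hconv s hs hs').2)
      fun u hu => hden s v u hs hv (mem_sphere_zero_iff_norm.1 hu).le).const_mul _)
    (fun s s' v hs hss hs' hv => by
      have hle : ‖t‖ / s' ≤ ‖t‖ / s :=
        div_le_div_of_nonneg_left htn.le (ha0.trans hs) hss
      have h1 := hconv s hs (hss.trans_lt hs')
      have h2 := hconv s' (hs.trans_le hss) hs'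
      refine congrArg _ (circleIntegral_eq_of_differentiableOn (ha0.trans h2.1) hle
        fun u hu hu' => ?_).symm
      exact (h₁ u (h2.1.trans_le hu) (hu'.trans_lt h1.2)).div (by fun_prop)
        (hden s v u hs hv hu'))
  -- Expanding H(v) = H(0) + v `dslope H 0 v` at v = t / u shows that u⁻¹ H(t / u) is the principal
  -- part with residue H(0) and opposite regular part −`dslope H 0`.
  have hR₂ : DifferentiableOn ℂ (fun v => -dslope H 0 v) (ball 0 ρ) :=
    ((Complex.differentiableOn_dslope (ball_mem_nhds 0 hρ)).2 hH).neg
  have main : ∀ u, a < ‖u‖ → ‖u‖ < ρ →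
      g₁ u = principalPart (H 0) t (fun v => -dslope H 0 v) u + R₁ u := by
    intro u hu hu'
    obtain ⟨r₁, hr₁, hr₁u⟩ := exists_between hu
    obtain ⟨r₂, hur₂, hr₂⟩ := exists_between hu'
    have hj := deriv_mul_cauchyTransform_jump (φ := fun u => u) (P := g₁) ha0.le hr₁ hr₂ hid
      (fun _ _ _ _ h => h) (fun _ _ => by simp) h₁ hr₁u hur₂
    simp only [deriv_id'', one_mul] at hj
    have hu0 : u ≠ 0 := norm_pos_iff.1 (ha0.trans hu)
    have hr₁0 := ha0.trans hr₁
    have h3 : cauchyTransform (fun u => u) g₁ r₁ u = u⁻¹ * H (t / u) := by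
      have hs := hconv r₁ hr₁ (hr₁u.trans hu')
      have hlt : ‖t / u‖ < ‖t‖ / r₁ := by
        rw [norm_div]
        exact div_lt_div_of_pos_left htn hr₁0 hr₁u
      rw [hHeq (‖t‖ / r₁) (t / u) hs.1 hs.2 hlt, div_div_cancel₀ htn.ne']
      have := cauchyTransform_inv (φ := fun u => u) (P := g₁) (r := r₁) (inv_ne_zero hu0)
      rw [inv_inv] at this
      rw [this]
      congr 2
      refine congrArg (fun F : ℂ → ℂ => ∮ v in C(0, r₁), F v) (funext fun v => ?_)
      congr 2
      field_simp
    have h4 : t / u ≠ 0 := div_ne_zero ht hu0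
    rw [hR₁eq r₂ u (hu.trans hur₂) hr₂ hur₂, principalPart, dslope_of_ne H h4, slope_def_field]
    rw [h3] at hj
    rw [← sub_eq_iff_eq_add'] at hj
    rw [← hj]
    generalize H (t / u) = x
    generalize cauchyTransform (fun u => u) g₁ r₂ u = y
    rw [sub_zero]
    field_simp
    ring
  refine ⟨H 0, R₁, fun v => -dslope H 0 v, hR₁, hR₂, main, fun u hu hu' => ?_⟩
  have hu0 : u ≠ 0 := norm_pos_iff.1 (ha0.trans hu)
  have hv := hconv ‖u‖ hu hu'
  rw [← norm_div] at hv
  -- The involution u ↦ t / u exchanges the two regular parts and reverses the residue.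
  rw [h₁₂ u hu hu', main _ hv.1 hv.2]
  simp only [principalPart]
  rw [div_div_cancel₀ ht]
  field_simp
  ring

/-- A differential with a simple pole at `φ 0`, in the coordinate given by `φ`. -/
theorem exists_regular_part_of_hasSimplePole {f : ℂ → ℂ} {c : ℂ} {ρ : ℝ} (hρ : 0 < ρ)
    (hφ : DifferentiableOn ℂ φ (ball 0 ρ)) (hinj : InjOn φ (ball 0 ρ)) (hder : deriv φ 0 ≠ 0)
    (hf : HasSimplePole f (φ 0) c)
    (hg : ∀ u, u ≠ 0 → ‖u‖ < ρ → DifferentiableAt ℂ (fun u => f (φ u) * deriv φ u) u) :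
    ∃ R : ℂ → ℂ, DifferentiableOn ℂ R (ball 0 ρ) ∧
      ∀ u, u ≠ 0 → ‖u‖ < ρ → f (φ u) * deriv φ u = c / u + R u := by
  have h0 : (0 : ℂ) ∈ ball (0 : ℂ) ρ := mem_ball_self hρ
  have hφ0 : DifferentiableAt ℂ φ 0 := hφ.differentiableAt (ball_mem_nhds 0 hρ)
  obtain ⟨b, hb, hfb⟩ := hf
  set g := fun u => f (φ u) * deriv φ u
  -- The singularity of u g(u) at 0 is removable, with value c there; the regular part is then its
  -- divided difference at 0.
  set G := Function.update (fun u => u * g u) 0 c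
  have hGne : ∀ u, u ≠ 0 → G u = u * g u := fun u hu => Function.update_of_ne hu _ _
  have hG0 : G 0 = c := Function.update_self _ _ _
  have hderc : ContinuousAt (deriv φ) 0 :=
    ((hφ.deriv isOpen_ball).differentiableAt (ball_mem_nhds 0 hρ)).continuousAt
  have hslope : Tendsto (fun u => (slope φ 0 u)⁻¹) (𝓝[≠] 0) (𝓝 (deriv φ 0)⁻¹) :=
    (hasDerivAt_iff_tendsto_slope.1 hφ0.hasDerivAt).inv₀ hder
  have hcont : ContinuousAt G 0 := by
    rw [continuousAt_update_same]
    have htend : Tendsto φ (𝓝[≠] 0) (𝓝[≠] φ 0) := by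
      refine tendsto_nhdsWithin_iff.2 ⟨hφ0.continuousAt.tendsto.mono_left nhdsWithin_le_nhds, ?_⟩
      filter_upwards [self_mem_nhdsWithin, nhdsWithin_le_nhds (ball_mem_nhds (0 : ℂ) hρ)] with u
        hu hu' h
      exact hu (hinj hu' h0 h)
    have hlim : Tendsto (fun u => c * (slope φ 0 u)⁻¹ * deriv φ u + u * b (φ u) * deriv φ u)
        (𝓝[≠] 0) (𝓝 (c * (deriv φ 0)⁻¹ * deriv φ 0 + 0 * b (φ 0) * deriv φ 0)) := by
      have h1 : Tendsto (deriv φ) (𝓝[≠] 0) (𝓝 (deriv φ 0)) :=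
        hderc.tendsto.mono_left nhdsWithin_le_nhds
      have h2 : Tendsto (fun u => b (φ u)) (𝓝[≠] 0) (𝓝 (b (φ 0))) :=
        hb.continuousAt.tendsto.comp (htend.mono_right nhdsWithin_le_nhds)
      have h3 : Tendsto (fun u : ℂ => u) (𝓝[≠] 0) (𝓝 0) := nhdsWithin_le_nhds
      exact ((hslope.const_mul c).mul h1).add ((h3.mul h2).mul h1)
    rw [inv_mul_cancel_right₀ hder, zero_mul, zero_mul, add_zero] at hlim
    refine hlim.congr' ?_
    filter_upwards [self_mem_nhdsWithin, htend.eventually hfb,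
      nhdsWithin_le_nhds (ball_mem_nhds (0 : ℂ) hρ)] with u hu hfu hu'
    have hne : φ u - φ 0 ≠ 0 := sub_ne_zero.2 fun h => hu (hinj hu' h0 h)
    have hu0 : u ≠ 0 := hu
    simp only [g, hfu, slope_def_field, sub_zero]
    field_simp
  have hGd : DifferentiableOn ℂ G (ball 0 ρ) := by
    refine (Complex.differentiableOn_compl_singleton_and_continuousAt_iff
      (ball_mem_nhds 0 hρ)).1 ⟨fun u hu => ?_, hcont⟩
    have hu0 : u ≠ 0 := hu.2
    have hu1 : ‖u‖ < ρ := by simpa using hu.1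
    refine DifferentiableAt.differentiableWithinAt ?_
    refine (differentiableAt_id.mul (hg u hu0 hu1)).congr_of_eventuallyEq ?_
    filter_upwards [isOpen_ne.mem_nhds hu0] with x hx using hGne x hx
  refine ⟨dslope G 0, (Complex.differentiableOn_dslope (ball_mem_nhds 0 hρ)).2 hGd,
    fun u hu hu' => ?_⟩
  rw [dslope_of_ne G hu, slope_def_field, hGne u hu, hG0, sub_zero]
  field_simp
  ring

theorem hasSimplePole_of_regular_part {ψ R : ℂ → ℂ} {S : Set ℂ} {p c : ℂ} {ρ : ℝ}
    (hS : IsOpen S) (hp : p ∈ S) (hψ : DifferentiableOn ℂ ψ S) (hmaps : MapsTo ψ S (ball 0 ρ))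
    (hψp : ψ p = 0) (hder : deriv ψ p ≠ 0) (hR : DifferentiableOn ℂ R (ball 0 ρ)) {f : ℂ → ℂ}
    (hf : ∀ᶠ x in 𝓝[≠] p, f x = (c / ψ x + R (ψ x)) * deriv ψ x) : HasSimplePole f p c := by
  have hSn := hS.mem_nhds hp
  have hk : AnalyticAt ℂ (dslope ψ p) p :=
    ((Complex.differentiableOn_dslope hSn).2 hψ).analyticAt hSn
  have hkp : dslope ψ p p ≠ 0 := by rwa [dslope_same]
  have hψ' : AnalyticAt ℂ (deriv ψ) p := (hψ.analyticAt hSn).deriv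
  -- With this q, c ψ' / ψ = c q(x) / (x − p). As q(p) = 1, the residue stays exactly c under the
  -- change of coordinate.
  set q := fun x => deriv ψ x / dslope ψ p x
  have hq : AnalyticAt ℂ q p := hψ'.div hk hkp
  obtain ⟨T, hT, hqT⟩ : ∃ T ∈ 𝓝 p, DifferentiableOn ℂ q T := by
    obtain ⟨T, hT, hT'⟩ := hq.exists_mem_nhds_analyticOnNhd
    exact ⟨T, hT, hT'.differentiableOn⟩
  have hm : AnalyticAt ℂ (dslope q p) p :=
    ((Complex.differentiableOn_dslope hT).2 hqT).analyticAt hT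
  have hRψ : AnalyticAt ℂ (fun x => R (ψ x)) p :=
    (hR.comp hψ hmaps).analyticAt hSn
  refine ⟨fun x => c * dslope q p x + R (ψ x) * deriv ψ x,
    (analyticAt_const.mul hm).add (hRψ.mul hψ'), ?_⟩
  filter_upwards [hf, self_mem_nhdsWithin, nhdsWithin_le_nhds (hk.continuousAt.eventually_ne hkp)]
    with x hx hxp hkx
  have hxp' : x - p ≠ 0 := sub_ne_zero.2 hxp
  have e1 : ψ x = (x - p) * dslope ψ p x := by
    simpa [smul_eq_mul, hψp] using (sub_smul_dslope ψ p x).symm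
  have e2 : q p = 1 := by
    simp only [q, dslope_same]
    exact div_self hder
  have e3 : (x - p) * dslope q p x = q x - 1 := by
    simpa [smul_eq_mul, e2] using sub_smul_dslope q p x
  have e4 : c / ψ x * deriv ψ x = c / (x - p) * q x := by
    rw [e1]
    simp only [q]
    field_simp
  rw [hx, add_mul, e4, show q x = 1 + (x - p) * dslope q p x by rw [e3]; ring]
  field_simp
  ring

end CauchyTransform

/-! ### Half-edges and the geometry of admissible coordinates -/

/-- The other end of an edge. -/
def Side.opp : Side → Side
  | Side.minus => Side.plus
  | Side.plus => Side.minus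

instance : Finite Side :=
  Finite.of_surjective (fun b : Bool => if b then Side.plus else Side.minus) fun s => by
    cases s
    · exact ⟨false, rfl⟩
    · exact ⟨true, rfl⟩

namespace OrientedMultigraph

variable {V E : Type*} (G : OrientedMultigraph V E)

/-- The vertex at a half-edge. -/
def vtx (h : E × Side) : V := G.vertex h.1 h.2

/-- The half-edges at a vertex. -/
noncomputable def halfEdges (v : V) : Finset (E × Side) :=
  Set.Finite.toFinset (s := {h | G.vtx h = v}) <| by
    refine ((G.finite_degree v).prod Set.finite_univ).subset ?_
    rintro ⟨e, s⟩ h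
    refine ⟨?_, Set.mem_univ _⟩
    cases s
    · exact Or.inl h
    · exact Or.inr h

@[simp] theorem mem_halfEdges {v : V} {h : E × Side} : h ∈ G.halfEdges v ↔ G.vtx h = v := by
  simp [halfEdges]

end OrientedMultigraph

namespace NodeCoordinates

variable {E : Type*} (X : NodeCoordinates E)

/-- The inverse of the coordinate at a half-edge. -/
noncomputable def param (h : E × Side) : ℂ → ℂ := (X.z h.1 h.2).symm

/-- The coordinate at a half-edge. -/
noncomputable def coord (h : E × Side) : ℂ → ℂ := X.z h.1 h.2

/-- The domain of the coordinate at a half-edge. -/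
def disc (h : E × Side) : Set ℂ := (X.z h.1 h.2).source

/-- The point at a half-edge. -/
def center (h : E × Side) : ℂ := X.p h.1 h.2

theorem isOpen_disc (h : E × Side) : IsOpen (X.disc h) := (X.z h.1 h.2).open_source

theorem param_coord {h : E × Side} {x : ℂ} (hx : x ∈ X.disc h) : X.param h (X.coord h x) = x :=
  (X.z h.1 h.2).left_inv hx

end NodeCoordinates

namespace AdmissibleCoordinates

open Metric Set

variable {V E : Type*} {G : OrientedMultigraph V E} {X : NodeCoordinates E} {ρ c₁ c₂ : ℝ}
  (hX : AdmissibleCoordinates G X ρ c₁ c₂)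
include hX

theorem differentiableOn_param (h : E × Side) : DifferentiableOn ℂ (X.param h) (ball 0 ρ) := by
  rw [← hX.target_eq h.1 h.2]
  exact hX.holomorphic_symm h.1 h.2

theorem differentiableAt_param {h : E × Side} {w : ℂ} (hw : ‖w‖ < ρ) :
    DifferentiableAt ℂ (X.param h) w :=
  (hX.differentiableOn_param h).differentiableAt (isOpen_ball.mem_nhds (by simpa using hw))

theorem continuousOn_param_sphere {h : E × Side} {r : ℝ} (hr : r < ρ) :
    ContinuousOn (X.param h) (sphere 0 r) :=
  (hX.differentiableOn_param h).continuousOn.mono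
    (sphere_subset_closedBall.trans (closedBall_subset_ball hr))

theorem differentiableOn_coord (h : E × Side) : DifferentiableOn ℂ (X.coord h) (X.disc h) :=
  hX.holomorphic h.1 h.2

theorem param_mem {h : E × Side} {w : ℂ} (hw : ‖w‖ < ρ) : X.param h w ∈ X.disc h :=
  (X.z h.1 h.2).map_target (by rw [hX.target_eq]; simpa using hw)

theorem coord_param {h : E × Side} {w : ℂ} (hw : ‖w‖ < ρ) : X.coord h (X.param h w) = w :=
  (X.z h.1 h.2).right_inv (by rw [hX.target_eq]; simpa using hw)

theorem norm_coord_lt {h : E × Side} {x : ℂ} (hx : x ∈ X.disc h) : ‖X.coord h x‖ < ρ := by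
  have := (X.z h.1 h.2).map_source hx
  rw [hX.target_eq] at this
  exact mem_ball_zero_iff.1 this

theorem injOn_param (h : E × Side) : InjOn (X.param h) (ball 0 ρ) := fun a ha b hb hab => by
  rw [mem_ball_zero_iff] at ha hb
  rw [← hX.coord_param (h := h) ha, ← hX.coord_param (h := h) hb, hab]

theorem center_mem_disc (h : E × Side) : X.center h ∈ X.disc h := hX.center_mem h.1 h.2

theorem coord_center (h : E × Side) : X.coord h (X.center h) = 0 := hX.map_center h.1 h.2

theorem param_zero (h : E × Side) : X.param h 0 = X.center h := by
  rw [← hX.coord_center h, X.param_coord (hX.center_mem_disc h)]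

theorem norm_param_sub_le {h : E × Side} {w : ℂ} (hw : ‖w‖ < ρ) :
    ‖X.param h w - X.center h‖ ≤ c₂ * ‖w‖ := by
  have := (hX.comparison h.1 h.2 _ (hX.param_mem hw)).2
  rwa [show X.z h.1 h.2 (X.param h w) = w from hX.coord_param hw] at this

theorem le_norm_param_sub {h : E × Side} {w : ℂ} (hw : ‖w‖ < ρ) :
    c₁ * ‖w‖ ≤ ‖X.param h w - X.center h‖ := by
  have := (hX.comparison h.1 h.2 _ (hX.param_mem hw)).1
  rwa [show X.z h.1 h.2 (X.param h w) = w from hX.coord_param hw] at this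

theorem norm_sub_center_lt {h : E × Side} {x : ℂ} (hx : x ∈ X.disc h) :
    ‖x - X.center h‖ < c₂ * ρ :=
  ((hX.comparison h.1 h.2 x hx).2).trans_lt
    (mul_lt_mul_of_pos_left (hX.norm_coord_lt hx) hX.c₂_pos)

theorem deriv_coord_mul_deriv_param {h : E × Side} {w : ℂ} (hw : ‖w‖ < ρ) :
    deriv (X.coord h) (X.param h w) * deriv (X.param h) w = 1 := by
  refine deriv_mul_deriv_of_leftInverse (hX.differentiableAt_param hw)
    ((hX.differentiableOn_coord h).differentiableAt
      ((X.isOpen_disc h).mem_nhds (hX.param_mem hw))) ?_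
  filter_upwards [isOpen_ball.mem_nhds (show w ∈ ball (0 : ℂ) ρ by simpa using hw)] with u hu
  exact hX.coord_param (by simpa using hu)

theorem deriv_param_ne_zero {h : E × Side} {w : ℂ} (hw : ‖w‖ < ρ) : deriv (X.param h) w ≠ 0 :=
  right_ne_zero_of_mul_eq_one (hX.deriv_coord_mul_deriv_param hw)

theorem disjoint_disc {h h' : E × Side} (hv : G.vtx h = G.vtx h') (hne : h ≠ h') :
    Disjoint (X.disc h) (X.disc h') :=
  hX.disjoint h.1 h.2 h'.1 h'.2 hv hne

theorem eq_of_mem_disc {h h' : E × Side} (hv : G.vtx h = G.vtx h') {x : ℂ} (hx : x ∈ X.disc h)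
    (hx' : x ∈ X.disc h') : h = h' := by
  by_contra hne
  exact Set.disjoint_left.1 (hX.disjoint_disc hv hne) hx hx'

/-- The ball is connected and meets the open disc domain, so it suffices that this domain has no
further limit points inside the ball. By the comparison, its points closer than σ c₁ to the centre
have coordinate at most σ < ρ, hence lie in the compact image of a closed disc. -/
theorem ball_center_subset (h : E × Side) : ball (X.center h) (ρ * c₁) ⊆ X.disc h := by
  refine (convex_ball _ _).isPreconnected.subset_of_closure_inter_subset (X.isOpen_disc h)
    ⟨X.center h, mem_ball_self (mul_pos hX.rho_pos hX.c₁_pos), hX.center_mem_disc h⟩ ?_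
  rintro y ⟨hy, hyb⟩
  rw [mem_ball, dist_eq_norm, ← div_lt_iff₀ hX.c₁_pos] at hyb
  obtain ⟨σ, hyσ, hσ⟩ := exists_between hyb
  have hK : IsCompact (X.param h '' closedBall 0 σ) :=
    (isCompact_closedBall 0 σ).image_of_continuousOn
      ((hX.differentiableOn_param h).continuousOn.mono (closedBall_subset_ball hσ))
  have hKsub : X.param h '' closedBall 0 σ ⊆ X.disc h := by
    rintro _ ⟨w, hw, rfl⟩
    exact hX.param_mem ((by simpa using hw : ‖w‖ ≤ σ).trans_lt hσ)
  have hsub : X.disc h ∩ ball (X.center h) (σ * c₁) ⊆ X.param h '' closedBall 0 σ := by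
    rintro x ⟨hx, hxb⟩
    refine ⟨X.coord h x, ?_, X.param_coord hx⟩
    rw [mem_ball, dist_eq_norm] at hxb
    have hlt := (hX.comparison h.1 h.2 x hx).1.trans_lt hxb
    rw [mul_comm] at hlt
    rw [mem_closedBall_zero_iff]
    exact (lt_of_mul_lt_mul_right hlt hX.c₁_pos.le).le
  refine hKsub (hK.isClosed.closure_subset_iff.2 hsub (isOpen_ball.closure_inter ⟨hy, ?_⟩))
  rwa [mem_ball, dist_eq_norm, ← div_lt_iff₀ hX.c₁_pos]

/-- Cauchy's estimate on the circle of radius ρ / 4 around w: it stays in |u| ≤ 3ρ / 4, where the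
comparison bounds the function by 3c₂ρ / 4. -/
theorem norm_deriv_param_le {h : E × Side} {w : ℂ} (hw : ‖w‖ ≤ ρ / 2) :
    ‖deriv (X.param h) w‖ ≤ 3 * c₂ := by
  have hρ := hX.rho_pos
  have hd : DifferentiableOn ℂ (fun u => X.param h u - X.center h) (ball 0 ρ) :=
    (hX.differentiableOn_param h).sub_const _
  have hsub : closedBall w (ρ / 4) ⊆ ball 0 ρ := fun u hu => by
    rw [mem_closedBall, dist_eq_norm] at hu
    rw [mem_ball_zero_iff]
    have := norm_le_norm_add_norm_sub' u w
    linarith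
  have := Complex.norm_deriv_le_of_forall_mem_sphere_norm_le (c := w) (R := ρ / 4)
    (C := c₂ * (3 * ρ / 4)) (f := fun u => X.param h u - X.center h) (by positivity)
    ((hd.mono hsub).diffContOnCl_ball (U := closedBall w (ρ / 4)) subset_rfl) fun u hu => by
      have h1 := hsub (sphere_subset_closedBall hu)
      rw [mem_ball_zero_iff] at h1
      refine (hX.norm_param_sub_le h1).trans (mul_le_mul_of_nonneg_left ?_ hX.c₂_pos.le)
      rw [mem_sphere, dist_eq_norm] at hu
      have := norm_le_norm_add_norm_sub' u w
      linarith
  rw [deriv_sub_const_fun] at this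
  refine this.trans_eq ?_
  field_simp

theorem le_norm_param_sub_center {h h' : E × Side} (hv : G.vtx h = G.vtx h') (hne : h ≠ h') {u : ℂ}
    (hu : ‖u‖ < ρ) : ρ * c₁ ≤ ‖X.param h' u - X.center h‖ := by
  by_contra hlt
  rw [not_le, ← dist_eq_norm] at hlt
  exact hne (hX.eq_of_mem_disc hv (hX.ball_center_subset h hlt) (hX.param_mem hu))

theorem param_ne {h h' : E × Side} (hv : G.vtx h = G.vtx h') (hne : h ≠ h') {w u : ℂ}
    (hw : ‖w‖ < ρ) (hu : ‖u‖ < ρ) : X.param h w ≠ X.param h' u := fun heq =>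
  hne (hX.eq_of_mem_disc hv (hX.param_mem hw) (heq ▸ hX.param_mem hu))

/-- Finite degree is used here: the complement is a finite union of compact images of closed discs.
-/
theorem isOpen_piece {t : E → ℂ} (ht : ∀ e, ‖t e‖ / ρ < ρ) (v : V) :
    IsOpen (NodeCoordinates.piece G X ρ t v) := by
  have hcl : IsClosed (⋃ h ∈ G.halfEdges v, X.param h '' closedBall 0 (‖t h.1‖ / ρ)) :=
    (G.halfEdges v).finite_toSet.isClosed_biUnion fun h _ =>
      ((isCompact_closedBall 0 _).image_of_continuousOn ((hX.differentiableOn_param h).continuousOn.mono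
        (closedBall_subset_ball (ht _)))).isClosed
  convert hcl.isOpen_compl using 1
  ext x
  simp only [NodeCoordinates.piece, mem_ofPred_eq, mem_compl_iff, mem_iUnion, not_exists, mem_image,
    OrientedMultigraph.mem_halfEdges, mem_closedBall_zero_iff, not_and, exists_prop]
  constructor
  · rintro hx h hv w hw rfl
    have hw' : ‖w‖ < ρ := hw.trans_lt (ht _)
    have := hx h.1 h.2 hv (hX.param_mem hw')
    rw [show X.z h.1 h.2 (X.param h w) = w from hX.coord_param hw'] at this
    exact this.not_ge hw
  · intro hx e s hv hxs
    by_contra hle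
    exact hx (e, s) hv _ (not_lt.1 hle) (X.param_coord (h := (e, s)) hxs)

theorem param_mem_piece {t : E → ℂ} {h : E × Side} {w : ℂ} (hw : ‖t h.1‖ / ρ < ‖w‖)
    (hw' : ‖w‖ < ρ) : X.param h w ∈ NodeCoordinates.piece G X ρ t (G.vtx h) := by
  intro e s hv hx
  obtain rfl : h = (e, s) := hX.eq_of_mem_disc hv.symm (hX.param_mem hw') hx
  rwa [show X.z e s (X.param (e, s) w) = w from hX.coord_param (h := (e, s)) hw']

end AdmissibleCoordinates

/-! ### Sums of Cauchy transforms at a vertex -/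

namespace NodeCoordinates

variable {V E : Type*} (G : OrientedMultigraph V E) (X : NodeCoordinates E)

/-- The sum, over the half-edges at a vertex, of the Cauchy transforms of `P h` along the circles
`|z_h| = r`. -/
noncomputable def field (P : E × Side → ℂ → ℂ) (r : ℝ) (v : V) (x : ℂ) : ℂ :=
  ∑ h ∈ G.halfEdges v, cauchyTransform (X.param h) (P h) r x

/-- The principal parts at the half-edges of a differential with residues `c` and
regular parts `R`. -/
noncomputable def parts (t : E → ℂ) (c : E × Side → ℂ) (R : E × Side → ℂ → ℂ) (h : E × Side) :
    ℂ → ℂ :=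
  principalPart (c h) (t h.1) (R (h.1, h.2.opp))

/-- The point `x` is outside of the closed discs `|z_h| ≤ r` at the vertex `v`. -/
def Outside (r : ℝ) (v : V) (x : ℂ) : Prop :=
  ∀ h, G.vtx h = v → ∀ u, ‖u‖ ≤ r → x ≠ X.param h u

end NodeCoordinates

section DifferentialsFromGluingData

open Metric Set Filter NodeCoordinates

section Field

variable {V E : Type*} {G : OrientedMultigraph V E} {X : NodeCoordinates E} {ρ c₁ c₂ : ℝ}
  {P : E × Side → ℂ → ℂ} {a r : ℝ}

theorem norm_field_le {v : V} {M : E × Side → ℝ} {d : ℝ} {x : ℂ} (hr : 0 ≤ r) (hd : 0 < d)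
    (hP : ∀ h, ∀ u, ‖u‖ = r → ‖P h u‖ ≤ M h)
    (hx : ∀ h, G.vtx h = v → ∀ u, ‖u‖ = r → d ≤ ‖x - X.param h u‖) :
    ‖field G X P r v x‖ ≤ r / d * ∑ h ∈ G.halfEdges v, M h := by
  rw [Finset.mul_sum]
  refine norm_sum_le_of_le _ fun h hh => ?_
  rw [G.mem_halfEdges] at hh
  refine (norm_cauchyTransform_le hr hd (fun u hu => hP h u (mem_sphere_zero_iff_norm.1 hu))
    fun u hu => hx h hh u (mem_sphere_zero_iff_norm.1 hu)).trans_eq ?_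
  ring

namespace AdmissibleCoordinates

variable (hX : AdmissibleCoordinates G X ρ c₁ c₂)
include hX

theorem hasDerivAt_glue {t : E → ℂ} {e : E} {x : ℂ} (hx : x ∈ X.disc (e, Side.minus))
    (hx' : ‖t e‖ / ρ < ‖X.coord (e, Side.minus) x‖) :
    HasDerivAt (X.glue t e)
      (deriv (X.param (e, Side.plus)) (t e / X.coord (e, Side.minus) x) *
        (-(t e) * deriv (X.coord (e, Side.minus)) x / X.coord (e, Side.minus) x ^ 2)) x := by
  have h1 : HasDerivAt (fun y => t e / X.coord (e, Side.minus) y)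
      (-(t e) * deriv (X.coord (e, Side.minus)) x / X.coord (e, Side.minus) x ^ 2) x := by
    have := (hasDerivAt_const x (t e)).fun_div ((hX.differentiableOn_coord
      (e, Side.minus)).differentiableAt ((X.isOpen_disc _).mem_nhds hx)).hasDerivAt
      (ne_zero_of_div_lt hX.rho_pos hx')
    simpa using this
  have hq := norm_div_lt_of_div_lt hX.rho_pos hx'
  exact HasDerivAt.comp x (hX.differentiableAt_param (h := (e, Side.plus)) hq).hasDerivAt h1

theorem differentiableAt_field {v : V} {x : ℂ} (hr : 0 ≤ r) (hrρ : r < ρ)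
    (hP : ∀ h, ContinuousOn (P h) (sphere 0 r))
    (hx : ∀ h, G.vtx h = v → ∀ u, ‖u‖ = r → x ≠ X.param h u) :
    DifferentiableAt ℂ (field G X P r v) x := by
  unfold field
  refine DifferentiableAt.fun_sum fun h hh => ?_
  rw [G.mem_halfEdges] at hh
  exact differentiableAt_cauchyTransform hr (hX.continuousOn_param_sphere hrρ)
    (hP h) fun u hu => hx h hh u (mem_sphere_zero_iff_norm.1 hu)

theorem param_ne_param_of_norm_ne {h h' : E × Side} (hv : G.vtx h' = G.vtx h) {w u : ℂ}
    (hw : ‖w‖ < ρ) (hu : ‖u‖ < ρ) (hne : ‖u‖ ≠ ‖w‖) : X.param h w ≠ X.param h' u := by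
  intro heq
  by_cases hh : h = h'
  · subst hh
    rw [hX.injOn_param h (by simpa using hw) (by simpa using hu) heq] at hne
    exact hne rfl
  · exact hX.param_ne hv.symm hh hw hu heq

theorem outside_of_notMem_disc {v : V} {x : ℂ} (hr : r < ρ)
    (hx : ∀ h, G.vtx h = v → x ∉ X.disc h) : Outside G X r v x := by
  rintro h hh u hu rfl
  exact hx h hh (hX.param_mem (hu.trans_lt hr))

theorem isOpen_outside (hr : r < ρ) (v : V) : IsOpen {x | Outside G X r v x} := by
  have hcl : IsClosed (⋃ h ∈ G.halfEdges v, X.param h '' closedBall 0 r) :=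
    (G.halfEdges v).finite_toSet.isClosed_biUnion fun h _ =>
      ((isCompact_closedBall 0 _).image_of_continuousOn ((hX.differentiableOn_param h).continuousOn.mono
        (closedBall_subset_ball hr))).isClosed
  convert hcl.isOpen_compl using 1
  ext x
  simp only [Outside, mem_ofPred_eq, mem_compl_iff, mem_iUnion, not_exists, mem_image,
    OrientedMultigraph.mem_halfEdges, mem_closedBall_zero_iff, not_and, ne_eq, @eq_comm _ x]

theorem field_param_eq {h : E × Side} {w : ℂ} {r₁ r₂ : ℝ} (ha : 0 ≤ a) (h₁ : a < r₁)
    (h₁₂ : r₁ ≤ r₂) (h₂ : r₂ < ρ)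
    (hP : ∀ h u, a < ‖u‖ → ‖u‖ < ρ → DifferentiableAt ℂ (P h) u) (hw : ‖w‖ < r₁) :
    field G X P r₁ (G.vtx h) (X.param h w) = field G X P r₂ (G.vtx h) (X.param h w) := by
  refine Finset.sum_congr rfl fun h' hh' => ?_
  rw [G.mem_halfEdges] at hh'
  exact cauchyTransform_eq_of_differentiableOn (ha.trans_lt h₁) h₁₂
    (fun u _ hu => hX.differentiableAt_param (hu.trans_lt h₂))
    (fun u hu hu' => hP h' u (h₁.trans_le hu) (hu'.trans_lt h₂))
    fun u hu hu' => hX.param_ne_param_of_norm_ne hh' (hw.trans_le (h₁₂.trans h₂.le))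
      (hu'.trans_lt h₂) (hw.trans_le hu).ne'

/-- Only the summand of `h` itself jumps. The circles of the other half-edges can be deformed
freely, since their discs do not contain the point. -/
theorem field_param_jump {h : E × Side} {w : ℂ} {r₁ r₂ : ℝ} (ha : 0 ≤ a) (h₁ : a < r₁)
    (h₂ : r₂ < ρ) (hP : ∀ h u, a < ‖u‖ → ‖u‖ < ρ → DifferentiableAt ℂ (P h) u)
    (hw₁ : r₁ < ‖w‖) (hw₂ : ‖w‖ < r₂) :
    deriv (X.param h) w * field G X P r₁ (G.vtx h) (X.param h w) =
      deriv (X.param h) w * field G X P r₂ (G.vtx h) (X.param h w) + P h w := by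
  classical
  have hh : h ∈ G.halfEdges (G.vtx h) := by simp
  unfold field
  rw [← Finset.add_sum_erase _ _ hh, ← Finset.add_sum_erase _ _ hh, mul_add, mul_add,
    deriv_mul_cauchyTransform_jump ha h₁ h₂ (hX.differentiableOn_param h) (hX.injOn_param h)
      (fun u hu => hX.deriv_param_ne_zero (by simpa using hu)) (hP h) hw₁ hw₂]
  have : ∑ h' ∈ (G.halfEdges (G.vtx h)).erase h,
      cauchyTransform (X.param h') (P h') r₁ (X.param h w) =
      ∑ h' ∈ (G.halfEdges (G.vtx h)).erase h,
        cauchyTransform (X.param h') (P h') r₂ (X.param h w) := by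
    refine Finset.sum_congr rfl fun h' hh' => ?_
    obtain ⟨hne, hh'⟩ := Finset.mem_erase.1 hh'
    rw [G.mem_halfEdges] at hh'
    exact cauchyTransform_eq_of_differentiableOn (ha.trans_lt h₁) (hw₁.trans hw₂).le
      (fun u _ hu => hX.differentiableAt_param (hu.trans_lt h₂))
      (fun u hu hu' => hP h' u (h₁.trans_le hu) (hu'.trans_lt h₂))
      fun u hu hu' => hX.param_ne hh'.symm hne.symm (hw₂.trans h₂) (hu'.trans_lt h₂)
  rw [this]
  ring

/-- Expansion at infinity. The coefficient of 1 / x is a sum of residues, and its vanishing turns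
the decay O(1 / x) into the decay O(1 / x²) of a differential holomorphic at infinity. -/
theorem exists_field_inv (hr : 0 ≤ r) (hrρ : r < ρ) (hP : ∀ h, ContinuousOn (P h) (sphere 0 r))
    (v : V) : ∃ K : ℂ → ℂ, AnalyticAt ℂ K 0 ∧
      K 0 = ∑ h ∈ G.halfEdges v, (2 * Real.pi * Complex.I)⁻¹ * ∮ u in C(0, r), P h u ∧
      ∀ w, w ≠ 0 → field G X P r v w⁻¹ = w * K w := by
  refine ⟨fun w => ∑ h ∈ G.halfEdges v,
    (2 * Real.pi * Complex.I)⁻¹ * ∮ u in C(0, r), P h u / (1 + w * -X.param h u), ?_, ?_, ?_⟩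
  · refine Finset.analyticAt_fun_sum _ fun h _ => analyticAt_const.mul ?_
    rw [Complex.analyticAt_iff_eventually_differentiableAt]
    obtain ⟨M, hM⟩ := (isCompact_sphere (0 : ℂ) r).exists_bound_of_continuousOn
      (hX.continuousOn_param_sphere (h := h) hrρ)
    have hlim : Tendsto (fun w : ℂ => ‖w‖ * M) (𝓝 0) (𝓝 0) := by
      have : Continuous fun w : ℂ => ‖w‖ * M := by fun_prop
      simpa using this.tendsto 0
    filter_upwards [hlim.eventually_lt_const zero_lt_one] with w hw
    refine differentiableAt_circleIntegral_div hr continuousOn_const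
      (hX.continuousOn_param_sphere hrρ).neg (hP h) fun u hu h0 => ?_
    have h0' : 1 + w * -X.param h u = 0 := h0
    have h1 : w * X.param h u = 1 := by linear_combination -h0'
    have h2 : ‖w‖ * ‖X.param h u‖ = 1 := by rw [← norm_mul, h1, norm_one]
    have := mul_le_mul_of_nonneg_left (hM u hu) (norm_nonneg w)
    linarith
  · simp
  · intro w hw
    rw [field, Finset.mul_sum]
    exact Finset.sum_congr rfl fun h _ => cauchyTransform_inv hw

theorem eventually_outside_inv (hr : r < ρ) (v : V) :
    ∀ᶠ w in 𝓝[≠] (0 : ℂ), Outside G X r v w⁻¹ := by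
  have : ∀ h ∈ G.halfEdges v, ∀ᶠ w in 𝓝[≠] (0 : ℂ), ∀ u, ‖u‖ ≤ r → w⁻¹ ≠ X.param h u := by
    intro h _
    have h1 : Tendsto (fun w : ℂ => ‖w⁻¹‖) (𝓝[≠] (0 : ℂ)) atTop :=
      tendsto_norm_inv_nhdsNE_zero_atTop
    filter_upwards [h1.eventually_gt_atTop (‖X.center h‖ + c₂ * ρ)] with w hw u hu heq
    have h2 := hX.norm_sub_center_lt (hX.param_mem (h := h) (hu.trans_lt hr))
    have h3 := norm_le_norm_add_norm_sub' (X.param h u) (X.center h)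
    rw [heq] at hw
    linarith
  have h2 := (Filter.eventually_all_finset (G.halfEdges v)).2 this
  filter_upwards [h2] with w hw h hh using hw h (by simpa using hh)

end AdmissibleCoordinates

end Field

/-! ### From gluing data to regular differentials -/

/-- Residues `c` and regular parts `R` at the half-edges which fit together to a regular
differential on the surface obtained by opening the nodes. -/
structure GluingData {V E : Type*} (G : OrientedMultigraph V E) (X : NodeCoordinates E) (ρ : ℝ)
    (t : E → ℂ) (r : ℝ) (c : E × Side → ℂ) (R : E × Side → ℂ → ℂ) : Prop where
  residue_minus : ∀ e, c (e, Side.minus) = -c (e, Side.plus)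
  sum_residues : ∀ v, ∑ h ∈ G.halfEdges v, c h = 0
  differentiableOn : ∀ h, DifferentiableOn ℂ (R h) (ball 0 ρ)
  regular_eq : ∀ h w, ‖w‖ < r →
    R h w = deriv (X.param h) w * field G X (parts t c R) r (G.vtx h) (X.param h w)

namespace GluingData

variable {V E : Type*} {G : OrientedMultigraph V E} {X : NodeCoordinates E} {ρ c₁ c₂ : ℝ}
  {t : E → ℂ} {a r : ℝ} {c : E × Side → ℂ} {R : E × Side → ℂ → ℂ}

theorem differentiableAt_parts (hρ : 0 < ρ) (hR : ∀ h, DifferentiableOn ℂ (R h) (ball 0 ρ))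
    {h : E × Side} {u : ℂ} (hu : ‖t h.1‖ / ρ < ‖u‖) : DifferentiableAt ℂ (parts t c R h) u :=
  differentiableAt_principalPart hρ (hR _) hu

theorem continuousOn_parts (hρ : 0 < ρ) (hR : ∀ h, DifferentiableOn ℂ (R h) (ball 0 ρ))
    {h : E × Side} (hr : ‖t h.1‖ / ρ < r) : ContinuousOn (parts t c R h) (sphere 0 r) :=
  fun u hu => (differentiableAt_parts hρ hR
    (by rwa [mem_sphere_zero_iff_norm.1 hu])).continuousAt.continuousWithinAt

/-- For |w| < r the circle can be enlarged from r to s. Both sides are holomorphic on |w| < s, so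
the identity theorem does the rest. -/
theorem regular_eq_of_le (D : GluingData G X ρ t r c R) (hX : AdmissibleCoordinates G X ρ c₁ c₂)
    (ha : 0 ≤ a) (har : a < r) (ht : ∀ e, ‖t e‖ / ρ ≤ a) {h : E × Side} {w : ℂ} {s : ℝ}
    (hs : r ≤ s) (hsρ : s < ρ) (hw : ‖w‖ < s) :
    R h w = deriv (X.param h) w * field G X (parts t c R) s (G.vtx h) (X.param h w) := by
  have hP : ∀ (h : E × Side) u, a < ‖u‖ → ‖u‖ < ρ → DifferentiableAt ℂ (parts t c R h) u :=
    fun h u hu _ => differentiableAt_parts hX.rho_pos D.differentiableOn ((ht _).trans_lt hu)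
  have h1 : AnalyticOnNhd ℂ (R h) (ball 0 s) :=
    ((D.differentiableOn h).mono (ball_subset_ball hsρ.le)).analyticOnNhd isOpen_ball
  have h2 : AnalyticOnNhd ℂ (fun w => deriv (X.param h) w *
      field G X (parts t c R) s (G.vtx h) (X.param h w)) (ball 0 s) := by
    refine DifferentiableOn.analyticOnNhd (fun u hu => ?_) isOpen_ball
    rw [mem_ball_zero_iff] at hu
    have huρ := hu.trans hsρ
    refine DifferentiableAt.differentiableWithinAt (DifferentiableAt.mul ?_ ?_)
    · exact ((hX.differentiableOn_param h).deriv isOpen_ball).differentiableAt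
        (isOpen_ball.mem_nhds (by simpa using huρ))
    · have hf : DifferentiableAt ℂ (field G X (parts t c R) s (G.vtx h)) (X.param h u) :=
        hX.differentiableAt_field ((ha.trans har.le).trans hs) hsρ
          (fun h => continuousOn_parts hX.rho_pos D.differentiableOn
            ((ht _).trans_lt (har.trans_le hs)))
          fun h' hh' u' hu' => hX.param_ne_param_of_norm_ne hh' huρ (hu' ▸ hsρ)
            (by rw [hu']; exact hu.ne')
      exact hf.fun_comp' u (hX.differentiableAt_param huρ)
  have hr : 0 < r := ha.trans_lt har
  refine h1.eqOn_of_preconnected_of_eventuallyEq h2 (convex_ball _ _).isPreconnected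
    (mem_ball_self (hr.trans_le hs)) ?_ (by simpa using hw)
  filter_upwards [ball_mem_nhds (0 : ℂ) hr] with u hu
  rw [mem_ball_zero_iff] at hu
  rw [D.regular_eq h u hu, hX.field_param_eq ha har hs hsρ hP hu]

open Classical in
/-- The differential with given residues and regular parts. -/
noncomputable def differential (G : OrientedMultigraph V E) (X : NodeCoordinates E) (ρ : ℝ)
    (t : E → ℂ) (r : ℝ) (c : E × Side → ℂ) (R : E × Side → ℂ → ℂ) (v : V) (x : ℂ) : ℂ :=
  if x ∈ piece G X ρ t v then
    if H : ∃ h, G.vtx h = v ∧ x ∈ X.disc h then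
      (parts t c R H.choose (X.coord H.choose x) + R H.choose (X.coord H.choose x)) *
        deriv (X.coord H.choose) x
    else field G X (parts t c R) r v x
  else 0

theorem differential_of_mem_disc (hX : AdmissibleCoordinates G X ρ c₁ c₂) {h : E × Side} {x : ℂ}
    (hx : x ∈ X.disc h) (hx' : ‖t h.1‖ / ρ < ‖X.coord h x‖) :
    differential G X ρ t r c R (G.vtx h) x =
      (parts t c R h (X.coord h x) + R h (X.coord h x)) * deriv (X.coord h) x := by
  have hp := hX.param_mem_piece hx' (hX.norm_coord_lt hx)
  rw [X.param_coord hx] at hp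
  have H : ∃ h', G.vtx h' = G.vtx h ∧ x ∈ X.disc h' := ⟨h, rfl, hx⟩
  have hch : H.choose = h := hX.eq_of_mem_disc H.choose_spec.1 H.choose_spec.2 hx
  rw [differential, if_pos hp, dif_pos H, hch]

theorem differential_param (hX : AdmissibleCoordinates G X ρ c₁ c₂) {h : E × Side} {w : ℂ}
    (hw : ‖t h.1‖ / ρ < ‖w‖) (hwρ : ‖w‖ < ρ) :
    differential G X ρ t r c R (G.vtx h) (X.param h w) * deriv (X.param h) w =
      parts t c R h w + R h w := by
  rw [differential_of_mem_disc hX (hX.param_mem hwρ) (by rwa [hX.coord_param hwρ]),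
    hX.coord_param hwρ, mul_assoc, hX.deriv_coord_mul_deriv_param hwρ, mul_one]

/-- On the collar r < |z_h| < ρ the two cases of the definition overlap, and the jump relation shows
that they agree. This makes the differential holomorphic across the boundaries of the discs. -/
theorem differential_of_outside (D : GluingData G X ρ t r c R)
    (hX : AdmissibleCoordinates G X ρ c₁ c₂) (ha : 0 ≤ a) (har : a < r)
    (ht : ∀ e, ‖t e‖ / ρ ≤ a) {v : V} {x : ℂ} (hx : Outside G X r v x) :
    differential G X ρ t r c R v x = field G X (parts t c R) r v x := by
  have hP : ∀ (h : E × Side) u, a < ‖u‖ → ‖u‖ < ρ → DifferentiableAt ℂ (parts t c R h) u :=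
    fun h u hu _ => differentiableAt_parts hX.rho_pos D.differentiableOn ((ht _).trans_lt hu)
  have hlt : ∀ h, G.vtx h = v → x ∈ X.disc h → r < ‖X.coord h x‖ := by
    intro h hh hxh
    by_contra hle
    exact hx h hh _ (not_lt.1 hle) (X.param_coord hxh).symm
  by_cases H : ∃ h, G.vtx h = v ∧ x ∈ X.disc h
  · obtain ⟨h, rfl, hxh⟩ := H
    have hr := hlt h rfl hxh
    set w := X.coord h x with hw
    have hwρ : ‖w‖ < ρ := hX.norm_coord_lt hxh
    have hxw : x = X.param h w := (X.param_coord hxh).symm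
    obtain ⟨s, hws, hsρ⟩ := exists_between hwρ
    have h1 := differential_param (r := r) (c := c) (R := R) hX
      ((ht h.1).trans_lt (har.trans hr)) hwρ
    have h2 := hX.field_param_jump ha har hsρ hP (h := h) hr hws
    rw [← D.regular_eq_of_le hX ha har ht (hr.trans hws).le hsρ hws] at h2
    rw [hxw]
    refine mul_right_cancel₀ (hX.deriv_param_ne_zero (h := h) hwρ) ?_
    rw [h1, mul_comm, h2, add_comm]
  · have hp : x ∈ piece G X ρ t v := fun e s hv hxs => absurd ⟨(e, s), hv, hxs⟩ H
    rw [differential, if_pos hp, dif_neg H]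

theorem isRegularDifferential (D : GluingData G X ρ t r c R)
    (hX : AdmissibleCoordinates G X ρ c₁ c₂) (ha : 0 ≤ a) (har : a < r) (hrρ : r < ρ)
    (ht : ∀ e, ‖t e‖ / ρ ≤ a) : IsRegularDifferential G X ρ t (differential G X ρ t r c R) := by
  have hρ := hX.rho_pos
  have hcont : ∀ h, ContinuousOn (parts t c R h) (sphere 0 r) := fun h =>
    continuousOn_parts hρ D.differentiableOn ((ht _).trans_lt har)
  have hcoord : ∀ {h x}, x ∈ X.disc h → DifferentiableAt ℂ (X.coord h) x := fun {h x} hx =>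
    (hX.differentiableOn_coord h).differentiableAt ((X.isOpen_disc h).mem_nhds hx)
  have hformula : ∀ h x, x ∈ X.disc h → ‖t h.1‖ / ρ < ‖X.coord h x‖ →
      DifferentiableAt ℂ (differential G X ρ t r c R (G.vtx h)) x := by
    intro h x hx hx'
    have hR : DifferentiableAt ℂ (R h) (X.coord h x) :=
      (D.differentiableOn h).differentiableAt
        (isOpen_ball.mem_nhds (by simpa using hX.norm_coord_lt hx))
    have hd : DifferentiableAt ℂ (deriv (X.coord h)) x :=
      ((hX.differentiableOn_coord h).deriv (X.isOpen_disc h)).differentiableAt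
        ((X.isOpen_disc h).mem_nhds hx)
    have h1 : DifferentiableAt ℂ (fun y =>
        (parts t c R h (X.coord h y) + R h (X.coord h y)) * deriv (X.coord h) y) x :=
      (((differentiableAt_parts hρ D.differentiableOn hx').comp x (hcoord hx)).add
        (hR.comp x (hcoord hx))).mul hd
    refine h1.congr_of_eventuallyEq ?_
    filter_upwards [(X.isOpen_disc h).mem_nhds hx,
      continuousAt_const.eventually_lt (hcoord hx).continuousAt.norm hx'] with y hy hy'
    exact differential_of_mem_disc hX hy hy'
  refine ⟨fun v x hx => if_neg hx, fun v x hx => ?_, fun v => ?_, fun e he x hx hx' => ?_,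
    fun e he => ?_⟩
  · refine DifferentiableAt.differentiableWithinAt ?_
    by_cases H : ∃ h, G.vtx h = v ∧ x ∈ X.disc h
    · obtain ⟨h, rfl, hxh⟩ := H
      exact hformula h x hxh (hx h.1 h.2 rfl hxh)
    · push Not at H
      have hxo : Outside G X r v x := hX.outside_of_notMem_disc hrρ H
      refine (hX.differentiableAt_field (ha.trans har.le) hrρ hcont
        fun h hh u hu => hxo h hh u hu.le).congr_of_eventuallyEq ?_
      filter_upwards [(hX.isOpen_outside hrρ v).mem_nhds hxo] with y hy
      exact D.differential_of_outside hX ha har ht hy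
  · obtain ⟨K, hK, hK0, hKeq⟩ := hX.exists_field_inv (ha.trans har.le) hrρ hcont v
    -- Each circle integral of a principal part is 2πi times its residue, so K(0) is the residue sum
    -- at v. Then K(w) / w extends holomorphically to 0 as a divided difference.
    have hK00 : K 0 = 0 := by
      refine (hK0.trans (Finset.sum_congr rfl fun h _ => ?_)).trans (D.sum_residues v)
      rw [parts, circleIntegral_principalPart hρ (D.differentiableOn _) ((ht _).trans_lt har),
        inv_mul_cancel_left₀ Complex.two_pi_I_ne_zero]
    obtain ⟨T, hT, hKT⟩ := hK.exists_mem_nhds_analyticOnNhd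
    refine ⟨fun w => -dslope K 0 w, (((Complex.differentiableOn_dslope hT).2
      hKT.differentiableOn).analyticAt hT).neg, ?_⟩
    filter_upwards [hX.eventually_outside_inv hrρ v, self_mem_nhdsWithin] with w hw hw0
    have hw0' : w ≠ 0 := hw0
    rw [D.differential_of_outside hX ha har ht hw, hKeq w hw0', dslope_of_ne K hw0',
      slope_def_field, hK00]
    field_simp
    ring
  · set w := X.coord (e, Side.minus) x with hw
    have hwρ : ‖w‖ < ρ := hX.norm_coord_lt (h := (e, Side.minus)) hx
    have hw0 : w ≠ 0 := ne_zero_of_div_lt hρ hx'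
    have htn : 0 < ‖t e‖ := norm_pos_iff.2 he
    have hqρ : ‖t e / w‖ < ρ := norm_div_lt_of_div_lt hρ hx'
    have hq : ‖t e‖ / ρ < ‖t e / w‖ := by
      rw [norm_div]
      exact div_lt_div_of_pos_left htn (norm_pos_iff.2 hw0) hwρ
    have hder := hX.hasDerivAt_glue (t := t) (e := e) hx hx'
    have h1 := differential_of_mem_disc (r := r) (c := c) (R := R) hX (h := (e, Side.minus)) hx hx'
    have h2 := differential_param (r := r) (c := c) (R := R) hX (h := (e, Side.plus)) hq hqρ
    have h3 : X.glue t e x = X.param (e, Side.plus) (t e / w) := rfl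
    rw [hder.deriv, ← mul_assoc, h3]
    refine h1.trans ?_
    refine Eq.trans ?_ (congrArg (· * (-(t e) * deriv (X.coord (e, Side.minus)) x / w ^ 2)) h2.symm)
    -- After substituting t / w the residue term changes sign, and each regular part becomes the
    -- singular part at the other end: both sides consist of the same terms.
    simp only [parts, principalPart, Side.opp, D.residue_minus e, ← hw]
    rw [div_div_cancel₀ he]
    field_simp
    ring
  · have hpole : ∀ s, HasSimplePole (differential G X ρ t r c R (G.vtx (e, s))) (X.p e s)
        (c (e, s)) := by
      intro s
      have hc := hX.center_mem_disc (e, s)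
      refine hasSimplePole_of_regular_part (X.isOpen_disc (e, s)) hc
        (hX.differentiableOn_coord (e, s)) (fun x hx => by simpa using hX.norm_coord_lt hx)
        (hX.coord_center (e, s)) ?_ (D.differentiableOn (e, s)) ?_
      · have h0 : ‖(0 : ℂ)‖ < ρ := by simpa using hρ
        have := hX.deriv_coord_mul_deriv_param (h := (e, s)) h0
        rw [hX.param_zero] at this
        exact left_ne_zero_of_mul_eq_one this
      · filter_upwards [self_mem_nhdsWithin,
          nhdsWithin_le_nhds ((X.isOpen_disc (e, s)).mem_nhds hc)] with x hx hx'
        have hx0 : X.coord (e, s) x ≠ 0 := by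
          intro h0
          apply hx
          rw [mem_singleton_iff, ← X.param_coord hx', h0, hX.param_zero]
        rw [differential_of_mem_disc hX hx' (by simpa [he] using hx0), parts]
        simp only [he, principalPart_zero]
    refine ⟨c (e, Side.plus), ?_, hpole Side.plus⟩
    rw [← D.residue_minus e]
    exact hpole Side.minus

end GluingData

end DifferentialsFromGluingData

/-! ### From regular differentials to gluing data -/

section GluingDataOfDifferential

open Metric Set Filter NodeCoordinates

namespace NodeCoordinates.IsRegularDifferential

variable {V E : Type*} {G : OrientedMultigraph V E} {X : NodeCoordinates E} {ρ c₁ c₂ : ℝ}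
  {t : E → ℂ} {f : V → ℂ → ℂ} {a r : ℝ}

theorem differentiableAt_pullback (hf : IsRegularDifferential G X ρ t f)
    (hX : AdmissibleCoordinates G X ρ c₁ c₂) (ht : ∀ e, ‖t e‖ / ρ < ρ) {h : E × Side} {w : ℂ}
    (hw : ‖t h.1‖ / ρ < ‖w‖) (hwρ : ‖w‖ < ρ) :
    DifferentiableAt ℂ (fun w => f (G.vtx h) (X.param h w) * deriv (X.param h) w) w := by
  have h1 : DifferentiableAt ℂ (f (G.vtx h)) (X.param h w) :=
    (hf.holomorphic (G.vtx h)).differentiableAt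
      ((hX.isOpen_piece ht _).mem_nhds (hX.param_mem_piece hw hwρ))
  have h2 : DifferentiableAt ℂ (deriv (X.param h)) w :=
    ((hX.differentiableOn_param h).deriv isOpen_ball).differentiableAt
      (isOpen_ball.mem_nhds (by simpa using hwρ))
  exact (h1.fun_comp' w (hX.differentiableAt_param hwρ)).mul h2

/-- For t_e ≠ 0 one Laurent decomposition, with the plus end as first coordinate, serves both ends.
For t_e = 0 the ends are treated separately, and only the node condition relates their residues. -/
theorem exists_parts_edge (hf : IsRegularDifferential G X ρ t f)
    (hX : AdmissibleCoordinates G X ρ c₁ c₂) (ht : ∀ e, ‖t e‖ / ρ < ρ) (e : E) :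
    ∃ (c : ℂ) (Rm Rp : ℂ → ℂ), DifferentiableOn ℂ Rm (ball 0 ρ) ∧
      DifferentiableOn ℂ Rp (ball 0 ρ) ∧
      (∀ w, ‖t e‖ / ρ < ‖w‖ → ‖w‖ < ρ →
        f (G.tgt e) (X.param (e, Side.plus) w) * deriv (X.param (e, Side.plus)) w =
          principalPart c (t e) Rm w + Rp w) ∧
      ∀ w, ‖t e‖ / ρ < ‖w‖ → ‖w‖ < ρ →
        f (G.src e) (X.param (e, Side.minus) w) * deriv (X.param (e, Side.minus)) w =
          principalPart (-c) (t e) Rp w + Rm w := by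
  have hρ := hX.rho_pos
  by_cases he : t e = 0
  · obtain ⟨c, hm, hp⟩ := hf.node e he
    have h0 : ‖(0 : ℂ)‖ < ρ := by simpa using hρ
    have key : ∀ s c', HasSimplePole (f (G.vtx (e, s))) (X.p e s) c' →
        ∃ R : ℂ → ℂ, DifferentiableOn ℂ R (ball 0 ρ) ∧ ∀ u, u ≠ 0 → ‖u‖ < ρ →
          f (G.vtx (e, s)) (X.param (e, s) u) * deriv (X.param (e, s)) u = c' / u + R u := by
      intro s c' hpole
      refine exists_regular_part_of_hasSimplePole hρ (hX.differentiableOn_param (e, s))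
        (hX.injOn_param (e, s)) (hX.deriv_param_ne_zero h0) ?_ fun u hu hu' =>
          hf.differentiableAt_pullback hX ht (h := (e, s)) (by simpa [he] using hu) hu'
      rw [hX.param_zero]
      exact hpole
    obtain ⟨Rm, hRm, hRm'⟩ := key Side.minus _ hm
    obtain ⟨Rp, hRp, hRp'⟩ := key Side.plus _ hp
    refine ⟨c, Rm, Rp, hRm, hRp, fun w hw hw' => ?_, fun w hw hw' => ?_⟩
    · rw [he, principalPart_zero]
      exact hRp' w (ne_zero_of_div_lt hρ hw) hw'
    · rw [he, principalPart_zero]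
      exact hRm' w (ne_zero_of_div_lt hρ hw) hw'
  · have hlt : ‖t e‖ < ρ ^ 2 := by
      have := ht e
      rwa [div_lt_iff₀ hρ, ← sq] at this
    obtain ⟨c, R₁, R₂, h1, h2, h3, h4⟩ := exists_laurent_decomposition hρ he hlt
      (g₁ := fun w => f (G.vtx (e, Side.plus)) (X.param (e, Side.plus) w) *
        deriv (X.param (e, Side.plus)) w)
      (g₂ := fun w => f (G.vtx (e, Side.minus)) (X.param (e, Side.minus) w) *
        deriv (X.param (e, Side.minus)) w)
      (fun u hu hu' => hf.differentiableAt_pullback hX ht hu hu') fun u hu hu' => by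
        have hx := hX.param_mem (h := (e, Side.minus)) hu'
        have hcx := hX.coord_param (h := (e, Side.minus)) hu'
        have hg := hf.glued e he (X.param (e, Side.minus) u) hx (by
          change _ < ‖X.coord (e, Side.minus) _‖
          rwa [hcx])
        have hd := hX.hasDerivAt_glue (t := t) hx (by rwa [hcx])
        have h1 := hX.deriv_coord_mul_deriv_param (h := (e, Side.minus)) hu'
        have h2 : X.glue t e (X.param (e, Side.minus) u) = X.param (e, Side.plus) (t e / u) := by
          change X.param (e, Side.plus) (t e / X.coord (e, Side.minus) _) = _
          rw [hcx]
        rw [hd.deriv, h2, hcx] at hg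
        have hu0 := ne_zero_of_div_lt hρ hu
        change f (G.src e) _ * _ = _ * (f (G.tgt e) _ * _)
        rw [hg]
        linear_combination (-(t e) / u ^ 2) *
          f (G.tgt e) (X.param (e, Side.plus) (t e / u)) *
            deriv (X.param (e, Side.plus)) (t e / u) * h1
    exact ⟨c, R₂, R₁, h2, h1, h3, h4⟩

theorem exists_parts (hf : IsRegularDifferential G X ρ t f)
    (hX : AdmissibleCoordinates G X ρ c₁ c₂) (ht : ∀ e, ‖t e‖ / ρ < ρ) :
    ∃ (c : E × Side → ℂ) (R : E × Side → ℂ → ℂ), (∀ e, c (e, Side.minus) = -c (e, Side.plus)) ∧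
      (∀ h, DifferentiableOn ℂ (R h) (ball 0 ρ)) ∧
      ∀ (h : E × Side) w, ‖t h.1‖ / ρ < ‖w‖ → ‖w‖ < ρ →
        f (G.vtx h) (X.param h w) * deriv (X.param h) w = parts t c R h w + R h w := by
  choose c Rm Rp h1 h2 h3 h4 using hf.exists_parts_edge hX ht
  refine ⟨fun h => match h.2 with
    | Side.minus => -c h.1
    | Side.plus => c h.1, fun h => match h.2 with
    | Side.minus => Rm h.1
    | Side.plus => Rp h.1, fun e => rfl, ?_, ?_⟩
  · rintro ⟨e, s⟩
    cases s
    · exact h1 e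
    · exact h2 e
  · rintro ⟨e, s⟩ w hw hw'
    cases s
    · exact h4 e w hw hw'
    · exact h3 e w hw hw'

theorem tendsto_zero_inv {g : ℂ → ℂ} (hg : HolomorphicAtInfty g) :
    ∃ k : ℂ → ℂ, Tendsto k (𝓝[≠] 0) (𝓝 0) ∧ ∀ᶠ w in 𝓝[≠] (0 : ℂ), g w⁻¹ = w * k w := by
  obtain ⟨b, hb, hgb⟩ := hg
  refine ⟨fun w => -(w * b w), ?_, ?_⟩
  · have h1 : Tendsto (fun w : ℂ => w) (𝓝[≠] 0) (𝓝 0) := nhdsWithin_le_nhds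
    simpa using (h1.mul (hb.continuousAt.tendsto.mono_left nhdsWithin_le_nhds)).neg
  · filter_upwards [hgb, self_mem_nhdsWithin] with w hw hw0
    have hw0' : w ≠ 0 := hw0
    rw [← hw]
    field_simp

/-- A regular differential is determined by its residues and regular parts. -/
theorem exists_gluingData (hf : IsRegularDifferential G X ρ t f)
    (hX : AdmissibleCoordinates G X ρ c₁ c₂) (ha : 0 ≤ a) (har : a < r) (hrρ : r < ρ)
    (ht : ∀ e, ‖t e‖ / ρ ≤ a) :
    ∃ c R, GluingData G X ρ t r c R ∧ f = GluingData.differential G X ρ t r c R := by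
  have hρ := hX.rho_pos
  have htρ : ∀ e, ‖t e‖ / ρ < ρ := fun e => (ht e).trans_lt (har.trans hrρ)
  obtain ⟨c, R, hc, hR, hfR⟩ := hf.exists_parts hX htρ
  obtain ⟨s, hrs, hsρ⟩ := exists_between hrρ
  have hP : ∀ (h : E × Side) u, a < ‖u‖ → ‖u‖ < ρ → DifferentiableAt ℂ (parts t c R h) u :=
    fun h u hu _ => GluingData.differentiableAt_parts hρ hR ((ht _).trans_lt hu)
  have hcont : ∀ s, a < s → ∀ h, ContinuousOn (parts t c R h) (sphere 0 s) := fun s hs h =>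
    GluingData.continuousOn_parts hρ hR ((ht _).trans_lt hs)
  have hcoord : ∀ {h x}, x ∈ X.disc h → DifferentiableAt ℂ (X.coord h) x := fun {h x} hx =>
    (hX.differentiableOn_coord h).differentiableAt ((X.isOpen_disc h).mem_nhds hx)
  have main : ∀ v, (∀ x, Outside G X r v x → f v x = field G X (parts t c R) r v x) ∧
      (∀ h, G.vtx h = v → ∀ w, ‖w‖ < s →
        R h w = deriv (X.param h) w * field G X (parts t c R) s v (X.param h w)) ∧
      ∑ h ∈ G.halfEdges v, c h = 0 := by
    classical
    intro v
    -- The difference between the differential and its reconstruction: R minus the outer sum near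
    -- the nodes, f minus the inner sum elsewhere. The cases overlap on r < |z_h| < s, where they
    -- agree by the jump relation; hence k is entire.
    set k : ℂ → ℂ := fun x => if H : ∃ h, G.vtx h = v ∧ x ∈ X.disc h ∧ ‖X.coord h x‖ < s then
        R H.choose (X.coord H.choose x) * deriv (X.coord H.choose) x -
          field G X (parts t c R) s v x
      else f v x - field G X (parts t c R) r v x with hk
    have hk₁ : ∀ h, G.vtx h = v → ∀ x, x ∈ X.disc h → ‖X.coord h x‖ < s →
        k x = R h (X.coord h x) * deriv (X.coord h) x - field G X (parts t c R) s v x := by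
      intro h hh x hx hx'
      have H : ∃ h, G.vtx h = v ∧ x ∈ X.disc h ∧ ‖X.coord h x‖ < s := ⟨h, hh, hx, hx'⟩
      have hch : H.choose = h :=
        hX.eq_of_mem_disc (H.choose_spec.1.trans hh.symm) H.choose_spec.2.1 hx
      rw [hk]
      simp only [dif_pos H, hch]
    have hk₂ : ∀ x, Outside G X r v x → k x = f v x - field G X (parts t c R) r v x := by
      intro x hx
      by_cases H : ∃ h, G.vtx h = v ∧ x ∈ X.disc h ∧ ‖X.coord h x‖ < s
      · obtain ⟨h, rfl, hxh, hxs⟩ := H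
        rw [hk₁ h rfl x hxh hxs]
        have hrw : r < ‖X.coord h x‖ := by
          by_contra hle
          exact hx h rfl _ (not_lt.1 hle) (X.param_coord hxh).symm
        set w := X.coord h x
        have hwρ := hxs.trans hsρ
        have hxw : x = X.param h w := (X.param_coord hxh).symm
        have h1 := hfR h w ((ht _).trans_lt (har.trans hrw)) hwρ
        have h2 := hX.field_param_jump ha har hsρ hP (h := h) hrw hxs
        have h3 := hX.deriv_coord_mul_deriv_param (h := h) hwρ
        rw [← hxw] at h1 h2 h3
        refine mul_right_cancel₀ (hX.deriv_param_ne_zero (h := h) hwρ) ?_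
        linear_combination R h w * h3 - h1 + h2
      · rw [hk]
        simp only [dif_neg H]
    have hkd : Differentiable ℂ k := by
      intro x
      by_cases H : ∃ h, G.vtx h = v ∧ x ∈ X.disc h ∧ ‖X.coord h x‖ < s
      · obtain ⟨h, rfl, hxh, hxs⟩ := H
        have hd : DifferentiableAt ℂ (deriv (X.coord h)) x :=
          ((hX.differentiableOn_coord h).deriv (X.isOpen_disc h)).differentiableAt
            ((X.isOpen_disc h).mem_nhds hxh)
        have hRd : DifferentiableAt ℂ (R h) (X.coord h x) := (hR h).differentiableAt
          (isOpen_ball.mem_nhds (by simpa using hxs.trans hsρ))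
        have hfd : DifferentiableAt ℂ (field G X (parts t c R) s (G.vtx h)) x := by
          refine hX.differentiableAt_field (ha.trans (har.trans hrs).le) hsρ
            (hcont s (har.trans hrs)) fun h' hh' u hu => ?_
          have := hX.param_ne_param_of_norm_ne hh' (hX.norm_coord_lt hxh) (hu ▸ hsρ)
            (by rw [hu]; exact hxs.ne')
          rwa [X.param_coord hxh] at this
        refine (((hRd.fun_comp' x (hcoord hxh)).mul hd).sub hfd).congr_of_eventuallyEq ?_
        filter_upwards [(X.isOpen_disc h).mem_nhds hxh,
          (hcoord hxh).continuousAt.norm.eventually_lt continuousAt_const hxs] with y hy hy'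
        exact hk₁ h rfl y hy hy'
      · have hxo : Outside G X r v x := by
          rintro h hh u hu rfl
          have huρ := hu.trans_lt hrρ
          exact H ⟨h, hh, hX.param_mem huρ, by rw [hX.coord_param huρ]; exact hu.trans_lt hrs⟩
        have hxp : x ∈ piece G X ρ t v := by
          intro e σ hv hxσ
          by_contra hle
          exact hxo (e, σ) hv _ ((not_lt.1 hle).trans ((ht e).trans har.le))
            (X.param_coord (h := (e, σ)) hxσ).symm
        have hfd : DifferentiableAt ℂ (f v) x := (hf.holomorphic v).differentiableAt
          ((hX.isOpen_piece htρ v).mem_nhds hxp)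
        refine (hfd.sub (hX.differentiableAt_field (ha.trans har.le) hrρ (hcont r har)
          fun h hh u hu => hxo h hh u hu.le)).congr_of_eventuallyEq ?_
        filter_upwards [(hX.isOpen_outside hrρ v).mem_nhds hxo] with y hy using hk₂ y hy
    obtain ⟨K, hK, hK0, hKeq⟩ := hX.exists_field_inv (ha.trans har.le) hrρ (hcont r har) v
    obtain ⟨b, hb, hfb⟩ := tendsto_zero_inv (hf.holomorphic_infty v)
    have hKlim : Tendsto K (𝓝[≠] 0) (𝓝 (K 0)) :=
      hK.continuousAt.tendsto.mono_left nhdsWithin_le_nhds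
    have hid : Tendsto (fun w : ℂ => w) (𝓝[≠] 0) (𝓝 0) := nhdsWithin_le_nhds
    have hklim : Tendsto (fun w => k w⁻¹) (𝓝[≠] 0) (𝓝 0) := by
      have h1 : Tendsto (fun w => w * b w - w * K w) (𝓝[≠] 0) (𝓝 0) := by
        simpa using (hid.mul hb).sub (hid.mul hKlim)
      refine h1.congr' ?_
      filter_upwards [hfb, hX.eventually_outside_inv hrρ v, self_mem_nhdsWithin] with w hw hw' hw0
      rw [hk₂ _ hw', hw, hKeq w hw0]
    -- Liouville: f and the sum of Cauchy transforms both vanish at infinity.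
    have hkzero : ∀ x, k x = 0 := by
      intro x
      refine hkd.apply_eq_of_tendsto_cocompact x ?_
      have h1 := hklim.comp (tendsto_inv₀_cobounded' (α := ℂ))
      rw [← Metric.cobounded_eq_cocompact]
      refine h1.congr fun y => ?_
      simp
    have hout : ∀ x, Outside G X r v x → f v x = field G X (parts t c R) r v x := fun x hx =>
      sub_eq_zero.1 ((hk₂ x hx).symm.trans (hkzero x))
    refine ⟨hout, fun h hh w hw => ?_, ?_⟩
    · have hwρ := hw.trans hsρ
      have h1 := hk₁ h hh _ (hX.param_mem hwρ) (by rwa [hX.coord_param hwρ])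
      rw [hkzero, hX.coord_param hwρ] at h1
      linear_combination (-deriv (X.param h) w) * h1 -
        R h w * hX.deriv_coord_mul_deriv_param (h := h) hwρ
    -- Near infinity f(1 / w) equals both w b(w), with b tending to 0, and w K(w); hence the residue
    -- sum K(0) vanishes.
    · have hK00 : K 0 = 0 := by
        refine tendsto_nhds_unique hKlim (hb.congr' ?_)
        filter_upwards [hfb, hX.eventually_outside_inv hrρ v, self_mem_nhdsWithin]
          with w hw hw' hw0
        refine mul_left_cancel₀ (show w ≠ 0 from hw0) ?_
        rw [← hw, ← hKeq w hw0, hout _ hw']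
      rw [← hK00, hK0]
      refine Finset.sum_congr rfl fun h _ => ?_
      rw [parts, circleIntegral_principalPart hρ (hR _) ((ht _).trans_lt har),
        inv_mul_cancel_left₀ Complex.two_pi_I_ne_zero]
  have D : GluingData G X ρ t r c R :=
    { residue_minus := hc
      sum_residues := fun v => (main v).2.2
      differentiableOn := hR
      regular_eq := fun h w hw => by
        rw [(main (G.vtx h)).2.1 h rfl w (hw.trans hrs), hX.field_param_eq ha har hrs.le hsρ hP hw] }
  refine ⟨c, R, D, funext fun v => funext fun x => ?_⟩
  by_cases hx : x ∈ piece G X ρ t v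
  · by_cases H : ∃ h, G.vtx h = v ∧ x ∈ X.disc h
    · obtain ⟨h, rfl, hxh⟩ := H
      have hw := hx h.1 h.2 rfl hxh
      have hwρ := hX.norm_coord_lt hxh
      have h1 := hfR h _ hw hwρ
      rw [← GluingData.differential_param (r := r) hX hw hwρ] at h1
      have h2 := mul_right_cancel₀ (hX.deriv_param_ne_zero hwρ) h1
      have h3 : X.param h (X.z h.1 h.2 x) = x := X.param_coord hxh
      rwa [h3] at h2
    · push Not at H
      have hxo := hX.outside_of_notMem_disc hrρ H
      rw [(main v).1 x hxo, D.differential_of_outside hX ha har ht hxo]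
  · rw [hf.eq_zero v x hx, GluingData.differential, if_neg hx]

end NodeCoordinates.IsRegularDifferential

end GluingDataOfDifferential

/-! ### Monotonic norms and sums over adjacent edges -/

namespace MonotoneNorm

open Filter

variable {ι : Type*} {N : MonotoneNorm ι}

/-- The norm of the real sequence `a` is defined and at most `M`. -/
def Bounded (N : MonotoneNorm ι) (a : ι → ℝ) (M : ℝ) : Prop :=
  ∃ h : (fun i => (a i : ℂ)) ∈ N.space, N.norm ⟨_, h⟩ ≤ M

theorem Bounded.mem {a : ι → ℝ} {M : ℝ} (h : N.Bounded a M) {x : ι → ℂ}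
    (hx : ∀ i, ‖x i‖ ≤ |a i|) : ∃ hx : x ∈ N.space, N.norm ⟨x, hx⟩ ≤ M := by
  obtain ⟨ha, hM⟩ := h
  obtain ⟨h1, h2⟩ := N.mono x ⟨_, ha⟩ fun i => by simpa using hx i
  exact ⟨h1, h2.trans hM⟩

theorem Bounded.mono {a b : ι → ℝ} {M : ℝ} (h : N.Bounded b M) (hab : ∀ i, |a i| ≤ |b i|) :
    N.Bounded a M :=
  h.mem fun i => by simpa using hab i

theorem Bounded.mono_of_nonneg {a b : ι → ℝ} {M : ℝ} (h : N.Bounded b M) (ha : ∀ i, 0 ≤ a i)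
    (hab : ∀ i, a i ≤ b i) : N.Bounded a M :=
  h.mono fun i => abs_le_abs_of_nonneg (ha i) (hab i)

theorem Bounded.le {a : ι → ℝ} {M M' : ℝ} (h : N.Bounded a M) (hM : M ≤ M') : N.Bounded a M' :=
  ⟨h.1, h.2.trans hM⟩

theorem Bounded.nonneg {a : ι → ℝ} {M : ℝ} (h : N.Bounded a M) : 0 ≤ M :=
  (apply_nonneg N.norm _).trans h.2

theorem Bounded.add {a b : ι → ℝ} {M M' : ℝ} (h : N.Bounded a M) (h' : N.Bounded b M') :
    N.Bounded (fun i => a i + b i) (M + M') := by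
  obtain ⟨h1, h2⟩ := h
  obtain ⟨h1', h2'⟩ := h'
  have e : (fun i => ((a i + b i : ℝ) : ℂ)) = (fun i => (a i : ℂ)) + fun i => (b i : ℂ) := by
    funext i
    simp
  unfold Bounded
  simp only [e]
  exact ⟨N.space.add_mem h1 h1', (map_add_le_add N.norm ⟨_, h1⟩ ⟨_, h1'⟩).trans
    (add_le_add h2 h2')⟩

theorem Bounded.const_mul {a : ι → ℝ} {M : ℝ} (h : N.Bounded a M) {k : ℝ} (hk : 0 ≤ k) :
    N.Bounded (fun i => k * a i) (k * M) := by
  obtain ⟨h1, h2⟩ := h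
  have e : (fun i => ((k * a i : ℝ) : ℂ)) = (k : ℂ) • fun i => (a i : ℂ) := by
    funext i
    simp
  unfold Bounded
  simp only [e]
  refine ⟨N.space.smul_mem _ h1, ?_⟩
  have := map_smul_eq_mul N.norm (k : ℂ) ⟨_, h1⟩
  rw [Complex.norm_real, Real.norm_of_nonneg hk] at this
  exact this.le.trans (mul_le_mul_of_nonneg_left h2 hk)

theorem bounded_norm (x : N.space) : N.Bounded (fun i => ‖x.1 i‖) (N.norm x) := by
  obtain ⟨h, hle⟩ := N.mono (fun i => ((‖x.1 i‖ : ℝ) : ℂ)) x fun i => by simp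
  exact ⟨h, hle⟩

/-- By monotonicity, replacing all coordinates but the i-th by zero does not increase the norm, and
the resulting vectors are multiples of a single one. If the i-th coordinate vanishes on the whole
space, C = 0 works. -/
theorem exists_norm_coords_le (N : MonotoneNorm ι) (i : ι) :
    ∃ C, ∀ x : N.Space, ‖N.coords x i‖ ≤ C * ‖x‖ := by
  classical
  by_cases hb : ∃ b : N.space, b.1 i ≠ 0
  · obtain ⟨b, hb⟩ := hb
    have hsingle : ∀ x : N.space, ∃ h : (Pi.single i (x.1 i) : ι → ℂ) ∈ N.space,
        N.norm ⟨_, h⟩ ≤ N.norm x := fun x => N.mono _ x fun j => by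
      rcases eq_or_ne j i with rfl | hj
      · simp
      · simp [hj]
    obtain ⟨h1, -⟩ := hsingle b
    set y : N.space := ⟨_, h1⟩
    have hy : y ≠ 0 := fun h0 => hb (by simpa [y] using congrFun (congrArg Subtype.val h0) i)
    have hpos : 0 < N.norm y := (apply_nonneg N.norm y).lt_of_ne fun h =>
      hy (N.eq_zero_of_norm_eq_zero y h.symm)
    refine ⟨‖b.1 i‖ / N.norm y, fun x => ?_⟩
    obtain ⟨h2, h3⟩ := hsingle x
    have e : (⟨_, h2⟩ : N.space) = (N.coords x i / b.1 i) • y := by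
      refine Subtype.ext (funext fun j => ?_)
      change (Pi.single i (N.coords x i) : ι → ℂ) j
        = N.coords x i / b.1 i * (Pi.single i (b.1 i) : ι → ℂ) j
      rcases eq_or_ne j i with rfl | hj
      · simp [hb]
      · simp [hj]
    rw [e, map_smul_eq_mul, norm_div] at h3
    change _ ≤ ‖x‖ at h3
    have hbi : 0 < ‖b.1 i‖ := norm_pos_iff.2 hb
    rw [div_mul_eq_mul_div, div_le_iff₀ hbi] at h3
    rw [div_mul_eq_mul_div, le_div_iff₀ hpos]
    linarith
  · push Not at hb
    refine ⟨0, fun x => ?_⟩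
    have : N.coords x i = 0 := hb x
    simp [this]

theorem continuous_coords (N : MonotoneNorm ι) (i : ι) : Continuous fun x : N.Space => N.coords x i := by
  obtain ⟨C, hC⟩ := N.exists_norm_coords_le i
  exact (((LinearMap.proj i).comp N.coords).mkContinuous C hC).continuous

/-- A series of sequences with geometrically decreasing norms. -/
theorem exists_hasSum_of_bounded [CompleteSpace N.Space] {b : ℕ → ι → ℝ} {M : ℝ}
    (hb : ∀ n, N.Bounded (b n) (M * (1 / 2) ^ n)) :
    ∃ s : ι → ℝ, N.Bounded s (M * 2) ∧ ∀ i, HasSum (fun n => b n i) (s i) := by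
  choose h1 h2 using hb
  let x : ℕ → N.Space := fun n => (⟨_, h1 n⟩ : N.space)
  have hsum : HasSum (fun n : ℕ => M * (1 / 2 : ℝ) ^ n) (M * 2) :=
    hasSum_geometric_two.mul_left M
  have hx : ∀ n, ‖x n‖ ≤ M * (1 / 2) ^ n := h2
  have hsx : Summable x := Summable.of_norm_bounded hsum.summable hx
  -- Continuity of the coordinates identifies the sum in the Banach space with the termwise sums.
  have hcoord : ∀ i, HasSum (fun n => ((b n i : ℝ) : ℂ)) (N.coords (∑' n, x n) i) := fun i =>
    hsx.hasSum.map ((LinearMap.proj i).comp N.coords) (N.continuous_coords i)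
  have hre : ∀ i, HasSum (fun n => b n i) (N.coords (∑' n, x n) i).re := fun i => by
    simpa using! Complex.hasSum_re (hcoord i)
  have him : ∀ i, N.coords (∑' n, x n) i = ((N.coords (∑' n, x n) i).re : ℂ) := fun i =>
    (hcoord i).unique (Complex.hasSum_ofReal.2 (hre i))
  refine ⟨fun i => (N.coords (∑' n, x n) i).re, ?_, hre⟩
  have e : (fun i => ((N.coords (∑' n, x n) i).re : ℂ)) = N.coords (∑' n, x n) :=
    funext fun i => (him i).symm
  unfold Bounded
  simp only [e]
  exact ⟨(∑' n, x n : N.Space).2, tsum_of_norm_bounded hsum hx⟩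

end MonotoneNorm

namespace OrientedMultigraph

variable {V E : Type*} (G : OrientedMultigraph V E)

theorem sum_halfEdges (v : V) (c : E × Side → ℂ) : ∑ h ∈ G.halfEdges v, c h =
    ∑ e ∈ G.outEdges v, c (e, Side.minus) + ∑ e ∈ G.inEdges v, c (e, Side.plus) := by
  classical
  have e : G.halfEdges v = (G.outEdges v).image (fun e => (e, Side.minus)) ∪
      (G.inEdges v).image fun e => (e, Side.plus) := by
    ext ⟨e, s⟩
    cases s
    · simp [vtx, vertex, outEdges]
    · simp [vtx, vertex, inEdges]
  rw [e, Finset.sum_union, Finset.sum_image, Finset.sum_image]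
  · intro a _ b _ h
    exact (Prod.mk.inj h).1
  · intro a _ b _ h
    exact (Prod.mk.inj h).1
  · rw [Finset.disjoint_left]
    simp

/-- The factor 2 accounts for loops, which give two half-edges at v but occur once in `edgesAt`. -/
theorem sum_halfEdges_le (v : V) {a : E → ℝ} (ha : ∀ e, 0 ≤ a e) :
    ∑ h ∈ G.halfEdges v, a h.1 ≤ 2 * ∑ e ∈ G.edgesAt v, a e := by
  classical
  have hsub : G.halfEdges v ⊆ G.edgesAt v ×ˢ {Side.minus, Side.plus} := by
    rintro ⟨e, s⟩ h
    rw [mem_halfEdges] at h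
    cases s
    · have h' : G.src e = v := h
      simp [edgesAt, h']
    · have h' : G.tgt e = v := h
      simp [edgesAt, h']
  refine (Finset.sum_le_sum_of_subset_of_nonneg hsub fun h _ _ => ha h.1).trans_eq ?_
  rw [Finset.sum_product, Finset.mul_sum]
  refine Finset.sum_congr rfl fun e _ => ?_
  rw [Finset.sum_pair (by simp), two_mul]

/-- The sum of `a` over the half-edges at the ends of an edge. -/
noncomputable def endSum (a : E → ℝ) (e : E) : ℝ :=
  ∑ h ∈ G.halfEdges (G.src e), a h.1 + ∑ h ∈ G.halfEdges (G.tgt e), a h.1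

theorem sum_le_endSum {a : E → ℝ} (ha : ∀ e, 0 ≤ a e) (h : E × Side) :
    ∑ h' ∈ G.halfEdges (G.vtx h), a h'.1 ≤ G.endSum a h.1 := by
  have hn : ∀ v, 0 ≤ ∑ h ∈ G.halfEdges v, a h.1 := fun v => Finset.sum_nonneg fun h _ => ha h.1
  obtain ⟨e, s⟩ := h
  cases s
  · exact le_add_of_nonneg_right (hn _)
  · exact le_add_of_nonneg_left (hn _)

theorem endSum_nonneg {a : E → ℝ} (ha : ∀ e, 0 ≤ a e) (e : E) : 0 ≤ G.endSum a e :=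
  add_nonneg (Finset.sum_nonneg fun h _ => ha h.1) (Finset.sum_nonneg fun h _ => ha h.1)

end OrientedMultigraph

namespace AdmissibleNorms

variable {V E : Type*} {G : OrientedMultigraph V E} {NE : MonotoneNorm E} {NV : MonotoneNorm V}

theorem exists_bounded_vertexSum (hN : AdmissibleNorms G NE NV) : ∃ K : ℝ, 0 ≤ K ∧
    ∀ (a : E → ℝ) (M : ℝ), (∀ e, 0 ≤ a e) → NE.Bounded a M →
      NV.Bounded (fun v => ∑ h ∈ G.halfEdges v, a h.1) (K * M) := by
  obtain ⟨C, hC⟩ := hN.edges_to_vertices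
  refine ⟨2 * max C 0, by positivity, fun a M ha h => ?_⟩
  obtain ⟨h1, h2⟩ := hC ⟨_, h.1⟩
  have h3 : NV.Bounded (fun v => ∑ e ∈ G.edgesAt v, ‖(a e : ℂ)‖) (max C 0 * M) :=
    ⟨h1, h2.trans (mul_le_mul (le_max_left _ _) h.2 (apply_nonneg NE.norm _) (le_max_right _ _))⟩
  rw [mul_assoc]
  refine (h3.const_mul zero_le_two).mono_of_nonneg
    (fun v => Finset.sum_nonneg fun h _ => ha h.1) fun v => ?_
  refine (G.sum_halfEdges_le v ha).trans_eq ?_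
  congr 1
  refine Finset.sum_congr rfl fun e _ => ?_
  rw [Complex.norm_real, Real.norm_of_nonneg (ha e)]

theorem exists_bounded_endpoints (hN : AdmissibleNorms G NE NV) : ∃ K : ℝ, 0 ≤ K ∧
    ∀ (b : V → ℝ) (M : ℝ), (∀ v, 0 ≤ b v) → NV.Bounded b M →
      NE.Bounded (fun e => b (G.src e) + b (G.tgt e)) (K * M) := by
  obtain ⟨C, hC⟩ := hN.vertices_to_edges
  refine ⟨max C 0, le_max_right _ _, fun b M hb h => ?_⟩
  obtain ⟨h1, h2⟩ := hC ⟨_, h.1⟩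
  have h3 : NE.Bounded (fun e => ‖(b (G.src e) : ℂ)‖ + ‖(b (G.tgt e) : ℂ)‖) (max C 0 * M) :=
    ⟨h1, h2.trans (mul_le_mul (le_max_left _ _) h.2 (apply_nonneg NV.norm _) (le_max_right _ _))⟩
  refine h3.mono_of_nonneg (fun e => add_nonneg (hb _) (hb _)) fun e => ?_
  rw [Complex.norm_real, Complex.norm_real, Real.norm_of_nonneg (hb _), Real.norm_of_nonneg (hb _)]

/-- Composition of the two admissibility conditions, from edges to vertices and back. This bounds
the operator that couples neighbouring edges in the gluing equations. -/
theorem exists_bounded_endSum (hN : AdmissibleNorms G NE NV) : ∃ K : ℝ, 0 ≤ K ∧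
    ∀ (a : E → ℝ) (M : ℝ), (∀ e, 0 ≤ a e) → NE.Bounded a M → NE.Bounded (G.endSum a) (K * M) := by
  obtain ⟨K, hK, h⟩ := hN.exists_bounded_vertexSum
  obtain ⟨K', hK', h'⟩ := hN.exists_bounded_endpoints
  refine ⟨K' * K, mul_nonneg hK' hK, fun a M ha hb => ?_⟩
  rw [mul_assoc]
  exact h' _ _ (fun v => Finset.sum_nonneg fun h _ => ha h.1) (h a M ha hb)

end AdmissibleNorms

/-! ### Solving the gluing equations by iteration -/

section ConstructionOfGluingData

open Metric Set Filter NodeCoordinates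

/-- Auxiliary radii for the construction of regular differentials. -/
structure AdmissibleRadii (ρ c₁ c₂ ε r τ δ : ℝ) : Prop where
  r_pos : 0 < r
  r_le : r ≤ ρ / 2
  r_le_eps : c₂ * r ≤ ε / 2
  τ_pos : 0 < τ
  τ_lt : τ < r
  τ_le : 2 * (c₂ * τ) ≤ c₁ * r
  δ_pos : 0 < δ
  δ_le : 2 * δ ≤ r * τ

namespace AdmissibleRadii

variable {ρ c₁ c₂ ε r τ δ : ℝ}

theorem delta_le (hr : AdmissibleRadii ρ c₁ c₂ ε r τ δ) : δ ≤ r * τ := by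
  have := hr.δ_pos
  linarith [hr.δ_le]

theorem r_lt (hr : AdmissibleRadii ρ c₁ c₂ ε r τ δ) : r < ρ := by
  linarith [hr.r_le, hr.r_pos]

theorem delta_div_lt (hr : AdmissibleRadii ρ c₁ c₂ ε r τ δ) : δ / τ < r := by
  rw [div_lt_iff₀ hr.τ_pos]
  linarith [hr.δ_le, hr.δ_pos]

/-- From here on δ / τ is the inner radius of the annuli. It bounds |t| / ρ, and principal parts are
holomorphic beyond it as soon as the regular parts are holomorphic on |w| < τ. -/
theorem div_rho_le (hr : AdmissibleRadii ρ c₁ c₂ ε r τ δ) {t : ℂ} (ht : ‖t‖ ≤ δ) :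
    ‖t‖ / ρ ≤ δ / τ := by
  have h1 := hr.δ_pos
  have h2 := hr.τ_pos
  exact div_le_div₀ h1.le ht h2 (hr.τ_lt.trans hr.r_lt).le

end AdmissibleRadii

section Estimates

variable {V E : Type*} {G : OrientedMultigraph V E} {X : NodeCoordinates E} {ρ c₁ c₂ ε r τ δ : ℝ}
  {P : E × Side → ℂ → ℂ} {t : E → ℂ}

namespace AdmissibleCoordinates

variable (hX : AdmissibleCoordinates G X ρ c₁ c₂)
include hX

/-- The half-edge is needed: without edges the comparison says nothing about the constants. -/
theorem c₁_le_c₂ (h : E × Side) : c₁ ≤ c₂ := by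
  have hρ := hX.rho_pos
  have hw : ‖((ρ / 2 : ℝ) : ℂ)‖ = ρ / 2 := by
    rw [Complex.norm_real, Real.norm_of_nonneg (by positivity)]
  have hw' : ‖((ρ / 2 : ℝ) : ℂ)‖ < ρ := by rw [hw]; linarith
  have := (hX.le_norm_param_sub (h := h) hw').trans (hX.norm_param_sub_le hw')
  rw [hw] at this
  exact le_of_mul_le_mul_right this (by positivity)

theorem norm_param_sub_le_half (hr : AdmissibleRadii ρ c₁ c₂ ε r τ δ) {h : E × Side} {u : ℂ}
    (hu : ‖u‖ ≤ r) : ‖X.param h u - X.center h‖ ≤ ε / 2 :=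
  (hX.norm_param_sub_le (hu.trans_lt hr.r_lt)).trans
    ((mul_le_mul_of_nonneg_left hu hX.c₂_pos.le).trans hr.r_le_eps)

theorem le_norm_sub_param_self (hr : AdmissibleRadii ρ c₁ c₂ ε r τ δ) {h : E × Side} {w u : ℂ}
    (hw : ‖w‖ ≤ τ) (hu : ‖u‖ = r) : c₁ * r / 2 ≤ ‖X.param h w - X.param h u‖ := by
  have h1 := hX.norm_param_sub_le (h := h) (hw.trans_lt (hr.τ_lt.trans hr.r_lt))
  have h2 := hX.le_norm_param_sub (h := h) (w := u) (hu ▸ hr.r_lt)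
  have h3 := norm_sub_le_norm_sub_add_norm_sub (X.param h u) (X.param h w) (X.center h)
  rw [norm_sub_rev (X.param h u) (X.param h w)] at h3
  have h4 := mul_le_mul_of_nonneg_left hw hX.c₂_pos.le
  rw [hu] at h2
  linarith [hr.τ_le]

/-- At the same half-edge, τ is small compared with r. At different ones, the other disc stays at
distance ε from the centre while the point is within ε / 2 of it, and ε / 2 ≥ c₂ r ≥ c₁ r. -/
theorem le_norm_sub_param (hε' : ε ≤ ρ * c₁) (hr : AdmissibleRadii ρ c₁ c₂ ε r τ δ)
    {h h' : E × Side} (hh : G.vtx h' = G.vtx h) {w u : ℂ} (hw : ‖w‖ ≤ τ) (hu : ‖u‖ = r) :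
    c₁ * r / 2 ≤ ‖X.param h w - X.param h' u‖ := by
  by_cases hne : h = h'
  · subst hne
    exact hX.le_norm_sub_param_self hr hw hu
  · have h1 := hX.norm_param_sub_le_half hr (h := h) (hw.trans hr.τ_lt.le)
    have h2 := hX.le_norm_param_sub_center hh.symm hne (u := u) (hu ▸ hr.r_lt)
    have h3 := norm_sub_le_norm_sub_add_norm_sub (X.param h' u) (X.param h w) (X.center h)
    rw [norm_sub_rev (X.param h' u) (X.param h w)] at h3
    have h4 := mul_le_mul_of_nonneg_right (hX.c₁_le_c₂ h) hr.r_pos.le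
    have h5 := hr.r_le_eps
    have h6 := mul_pos hX.c₂_pos hr.r_pos
    linarith

theorem norm_deriv_mul_field_le (hε' : ε ≤ ρ * c₁) (hr : AdmissibleRadii ρ c₁ c₂ ε r τ δ)
    {M : E × Side → ℝ} (hP : ∀ h u, ‖u‖ = r → ‖P h u‖ ≤ M h) {h : E × Side} {w : ℂ}
    (hw : ‖w‖ ≤ τ) :
    ‖deriv (X.param h) w * field G X P r (G.vtx h) (X.param h w)‖ ≤
      6 * c₂ / c₁ * ∑ h' ∈ G.halfEdges (G.vtx h), M h' := by
  have h0 := hX.c₁_pos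
  have h0' := hX.c₂_pos
  have h0r := hr.r_pos
  have h1 := hX.norm_deriv_param_le (h := h) (hw.trans (hr.τ_lt.le.trans hr.r_le))
  have h2 := norm_field_le (G := G) (X := X) (v := G.vtx h) (x := X.param h w) (d := c₁ * r / 2)
    h0r.le (by positivity) hP fun h' hh' u hu => hX.le_norm_sub_param hε' hr hh' hw hu
  rw [norm_mul]
  refine (mul_le_mul h1 h2 (norm_nonneg _) (by positivity)).trans_eq ?_
  rw [← mul_assoc]
  congr 1
  field_simp
  ring

theorem eps_half_le_of_mem_Omega (hr : AdmissibleRadii ρ c₁ c₂ ε r τ δ) {v : V} {x : ℂ}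
    (hx : x ∈ Omega G X ε v) {h : E × Side} (hh : G.vtx h = v) {u : ℂ} (hu : ‖u‖ ≤ r) :
    ε / 2 ≤ ‖x - X.param h u‖ := by
  have h1 : ε ≤ ‖x - X.center h‖ := hx h.1 h.2 hh
  have h2 := hX.norm_param_sub_le_half hr (h := h) hu
  have h3 := norm_sub_le_norm_sub_add_norm_sub x (X.param h u) (X.center h)
  linarith

theorem outside_of_mem_Omega (hε : 0 < ε) (hr : AdmissibleRadii ρ c₁ c₂ ε r τ δ) {v : V} {x : ℂ}
    (hx : x ∈ Omega G X ε v) : Outside G X r v x := by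
  rintro h hh u hu rfl
  have := hX.eps_half_le_of_mem_Omega hr hx hh hu
  simp only [sub_self, norm_zero] at this
  linarith

theorem norm_field_le_of_mem_Omega (hε : 0 < ε) (hr : AdmissibleRadii ρ c₁ c₂ ε r τ δ)
    {M : E × Side → ℝ} (hP : ∀ h u, ‖u‖ = r → ‖P h u‖ ≤ M h) {v : V} {x : ℂ}
    (hx : x ∈ Omega G X ε v) :
    ‖field G X P r v x‖ ≤ r / (ε / 2) * ∑ h ∈ G.halfEdges v, M h :=
  norm_field_le hr.r_pos.le (half_pos hε) hP fun _ hh _ hu =>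
    hX.eps_half_le_of_mem_Omega hr hx hh hu.le

end AdmissibleCoordinates

theorem norm_parts_le (hr : AdmissibleRadii ρ c₁ c₂ ε r τ δ) (ht : ∀ e, ‖t e‖ ≤ δ)
    {c : E × Side → ℂ} {R : E × Side → ℂ → ℂ} {A : E → ℝ}
    (hR : ∀ h w, ‖w‖ ≤ τ → ‖R h w‖ ≤ A h.1) (h : E × Side) (u : ℂ) (hu : ‖u‖ = r) :
    ‖parts t c R h u‖ ≤ ‖c h‖ / r + δ * A h.1 / r ^ 2 :=
  norm_principalPart_le hr.r_pos hu (ht _) hr.delta_le (hR (h.1, h.2.opp))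

theorem continuousOn_parts_of_continuousOn (hr : AdmissibleRadii ρ c₁ c₂ ε r τ δ)
    (ht : ∀ e, ‖t e‖ ≤ δ) {c : E × Side → ℂ} {R : E × Side → ℂ → ℂ}
    (hR : ∀ h, ContinuousOn (R h) (closedBall 0 τ)) (h : E × Side) :
    ContinuousOn (parts t c R h) (sphere 0 r) := by
  have hne : ∀ u ∈ sphere (0 : ℂ) r, u ≠ 0 := fun u hu => by
    rw [mem_sphere_zero_iff_norm] at hu
    exact norm_pos_iff.1 (hu ▸ hr.r_pos)
  have h1 : ContinuousOn (fun u : ℂ => t h.1 / u) (sphere 0 r) :=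
    continuousOn_const.div continuousOn_id hne
  have h2 : ContinuousOn (fun u : ℂ => R (h.1, h.2.opp) (t h.1 / u)) (sphere 0 r) := by
    refine (hR _).comp h1 fun u hu => ?_
    rw [mem_sphere_zero_iff_norm] at hu
    rw [mem_closedBall_zero_iff, norm_div, hu, div_le_iff₀ hr.r_pos, mul_comm]
    exact (ht _).trans hr.delta_le
  exact (continuousOn_const.div continuousOn_id hne).sub ((continuousOn_const.div
    (continuousOn_id.pow 2) fun u hu => pow_ne_zero 2 (hne u hu)).mul h2)

end Estimates

section FixedPoint

variable {V E : Type*} (G : OrientedMultigraph V E) (X : NodeCoordinates E) {ρ c₁ c₂ ε r τ δ : ℝ}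
  {t : E → ℂ}

/-- The regular parts of the differential with given principal parts. -/
noncomputable def nextRegular (t : E → ℂ) (r : ℝ) (c : E × Side → ℂ) (R : E × Side → ℂ → ℂ)
    (h : E × Side) (w : ℂ) : ℂ :=
  deriv (X.param h) w * field G X (parts t c R) r (G.vtx h) (X.param h w)

variable {G X}

namespace AdmissibleCoordinates

variable (hX : AdmissibleCoordinates G X ρ c₁ c₂)
include hX

theorem differentiableAt_deriv_mul_field {P : E × Side → ℂ → ℂ} (hr : 0 ≤ r) (hrρ : r < ρ)
    (hP : ∀ h, ContinuousOn (P h) (sphere 0 r)) {h : E × Side} {w : ℂ} (hw : ‖w‖ < r) :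
    DifferentiableAt ℂ (fun w => deriv (X.param h) w * field G X P r (G.vtx h) (X.param h w)) w := by
  have hwρ := hw.trans hrρ
  have h1 : DifferentiableAt ℂ (deriv (X.param h)) w :=
    ((hX.differentiableOn_param h).deriv isOpen_ball).differentiableAt
      (isOpen_ball.mem_nhds (by simpa using hwρ))
  have h2 : DifferentiableAt ℂ (field G X P r (G.vtx h)) (X.param h w) :=
    hX.differentiableAt_field hr hrρ hP fun h' hh' u hu =>
      hX.param_ne_param_of_norm_ne hh' hwρ (hu ▸ hrρ) (by rw [hu]; exact hw.ne')
  exact h1.mul (h2.fun_comp' w (hX.differentiableAt_param hwρ))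

theorem continuousOn_nextRegular (hr : AdmissibleRadii ρ c₁ c₂ ε r τ δ) (ht : ∀ e, ‖t e‖ ≤ δ)
    {c : E × Side → ℂ} {R : E × Side → ℂ → ℂ} (hR : ∀ h, ContinuousOn (R h) (closedBall 0 τ))
    (h : E × Side) : ContinuousOn (nextRegular G X t r c R h) (closedBall 0 τ) := fun w hw => by
  rw [mem_closedBall_zero_iff] at hw
  exact (hX.differentiableAt_deriv_mul_field hr.r_pos.le hr.r_lt
    (continuousOn_parts_of_continuousOn hr ht hR)
    (hw.trans_lt hr.τ_lt)).continuousAt.continuousWithinAt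

theorem nextRegular_sub (hr : AdmissibleRadii ρ c₁ c₂ ε r τ δ) (ht : ∀ e, ‖t e‖ ≤ δ)
    {c : E × Side → ℂ} {R R' : E × Side → ℂ → ℂ} (hR : ∀ h, ContinuousOn (R h) (closedBall 0 τ))
    (hR' : ∀ h, ContinuousOn (R' h) (closedBall 0 τ)) {h : E × Side} {w : ℂ} (hw : ‖w‖ ≤ τ) :
    nextRegular G X t r c R h w - nextRegular G X t r c R' h w =
      nextRegular G X t r 0 (R - R') h w := by
  have hwr := hw.trans_lt hr.τ_lt
  unfold nextRegular
  rw [← mul_sub, field, field, field, ← Finset.sum_sub_distrib]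
  congr 1
  refine Finset.sum_congr rfl fun h' hh' => ?_
  rw [G.mem_halfEdges] at hh'
  have hint : ∀ {R : E × Side → ℂ → ℂ}, (∀ h, ContinuousOn (R h) (closedBall 0 τ)) →
      CircleIntegrable (fun u => parts t c R h' u / (X.param h w - X.param h' u)) 0 r := fun hR =>
    circleIntegrable_cauchyTransform hr.r_pos.le (hX.continuousOn_param_sphere hr.r_lt)
      (continuousOn_parts_of_continuousOn hr ht hR h') fun u hu => by
        rw [mem_sphere_zero_iff_norm] at hu
        exact hX.param_ne_param_of_norm_ne hh' (hwr.trans hr.r_lt) (hu ▸ hr.r_lt)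
          (by rw [hu]; exact hwr.ne')
  unfold cauchyTransform
  rw [← mul_sub, ← circleIntegral.integral_sub (hint hR) (hint hR')]
  refine congrArg (fun F : ℂ → ℂ => (2 * Real.pi * Complex.I)⁻¹ * ∮ u in C(0, r), F u)
    (funext fun u => ?_)
  rw [← sub_div]
  congr 1
  simp only [parts, principalPart, Pi.sub_apply, Pi.zero_apply]
  ring

theorem norm_nextRegular_le (hε' : ε ≤ ρ * c₁) (hr : AdmissibleRadii ρ c₁ c₂ ε r τ δ)
    (ht : ∀ e, ‖t e‖ ≤ δ) {c : E × Side → ℂ} {R : E × Side → ℂ → ℂ} {A a : E → ℝ}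
    (hc : ∀ h, ‖c h‖ ≤ a h.1) (hR : ∀ h w, ‖w‖ ≤ τ → ‖R h w‖ ≤ A h.1) {h : E × Side} {w : ℂ}
    (hw : ‖w‖ ≤ τ) :
    ‖nextRegular G X t r c R h w‖ ≤ 6 * c₂ / c₁ / r * ∑ h' ∈ G.halfEdges (G.vtx h), a h'.1 +
      6 * c₂ / c₁ * δ / r ^ 2 * ∑ h' ∈ G.halfEdges (G.vtx h), A h'.1 := by
  have h0r := hr.r_pos
  refine (hX.norm_deriv_mul_field_le hε' hr (M := fun h => a h.1 / r + δ * A h.1 / r ^ 2)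
    (fun h u hu => (norm_parts_le hr ht hR h u hu).trans ?_) hw).trans_eq ?_
  · gcongr
    exact hc h
  · rw [Finset.sum_add_distrib, ← Finset.sum_div, ← Finset.sum_div, ← Finset.mul_sum]
    ring

/-- Regular parts on small discs solving the gluing equations for given residues. -/
theorem exists_nextRegular_eq {NE : MonotoneNorm E} [CompleteSpace NE.Space] {K : ℝ}
    (hε' : ε ≤ ρ * c₁) (hr : AdmissibleRadii ρ c₁ c₂ ε r τ δ)
    (hK : ∀ (a : E → ℝ) (M : ℝ), (∀ e, 0 ≤ a e) → NE.Bounded a M →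
      NE.Bounded (G.endSum a) (K * M))
    (hδ : 6 * c₂ / c₁ * δ / r ^ 2 * K ≤ 1 / 2) (ht : ∀ e, ‖t e‖ ≤ δ)
    {c : E × Side → ℂ} {a : E → ℝ} (hc : ∀ h, ‖c h‖ ≤ a h.1) (ha : ∀ e, 0 ≤ a e) {M : ℝ}
    (haM : NE.Bounded a M) :
    ∃ (R : E × Side → ℂ → ℂ) (A : E → ℝ), (∀ e, 0 ≤ A e) ∧
      NE.Bounded A (6 * c₂ / c₁ / r * (K * M) * 2) ∧
      (∀ h, ContinuousOn (R h) (closedBall 0 τ)) ∧ (∀ h w, ‖w‖ ≤ τ → ‖R h w‖ ≤ A h.1) ∧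
      ∀ h w, ‖w‖ ≤ τ → R h w = nextRegular G X t r c R h w := by
  have h0 := hX.c₁_pos
  have h0' := hX.c₂_pos
  have h0r := hr.r_pos
  have h0d := hr.δ_pos
  set κ := 6 * c₂ / c₁ / r with hκ
  set q := 6 * c₂ / c₁ * δ / r ^ 2 with hq
  have hκ0 : 0 ≤ κ := by positivity
  have hq0 : 0 ≤ q := by positivity
  -- Picard iteration starting from R = 0.
  let S : ℕ → E × Side → ℂ → ℂ := fun n => (nextRegular G X t r c)^[n] 0
  have hS : ∀ n, S (n + 1) = nextRegular G X t r c (S n) := fun n =>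
    Function.iterate_succ_apply' _ _ _
  have hScont : ∀ n h, ContinuousOn (S n h) (closedBall 0 τ) := by
    intro n
    induction n with
    | zero => exact fun h => continuousOn_const
    | succ n ih => exact fun h => hS n ▸ hX.continuousOn_nextRegular hr ht ih h
  -- Scalar majorants of the increments of the iteration. Convergence in B_E is needed only for
  -- these; the regular parts themselves converge uniformly on each disc.
  let b : ℕ → E → ℝ := fun n => (fun b e => q * G.endSum b e)^[n] fun e => κ * G.endSum a e
  have hb : ∀ n e, b (n + 1) e = q * G.endSum (b n) e := fun n e =>
    congrFun (Function.iterate_succ_apply' _ _ _) e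
  have hb0 : ∀ n e, 0 ≤ b n e := by
    intro n
    induction n with
    | zero => exact fun e => mul_nonneg hκ0 (G.endSum_nonneg ha e)
    | succ n ih => exact fun e => hb n e ▸ mul_nonneg hq0 (G.endSum_nonneg ih e)
  have hbB : ∀ n, NE.Bounded (b n) (κ * (K * M) * (1 / 2) ^ n) := by
    intro n
    induction n with
    | zero =>
      rw [pow_zero, mul_one]
      exact (hK a M ha haM).const_mul hκ0
    | succ n ih =>
      rw [show b (n + 1) = fun e => q * G.endSum (b n) e from funext (hb n)]
      -- As q K ≤ 1 / 2, each step at least halves the bound on the norm.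
      refine ((hK _ _ (hb0 n) ih).const_mul hq0).le ?_
      have h1 := mul_le_mul_of_nonneg_right hδ ih.nonneg
      rw [pow_succ]
      linarith
  have hdiff : ∀ n h w, ‖w‖ ≤ τ → ‖(S (n + 1) - S n) h w‖ ≤ b n h.1 := by
    intro n
    induction n with
    | zero =>
      intro h w hw
      have h1 := hX.norm_nextRegular_le hε' hr ht hc (R := 0) (A := 0) (fun h w _ => by simp)
        (h := h) hw
      simp only [Pi.zero_apply, Finset.sum_const_zero, mul_zero, add_zero] at h1
      have h2 : (S (0 + 1) - S 0) h w = nextRegular G X t r c 0 h w := by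
        rw [hS]
        simp [S]
      rw [h2]
      exact h1.trans (mul_le_mul_of_nonneg_left (G.sum_le_endSum ha h) hκ0)
    | succ n ih =>
      intro h w hw
      -- The residues cancel in the difference, leaving the part linear in R, with its factor δ.
      have h2 : (S (n + 1 + 1) - S (n + 1)) h w =
          nextRegular G X t r 0 (S (n + 1) - S n) h w := by
        rw [← hX.nextRegular_sub hr ht (hScont (n + 1)) (hScont n) hw (c := c), ← hS, ← hS]
        rfl
      have h1 := hX.norm_nextRegular_le hε' hr ht (c := 0) (a := 0) (fun h => by simp) ih
        (h := h) hw
      simp only [Pi.zero_apply, Finset.sum_const_zero, mul_zero, zero_add] at h1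
      rw [h2, hb]
      exact h1.trans (mul_le_mul_of_nonneg_left (G.sum_le_endSum (hb0 n) h) hq0)
  obtain ⟨A, hA, hsum⟩ := MonotoneNorm.exists_hasSum_of_bounded hbB
  let T : ℕ → E → ℝ := fun n e => ∑' k, b (n + k) e
  have hA0 : ∀ e, 0 ≤ A e := fun e => (hsum e).nonneg fun n => hb0 n e
  have hdist : ∀ h w, ‖w‖ ≤ τ → ∀ n, dist (S n h w) (S (n + 1) h w) ≤ b n h.1 := by
    intro h w hw n
    rw [dist_comm, dist_eq_norm]
    exact hdiff n h w hw
  let R : E × Side → ℂ → ℂ := fun h w => limUnder atTop fun n => S n h w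
  have hlim : ∀ h w, ‖w‖ ≤ τ → Tendsto (fun n => S n h w) atTop (𝓝 (R h w)) := fun h w hw =>
    (cauchySeq_of_dist_le_of_summable _ (hdist h w hw) (hsum h.1).summable).tendsto_limUnder
  have hRS : ∀ n h w, ‖w‖ ≤ τ → ‖(R - S n) h w‖ ≤ T n h.1 := by
    intro n h w hw
    have := dist_le_tsum_of_dist_le_of_tendsto _ (hdist h w hw) (hsum h.1).summable (hlim h w hw) n
    rwa [dist_comm, dist_eq_norm] at this
  have hT : ∀ e, Tendsto (fun n => T n e) atTop (𝓝 0) := fun e => by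
    have := tendsto_sum_nat_add fun n => b n e
    simpa only [T, add_comm] using this
  have hRcont : ∀ h, ContinuousOn (R h) (closedBall 0 τ) := by
    intro h
    have : TendstoUniformlyOn (fun n => S n h) (R h) atTop (closedBall 0 τ) := by
      rw [Metric.tendstoUniformlyOn_iff]
      intro η hη
      filter_upwards [(hT h.1).eventually_lt_const hη] with n hn w hw
      rw [mem_closedBall_zero_iff] at hw
      rw [dist_eq_norm]
      exact (hRS n h w hw).trans_lt hn
    exact this.continuousOn (Frequently.of_forall fun n => hScont n h)
  refine ⟨R, A, hA0, hA, hRcont, fun h w hw => ?_, fun h w hw => ?_⟩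
  · have := hRS 0 h w hw
    simpa [S, T, (hsum h.1).tsum_eq] using this
  · refine tendsto_nhds_unique ((tendsto_add_atTop_iff_nat 1).2 (hlim h w hw)) ?_
    -- A finite sum of tails: the limit equation at one half-edge involves only the finitely many
    -- half-edges at its vertex.
    have hz : Tendsto (fun n => q * ∑ h' ∈ G.halfEdges (G.vtx h), T n h'.1) atTop (𝓝 0) := by
      have := (tendsto_finsetSum (G.halfEdges (G.vtx h)) fun h' _ => hT h'.1).const_mul q
      simpa using this
    rw [tendsto_iff_norm_sub_tendsto_zero]
    refine squeeze_zero (fun n => norm_nonneg _) (fun n => ?_) hz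
    rw [norm_sub_rev, hS, hX.nextRegular_sub hr ht hRcont (hScont n) hw]
    have h1 := hX.norm_nextRegular_le hε' hr ht (c := 0) (a := 0) (fun h => by simp) (hRS n)
        (h := h) hw
    simpa using h1

/-- Existence of gluing data with given residues. -/
theorem exists_gluingData_of_residues {NE : MonotoneNorm E} [CompleteSpace NE.Space] {K : ℝ}
    (hε' : ε ≤ ρ * c₁) (hr : AdmissibleRadii ρ c₁ c₂ ε r τ δ)
    (hK : ∀ (a : E → ℝ) (M : ℝ), (∀ e, 0 ≤ a e) → NE.Bounded a M →
      NE.Bounded (G.endSum a) (K * M))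
    (hδ : 6 * c₂ / c₁ * δ / r ^ 2 * K ≤ 1 / 2) (ht : ∀ e, ‖t e‖ ≤ δ)
    {c : E × Side → ℂ} {a : E → ℝ} (hc : ∀ h, ‖c h‖ ≤ a h.1) (ha : ∀ e, 0 ≤ a e) {M : ℝ}
    (haM : NE.Bounded a M) (hcm : ∀ e, c (e, Side.minus) = -c (e, Side.plus))
    (hcs : ∀ v, ∑ h ∈ G.halfEdges v, c h = 0) :
    ∃ (R : E × Side → ℂ → ℂ) (A : E → ℝ), GluingData G X ρ t r c R ∧ (∀ e, 0 ≤ A e) ∧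
      NE.Bounded A (6 * c₂ / c₁ / r * (K * M) * 2) ∧ ∀ h w, ‖w‖ ≤ τ → ‖R h w‖ ≤ A h.1 := by
  obtain ⟨R, A, hA0, hA, hRc, hRA, hReq⟩ := hX.exists_nextRegular_eq hε' hr hK hδ ht hc ha haM
  have hrρ := hr.r_lt
  have hτr := hr.τ_lt
  have hdτ := hr.delta_div_lt
  have hRd : ∀ h, DifferentiableOn ℂ (R h) (ball 0 τ) := by
    intro h w hw
    rw [mem_ball_zero_iff] at hw
    refine DifferentiableAt.differentiableWithinAt ?_
    refine (hX.differentiableAt_deriv_mul_field (h := h) hr.r_pos.le hrρ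
      (continuousOn_parts_of_continuousOn (c := c) hr ht hRc)
      (hw.trans hτr)).congr_of_eventuallyEq ?_
    filter_upwards [isOpen_ball.mem_nhds (mem_ball_zero_iff.2 hw)] with u hu
    exact hReq h u (mem_ball_zero_iff.1 hu).le
  -- At this stage R is known to be holomorphic only on |w| < τ, so τ plays the role of ρ here.
  have hP : ∀ (h : E × Side) u, δ / τ < ‖u‖ → DifferentiableAt ℂ (parts t c R h) u :=
    fun h u hu => differentiableAt_principalPart hr.τ_pos (hRd _)
      ((div_le_div_of_nonneg_right (ht _) hr.τ_pos.le).trans_lt hu)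
  have hd0 : 0 ≤ δ / τ := div_nonneg hr.δ_pos.le hr.τ_pos.le
  -- The right-hand side of the gluing equation makes sense on all larger circles and extends R to
  -- |w| < ρ.
  have hext : ∀ h : E × Side, ∃ R' : ℂ → ℂ, DifferentiableOn ℂ R' (ball 0 ρ) ∧
      ∀ s w, δ / τ < s → s < ρ → ‖w‖ < s →
        R' w = deriv (X.param h) w * field G X (parts t c R) s (G.vtx h) (X.param h w) := by
    intro h
    refine exists_differentiableOn_ball_of_radii (hdτ.trans hrρ)
      (F := fun s w => deriv (X.param h) w * field G X (parts t c R) s (G.vtx h) (X.param h w))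
      (fun s hs hs' w hw => ?_) fun s s' w hs hss hs' hw => ?_
    · refine hX.differentiableAt_deriv_mul_field (hd0.trans hs.le) hs' (fun h' u hu => ?_) hw
      rw [mem_sphere_zero_iff_norm] at hu
      exact (hP h' u (hu ▸ hs)).continuousAt.continuousWithinAt
    · exact congrArg _ (hX.field_param_eq hd0 hs hss hs' (fun h u hu _ => hP h u hu) hw)
  choose R' hR'd hR' using hext
  have hRR' : ∀ h w, ‖w‖ ≤ τ → R' h w = R h w := fun h w hw => by
    rw [hR' h r w hdτ hrρ (hw.trans_lt hτr), hReq h w hw, nextRegular]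
  -- On |u| = r the principal parts see the regular parts only at |t / u| ≤ τ, where the extension
  -- changes nothing.
  have hparts : ∀ v x, field G X (parts t c R') r v x = field G X (parts t c R) r v x := by
    intro v x
    refine Finset.sum_congr rfl fun h _ => ?_
    unfold cauchyTransform
    congr 1
    refine circleIntegral.integral_congr hr.r_pos.le fun u hu => ?_
    rw [mem_sphere_zero_iff_norm] at hu
    have h1 : ‖t h.1 / u‖ ≤ τ := by
      rw [norm_div, hu, div_le_iff₀ hr.r_pos, mul_comm]
      exact (ht _).trans hr.delta_le
    simp only [parts, principalPart, hRR' _ _ h1]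
  refine ⟨R', A, ⟨hcm, hcs, hR'd, fun h w hw => ?_⟩, hA0, hA, fun h w hw => ?_⟩
  · rw [hparts, hR' h r w hdτ hrρ hw]
  · rw [hRR' h w hw]
    exact hRA h w hw

end AdmissibleCoordinates

end FixedPoint

end ConstructionOfGluingData

/-! ### Bounds on residues and regular parts by the differential on Ω -/

section AprioriBounds

open Metric Set Filter NodeCoordinates

theorem norm_cauchyTransform_singular_le {φ R : ℂ → ℂ} {t x : ℂ} {A δ τ r d : ℝ} (hr : 0 < r)
    (hd : 0 < d) (ht : ‖t‖ ≤ δ) (hδ : δ ≤ r * τ) (hR : ∀ w, ‖w‖ ≤ τ → ‖R w‖ ≤ A)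
    (hx : ∀ u ∈ sphere (0 : ℂ) r, d ≤ ‖x - φ u‖) :
    ‖cauchyTransform φ (fun u => t / u ^ 2 * R (t / u)) r x‖ ≤ δ * A / (r * d) := by
  refine (norm_cauchyTransform_le hr.le hd (fun u hu =>
    norm_singular_le hr (mem_sphere_zero_iff_norm.1 hu) ht hδ hR) hx).trans_eq ?_
  field_simp

section Bounds

variable {V E : Type*} {G : OrientedMultigraph V E} {X : NodeCoordinates E}
  {ρ c₁ c₂ ε r τ δ : ℝ} {t : E → ℂ} {c : E × Side → ℂ} {R : E × Side → ℂ → ℂ}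

namespace AdmissibleCoordinates

variable (hX : AdmissibleCoordinates G X ρ c₁ c₂)
include hX

theorem ball_center_subset_of_le (hε' : ε ≤ ρ * c₁) (h : E × Side) :
    ball (X.center h) ε ⊆ X.disc h :=
  (ball_subset_ball hε').trans (hX.ball_center_subset h)

theorem disjoint_closedBall_center (hε : 0 < ε) (hε' : ε ≤ ρ * c₁) {h h' : E × Side}
    (hv : G.vtx h' = G.vtx h) (hne : h' ≠ h) :
    Disjoint (closedBall (X.center h) ε) (ball (X.center h') ε) := by
  have h1 : Disjoint (ball (X.center h) ε) (ball (X.center h') ε) :=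
    (hX.disjoint_disc hv.symm hne.symm).mono (hX.ball_center_subset_of_le hε' h)
      (hX.ball_center_subset_of_le hε' h')
  have h2 := h1.closure_left isOpen_ball
  rwa [closure_ball _ hε.ne'] at h2

/-- As ε ≤ ρ c₁, the open discs of radius ε at a vertex are disjoint; hence the bounding circle of
one does not enter another. -/
theorem sphere_subset_Omega (hε : 0 < ε) (hε' : ε ≤ ρ * c₁) (h : E × Side) :
    sphere (X.center h) ε ⊆ Omega G X ε (G.vtx h) := by
  intro x hx e s hv
  by_cases hne : (e, s) = h
  · subst hne
    rw [mem_sphere, dist_eq_norm] at hx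
    exact hx.ge
  · have := Set.disjoint_left.1 (hX.disjoint_closedBall_center hε hε' (h' := (e, s)) hv hne)
      (sphere_subset_closedBall hx)
    rw [mem_ball, dist_eq_norm, not_lt] at this
    exact this

/-- The other half-edges at the vertex contribute a function k holomorphic on the whole closed disc
of radius ε, so Cauchy's theorem and the maximum principle apply to it. -/
theorem field_decomposition (hε : 0 < ε) (hε' : ε ≤ ρ * c₁)
    (hr : AdmissibleRadii ρ c₁ c₂ ε r τ δ) {P : E × Side → ℂ → ℂ}
    (hP : ∀ h, ContinuousOn (P h) (sphere 0 r)) (h : E × Side) : ∃ k : ℂ → ℂ,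
      (∀ x ∈ closedBall (X.center h) ε, DifferentiableAt ℂ k x) ∧
      ∀ x, field G X P r (G.vtx h) x = cauchyTransform (X.param h) (P h) r x + k x := by
  classical
  refine ⟨fun x => ∑ h' ∈ (G.halfEdges (G.vtx h)).erase h,
    cauchyTransform (X.param h') (P h') r x, fun x hx => ?_, fun x => ?_⟩
  · refine DifferentiableAt.fun_sum fun h' hh' => ?_
    obtain ⟨hne, hh'⟩ := Finset.mem_erase.1 hh'
    rw [G.mem_halfEdges] at hh'
    refine differentiableAt_cauchyTransform hr.r_pos.le (hX.continuousOn_param_sphere hr.r_lt)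
      (hP h') fun u hu => ?_
    rintro rfl
    refine Set.disjoint_left.1 (hX.disjoint_closedBall_center hε hε' hh' hne) hx ?_
    rw [mem_ball, dist_eq_norm]
    have := hX.norm_param_sub_le_half hr (h := h') (mem_sphere_zero_iff_norm.1 hu).le
    linarith
  · exact (Finset.add_sum_erase _ (fun h' => cauchyTransform (X.param h') (P h') r x)
      (by simp : h ∈ G.halfEdges (G.vtx h))).symm

end AdmissibleCoordinates

namespace GluingData

theorem continuousOn_parts_sphere (D : GluingData G X ρ t r c R)
    (hr : AdmissibleRadii ρ c₁ c₂ ε r τ δ) (ht : ∀ e, ‖t e‖ ≤ δ) (h : E × Side) :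
    ContinuousOn (parts t c R h) (sphere 0 r) :=
  continuousOn_parts_of_continuousOn hr ht (fun h => (D.differentiableOn h).continuousOn.mono
    (closedBall_subset_ball (hr.τ_lt.trans hr.r_lt))) h

theorem cauchyTransform_parts (D : GluingData G X ρ t r c R)
    (hX : AdmissibleCoordinates G X ρ c₁ c₂)
    (hr : AdmissibleRadii ρ c₁ c₂ ε r τ δ) (ht : ∀ e, ‖t e‖ ≤ δ) {h : E × Side} {x : ℂ}
    (hx : ∀ u, ‖u‖ ≤ r → x ≠ X.param h u) :
    cauchyTransform (X.param h) (parts t c R h) r x = c h / (x - X.center h) -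
      cauchyTransform (X.param h) (fun u => t h.1 / u ^ 2 * R (h.1, h.2.opp) (t h.1 / u)) r x := by
  have hτρ := hr.τ_lt.trans hr.r_lt
  have hs : ContinuousOn (fun u => t h.1 / u ^ 2 * R (h.1, h.2.opp) (t h.1 / u)) (sphere 0 r) := by
    intro u hu
    refine (differentiableAt_singular hX.rho_pos (D.differentiableOn _) ?_).continuousAt
      |>.continuousWithinAt
    rw [mem_sphere_zero_iff_norm.1 hu]
    exact (hr.div_rho_le (ht _)).trans_lt hr.delta_div_lt
  have hc : ContinuousOn (fun u => c h / u) (sphere 0 r) := by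
    refine continuousOn_const.div continuousOn_id fun u hu => ?_
    rw [mem_sphere_zero_iff_norm] at hu
    exact norm_pos_iff.1 (hu ▸ hr.r_pos)
  have hx' : ∀ u ∈ sphere (0 : ℂ) r, x ≠ X.param h u := fun u hu =>
    hx u (mem_sphere_zero_iff_norm.1 hu).le
  have hφ := hX.continuousOn_param_sphere (h := h) hr.r_lt
  rw [← hX.param_zero, ← cauchyTransform_div hr.r_pos hr.r_lt (hX.differentiableOn_param h) hx]
  unfold cauchyTransform
  rw [← mul_sub, ← circleIntegral.integral_sub
    (circleIntegrable_cauchyTransform hr.r_pos.le hφ hc hx')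
    (circleIntegrable_cauchyTransform hr.r_pos.le hφ hs hx')]
  refine congrArg (fun F : ℂ → ℂ => (2 * Real.pi * Complex.I)⁻¹ * ∮ u in C(0, r), F u)
    (funext fun u => ?_)
  rw [← sub_div]
  rfl

/-- The residues are bounded by the values of the differential on the circle `|x - p| = ε`. -/
theorem norm_residue_le (D : GluingData G X ρ t r c R) (hX : AdmissibleCoordinates G X ρ c₁ c₂)
    (hε : 0 < ε) (hε' : ε ≤ ρ * c₁) (hr : AdmissibleRadii ρ c₁ c₂ ε r τ δ)
    (ht : ∀ e, ‖t e‖ ≤ δ) {A : E → ℝ} (hA : ∀ h w, ‖w‖ ≤ τ → ‖R h w‖ ≤ A h.1) {h : E × Side}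
    {B : ℝ} (hB : ∀ x ∈ sphere (X.center h) ε,
      ‖field G X (parts t c R) r (G.vtx h) x‖ ≤ B) :
    ‖c h‖ ≤ ε * B + 2 * δ / r * A h.1 := by
  have hP := D.continuousOn_parts_sphere hr ht
  obtain ⟨k, hk, hfk⟩ := hX.field_decomposition hε hε' hr hP h
  set Q := cauchyTransform (X.param h)
    (fun u => t h.1 / u ^ 2 * R (h.1, h.2.opp) (t h.1 / u)) r
  have hΩ := hX.sphere_subset_Omega hε hε' h
  have hQ : ∀ x ∈ sphere (X.center h) ε, ‖Q x‖ ≤ δ * A h.1 / (r * (ε / 2)) := fun x hx =>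
    norm_cauchyTransform_singular_le hr.r_pos (half_pos hε) (ht _) hr.delta_le
      (hA (h.1, h.2.opp)) fun u hu =>
        hX.eps_half_le_of_mem_Omega hr (hΩ hx) rfl (mem_sphere_zero_iff_norm.1 hu).le
  -- Adding back the O(δ) transform of the singular part leaves c / (x − p) plus a function
  -- holomorphic on the disc; integration over the circle extracts c.
  have heq : ∀ x ∈ sphere (X.center h) ε, (x - X.center h)⁻¹ • c h + k x =
      field G X (parts t c R) r (G.vtx h) x + Q x := by
    intro x hx
    have := hX.outside_of_mem_Omega hε hr (hΩ hx) h rfl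
    rw [hfk, D.cauchyTransform_parts hX hr ht this, smul_eq_mul]
    ring
  have hkc : ContinuousOn k (closedBall (X.center h) ε) := fun x hx =>
    (hk x hx).continuousAt.continuousWithinAt
  have hk0 : (∮ x in C(X.center h, ε), k x) = 0 :=
    Complex.circleIntegral_eq_zero_of_differentiable_on_off_countable hε.le countable_empty hkc
      fun x hx => hk x (ball_subset_closedBall hx.1)
  have hne : ∀ x ∈ sphere (X.center h) ε, x - X.center h ≠ 0 := fun x hx => by
    rw [mem_sphere, dist_eq_norm] at hx
    exact norm_pos_iff.1 (hx ▸ hε)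
  have hint : (∮ x in C(X.center h, ε), ((x - X.center h)⁻¹ • c h + k x)) =
      2 * Real.pi * Complex.I * c h := by
    rw [circleIntegral.integral_add, hk0, add_zero, circleIntegral.integral_smul_const,
      circleIntegral.integral_sub_center_inv _ hε.ne', smul_eq_mul]
    · exact (((continuousOn_id.sub continuousOn_const).inv₀ hne).smul
        continuousOn_const).circleIntegrable hε.le
    · exact (hkc.mono sphere_subset_closedBall).circleIntegrable hε.le
  have hbound := circleIntegral.norm_two_pi_i_inv_smul_integral_le_of_norm_le_const
    (f := fun x => (x - X.center h)⁻¹ • c h + k x) (c := X.center h) (R := ε)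
    (C := B + δ * A h.1 / (r * (ε / 2))) hε.le fun x hx => by
      rw [heq x hx]
      exact (norm_add_le _ _).trans (add_le_add (hB x hx) (hQ x hx))
  rw [hint, smul_eq_mul, inv_mul_cancel_left₀ Complex.two_pi_I_ne_zero] at hbound
  refine hbound.trans_eq ?_
  have := hr.r_pos
  field_simp

/-- The regular parts are bounded by the values of the differential on the
circle `|x - p| = ε`. -/
theorem norm_regular_le (D : GluingData G X ρ t r c R) (hX : AdmissibleCoordinates G X ρ c₁ c₂)
    (hε : 0 < ε) (hε' : ε ≤ ρ * c₁) (hr : AdmissibleRadii ρ c₁ c₂ ε r τ δ)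
    (ht : ∀ e, ‖t e‖ ≤ δ) {h : E × Side} {B M : ℝ}
    (hM : ∀ u, ‖u‖ = r → ‖parts t c R h u‖ ≤ M)
    (hB : ∀ x ∈ sphere (X.center h) ε, ‖field G X (parts t c R) r (G.vtx h) x‖ ≤ B)
    {w : ℂ} (hw : ‖w‖ ≤ τ) :
    ‖R h w‖ ≤ 3 * c₂ * ((2 / c₁ + 2 * r / ε) * M + B) := by
  have h0 := hX.c₁_pos
  have h0' := hX.c₂_pos
  have h0r := hr.r_pos
  have hP := D.continuousOn_parts_sphere hr ht
  obtain ⟨k, hk, hfk⟩ := hX.field_decomposition hε hε' hr hP h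
  have hΩ := hX.sphere_subset_Omega hε hε' h
  have hks : ∀ x ∈ sphere (X.center h) ε, ‖k x‖ ≤ B + r * M / (ε / 2) := by
    intro x hx
    have e : k x = field G X (parts t c R) r (G.vtx h) x -
        cauchyTransform (X.param h) (parts t c R h) r x := by
      rw [hfk]
      ring
    rw [e]
    refine (norm_sub_le _ _).trans (add_le_add (hB x hx) ?_)
    exact norm_cauchyTransform_le h0r.le (half_pos hε)
      (fun u hu => hM u (mem_sphere_zero_iff_norm.1 hu)) fun u hu =>
        hX.eps_half_le_of_mem_Omega hr (hΩ hx) rfl (mem_sphere_zero_iff_norm.1 hu).le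
  -- Maximum principle: k is controlled on the circle, and its value is needed well inside.
  have hkw : ‖k (X.param h w)‖ ≤ B + r * M / (ε / 2) := by
    refine Complex.norm_le_of_forall_mem_frontier_norm_le (U := ball (X.center h) ε)
      isBounded_ball ?_ (fun x hx => hks x ?_) (subset_closure ?_)
    · refine ⟨fun x hx => (hk x (ball_subset_closedBall hx)).differentiableWithinAt, ?_⟩
      rw [closure_ball _ hε.ne']
      exact fun x hx => (hk x hx).continuousAt.continuousWithinAt
    · rwa [frontier_ball _ hε.ne'] at hx
    · rw [mem_ball, dist_eq_norm]
      have := hX.norm_param_sub_le_half hr (h := h) (hw.trans hr.τ_lt.le)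
      linarith
  have hCT : ‖cauchyTransform (X.param h) (parts t c R h) r (X.param h w)‖ ≤
      r * M / (c₁ * r / 2) :=
    norm_cauchyTransform_le h0r.le (by positivity)
      (fun u hu => hM u (mem_sphere_zero_iff_norm.1 hu)) fun u hu =>
        hX.le_norm_sub_param_self hr hw (mem_sphere_zero_iff_norm.1 hu)
  rw [D.regular_eq h w (hw.trans_lt hr.τ_lt), hfk, norm_mul]
  refine (mul_le_mul (hX.norm_deriv_param_le (hw.trans (hr.τ_lt.le.trans hr.r_le)))
    ((norm_add_le _ _).trans (add_le_add hCT hkw)) (norm_nonneg _) (by positivity)).trans_eq ?_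
  field_simp
  ring

/-- Residues and regular parts are bounded by the differential on the domains `Ω_{v,ε}`. -/
theorem exists_bound (D : GluingData G X ρ t r c R) (hX : AdmissibleCoordinates G X ρ c₁ c₂)
    (hε : 0 < ε) (hε' : ε ≤ ρ * c₁) (hr : AdmissibleRadii ρ c₁ c₂ ε r τ δ)
    (ht : ∀ e, ‖t e‖ ≤ δ)
    (hδ : 9 * c₂ * (2 / c₁ + 2 * r / ε) / r ^ 2 * δ ≤ 1 / 4) {B : V → ℝ}
    (hB : ∀ v, ∀ x ∈ Omega G X ε v, ‖field G X (parts t c R) r v x‖ ≤ B v) :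
    ∃ A : E → ℝ, (∀ e, 0 ≤ A e) ∧ (∀ h w, ‖w‖ ≤ τ → ‖R h w‖ ≤ A h.1) ∧
      (∀ e, A e ≤ 6 * c₂ * ((2 / c₁ + 2 * r / ε) * ε / r + 1) * (B (G.src e) + B (G.tgt e))) ∧
      (∀ e b, (∀ s w, ‖w‖ ≤ τ → ‖R (e, s) w‖ ≤ b) → A e ≤ 2 * b) ∧
      ∀ h, ‖c h‖ ≤ ε * B (G.vtx h) + 2 * δ / r * A h.1 := by
  have h0 := hX.c₁_pos
  have h0' := hX.c₂_pos
  have h0r := hr.r_pos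
  have h0d := hr.δ_pos
  have hmax : ∀ h : E × Side, ∃ w₀, ‖w₀‖ ≤ τ ∧ ∀ w, ‖w‖ ≤ τ → ‖R h w‖ ≤ ‖R h w₀‖ := by
    intro h
    obtain ⟨w₀, hw₀, hmax⟩ := (isCompact_closedBall (0 : ℂ) τ).exists_isMaxOn
      ⟨0, mem_closedBall_self hr.τ_pos.le⟩ ((D.differentiableOn h).continuousOn.mono
        (closedBall_subset_ball (hr.τ_lt.trans hr.r_lt))).norm
    exact ⟨w₀, by simpa using hw₀, fun w hw => hmax (by simpa using hw)⟩
  choose w₀ hw₀ hmax using hmax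
  -- The sum of the actual maxima at the two ends, rather than an arbitrary bound. Any other bound b
  -- for R then gives A ≤ 2b, which is what absorption arguments need.
  set A : E → ℝ := fun e => ‖R (e, Side.minus) (w₀ (e, Side.minus))‖ +
    ‖R (e, Side.plus) (w₀ (e, Side.plus))‖ with hAdef
  have hA : ∀ h w, ‖w‖ ≤ τ → ‖R h w‖ ≤ A h.1 := by
    rintro ⟨e, s⟩ w hw
    refine (hmax _ w hw).trans ?_
    cases s
    · exact le_add_of_nonneg_right (norm_nonneg _)
    · exact le_add_of_nonneg_left (norm_nonneg _)
  have hBs : ∀ h, ∀ x ∈ sphere (X.center h) ε,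
      ‖field G X (parts t c R) r (G.vtx h) x‖ ≤ B (G.vtx h) := fun h x hx =>
    hB _ x (hX.sphere_subset_Omega hε hε' h hx)
  have hc : ∀ h, ‖c h‖ ≤ ε * B (G.vtx h) + 2 * δ / r * A h.1 := fun h =>
    D.norm_residue_le hX hε hε' hr ht hA (hBs h)
  have hm : 0 ≤ 2 / c₁ + 2 * r / ε := by positivity
  set m := 2 / c₁ + 2 * r / ε
  have hside : ∀ h, ‖R h (w₀ h)‖ ≤
      3 * c₂ * (m * ε / r + 1) * B (G.vtx h) + 9 * c₂ * m / r ^ 2 * δ * A h.1 := by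
    intro h
    refine (D.norm_regular_le hX hε hε' hr ht (h := h)
      (M := (ε * B (G.vtx h) + 2 * δ / r * A h.1) / r + δ * A h.1 / r ^ 2)
      (fun u hu => (norm_parts_le hr ht hA h u hu).trans ?_) (hBs h) (hw₀ h)).trans_eq ?_
    · gcongr
      exact hc h
    · rw [show 2 / c₁ + 2 * r / ε = m from rfl]
      field_simp
      ring
  have hA0 : ∀ e, 0 ≤ A e := fun e => add_nonneg (norm_nonneg _) (norm_nonneg _)
  refine ⟨A, hA0, hA, fun e => ?_, fun e b hb => ?_, hc⟩
  swap
  · rw [two_mul]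
    exact add_le_add (hb _ _ (hw₀ _)) (hb _ _ (hw₀ _))
  have h1 := hside (e, Side.minus)
  have h2 := hside (e, Side.plus)
  have h3 : A e ≤ 3 * c₂ * (m * ε / r + 1) * (B (G.src e) + B (G.tgt e)) +
      2 * (9 * c₂ * m / r ^ 2 * δ * A e) := by
    have e1 : G.vtx (e, Side.minus) = G.src e := rfl
    have e2 : G.vtx (e, Side.plus) = G.tgt e := rfl
    rw [e1] at h1
    rw [e2] at h2
    simp only at h1 h2
    linarith
  -- The two ends together contribute at most A / 2 on the right, which is absorbed and doubles the
  -- constant.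
  have h4 := mul_le_mul_of_nonneg_right hδ (hA0 e)
  linarith

theorem norm_regular_le_sum (D : GluingData G X ρ t r c R)
    (hX : AdmissibleCoordinates G X ρ c₁ c₂)
    (hε' : ε ≤ ρ * c₁) (hr : AdmissibleRadii ρ c₁ c₂ ε r τ δ) (ht : ∀ e, ‖t e‖ ≤ δ)
    {A a : E → ℝ} (hc : ∀ h, ‖c h‖ ≤ a h.1) (hA : ∀ h w, ‖w‖ ≤ τ → ‖R h w‖ ≤ A h.1)
    {h : E × Side} {w : ℂ} (hw : ‖w‖ ≤ τ) :
    ‖R h w‖ ≤ 6 * c₂ / c₁ / r * ∑ h' ∈ G.halfEdges (G.vtx h), a h'.1 +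
      6 * c₂ / c₁ * δ / r ^ 2 * ∑ h' ∈ G.halfEdges (G.vtx h), A h'.1 := by
  rw [D.regular_eq h w (hw.trans_lt hr.τ_lt)]
  exact hX.norm_nextRegular_le hε' hr ht hc hA hw

theorem norm_field_le_of_mem_Omega (hX : AdmissibleCoordinates G X ρ c₁ c₂)
    (hε : 0 < ε) (hr : AdmissibleRadii ρ c₁ c₂ ε r τ δ) (ht : ∀ e, ‖t e‖ ≤ δ)
    {A a : E → ℝ} (hc : ∀ h, ‖c h‖ ≤ a h.1) (hA : ∀ h w, ‖w‖ ≤ τ → ‖R h w‖ ≤ A h.1)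
    {v : V} {x : ℂ} (hx : x ∈ Omega G X ε v) :
    ‖field G X (parts t c R) r v x‖ ≤ 2 / ε * ∑ h ∈ G.halfEdges v, a h.1 +
      2 * δ / (ε * r) * ∑ h ∈ G.halfEdges v, A h.1 := by
  have h0r := hr.r_pos
  refine (hX.norm_field_le_of_mem_Omega hε hr (M := fun h => a h.1 / r + δ * A h.1 / r ^ 2)
    (fun h u hu => (norm_parts_le hr ht hA h u hu).trans ?_) hx).trans_eq ?_
  · gcongr
    exact hc h
  · rw [Finset.sum_add_distrib, ← Finset.sum_div, ← Finset.sum_div, ← Finset.mul_sum]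
    field_simp

/-- Only the residue term contributes, since the singular part integrates to zero and the regular
part is holomorphic on the disc. In particular the choice of circle does not matter. -/
theorem period_differential (D : GluingData G X ρ t r c R)
    (hX : AdmissibleCoordinates G X ρ c₁ c₂) {e : E} {s : ℝ}
    (hs : ‖t e‖ / ρ < s) (hsρ : s < ρ) :
    period G X (differential G X ρ t r c R) e s =
      2 * Real.pi * Complex.I * c (e, Side.plus) := by
  have hρ := hX.rho_pos
  have hs0 : 0 < s := (div_nonneg (norm_nonneg _) hρ.le).trans_lt hs
  have hR : ContinuousOn (R (e, Side.plus)) (closedBall 0 s) :=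
    (D.differentiableOn _).continuousOn.mono (closedBall_subset_ball hsρ)
  have hP : ContinuousOn (parts t c R (e, Side.plus)) (sphere 0 s) :=
    continuousOn_parts hρ D.differentiableOn hs
  have e1 : period G X (differential G X ρ t r c R) e s =
      ∮ w in C(0, s), (parts t c R (e, Side.plus) w + R (e, Side.plus) w) := by
    refine circleIntegral.integral_congr hs0.le fun w hw => ?_
    rw [mem_sphere_zero_iff_norm] at hw
    exact differential_param (h := (e, Side.plus)) hX (hw ▸ hs) (hw ▸ hsρ)
  have e2 : (∮ w in C(0, s), R (e, Side.plus) w) = 0 :=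
    Complex.circleIntegral_eq_zero_of_differentiable_on_off_countable hs0.le countable_empty hR
      fun w hw => (D.differentiableOn (e, Side.plus)).differentiableAt
        (isOpen_ball.mem_nhds (ball_subset_ball hsρ.le hw.1))
  rw [e1, circleIntegral.integral_add (hP.circleIntegrable hs0.le)
    ((hR.mono sphere_subset_closedBall).circleIntegrable hs0.le), e2, add_zero]
  exact circleIntegral_principalPart hρ (D.differentiableOn _) hs

end GluingData

end Bounds

end AprioriBounds

/-! ### The period isomorphism -/

section PeriodIsomorphism

open Metric Set Filter NodeCoordinates

/-- The radii are chosen in this order: r, so that |z| ≤ r lies within ε / 2 of the centre; τ, so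
that |z| ≤ τ is far from |z| = r; then δ, so that t / u stays in |w| < τ for |u| = r and both error
terms are small. The bounds 1 / 4, instead of 1 / 2, allow for the two ends of an edge. -/
theorem exists_admissibleRadii {ρ c₁ c₂ ε K : ℝ} (hρ : 0 < ρ) (h₁ : 0 < c₁) (h₂ : 0 < c₂)
    (hε : 0 < ε) (hK : 0 ≤ K) : ∃ r τ δ, AdmissibleRadii ρ c₁ c₂ ε r τ δ ∧
      6 * c₂ / c₁ * δ / r ^ 2 * K ≤ 1 / 4 ∧
      9 * c₂ * (2 / c₁ + 2 * r / ε) / r ^ 2 * δ ≤ 1 / 4 := by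
  obtain ⟨r, hr⟩ : ∃ r, r = min (ρ / 2) (ε / 2 / c₂) := ⟨_, rfl⟩
  have hr0 : 0 < r := by rw [hr]; positivity
  obtain ⟨τ, hτ⟩ : ∃ τ, τ = min (r / 2) (c₁ * r / (2 * c₂)) := ⟨_, rfl⟩
  have hτ0 : 0 < τ := by rw [hτ]; positivity
  set p := 6 * c₂ / c₁ / r ^ 2 * K with hp
  set q := 9 * c₂ * (2 / c₁ + 2 * r / ε) / r ^ 2 with hq
  have hp0 : 0 ≤ p := by positivity
  have hq0 : 0 ≤ q := by positivity
  obtain ⟨δ, hδ⟩ : ∃ δ, δ = min (r * τ / 2) (1 / 4 / (p + q + 1)) := ⟨_, rfl⟩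
  have hδ0 : 0 < δ := by rw [hδ]; positivity
  have hδ' : δ * (p + q + 1) ≤ 1 / 4 := by
    rw [← le_div_iff₀ (by positivity), hδ]
    exact min_le_right _ _
  have hpδ : 0 ≤ δ * p := by positivity
  have hqδ : 0 ≤ δ * q := by positivity
  refine ⟨r, τ, δ, ⟨hr0, hr ▸ min_le_left _ _, ?_, hτ0, ?_, ?_, hδ0, ?_⟩, ?_, ?_⟩
  · rw [mul_comm, ← le_div_iff₀ h₂, hr]
    exact min_le_right _ _
  · have : τ ≤ r / 2 := hτ ▸ min_le_left _ _
    linarith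
  · have : τ ≤ c₁ * r / (2 * c₂) := hτ ▸ min_le_right _ _
    rw [le_div_iff₀ (by positivity)] at this
    linarith
  · have : δ ≤ r * τ / 2 := hδ ▸ min_le_left _ _
    linarith
  · have : 6 * c₂ / c₁ * δ / r ^ 2 * K = δ * p := by rw [hp]; ring
    rw [this]
    linarith
  · linarith

section NormH1

variable {V E : Type*} {G : OrientedMultigraph V E} {X : NodeCoordinates E} {ρ ε : ℝ} {t : E → ℂ}
  {NV : MonotoneNorm V}

theorem NodeCoordinates.H1.isRegularDifferential (ω : H1 G X ρ t ε NV) :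
    IsRegularDifferential G X ρ t (H1.coeff G X ρ t ε NV ω) := ω.2.1

theorem NodeCoordinates.H1.bounded_iSup (ω : H1 G X ρ t ε NV) :
    NV.Bounded (fun v => ⨆ x : Omega G X ε v, ‖H1.coeff G X ρ t ε NV ω v x‖) ‖ω‖ :=
  ⟨ω.2.2.2, le_rfl⟩

theorem NodeCoordinates.H1.norm_coeff_le_iSup (ω : H1 G X ρ t ε NV) (v : V) {x : ℂ} (hx : x ∈ Omega G X ε v) :
    ‖H1.coeff G X ρ t ε NV ω v x‖ ≤ ⨆ x : Omega G X ε v, ‖H1.coeff G X ρ t ε NV ω v x‖ :=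
  le_ciSup (ω.2.2.1 v) ⟨x, hx⟩

theorem supSeq_restrictOmega_bounded {f : V → ℂ → ℂ} {b : V → ℝ} {M : ℝ} (hb : NV.Bounded b M)
    (hf : ∀ v, ∀ x ∈ Omega G X ε v, ‖f v x‖ ≤ b v) (hb0 : ∀ v, 0 ≤ b v) :
    ∃ h : MonotoneNorm.supSeq (restrictOmega G X ε f) ∈ NV.space, NV.norm ⟨_, h⟩ ≤ M := by
  refine hb.mem fun v => ?_
  rw [MonotoneNorm.norm_supSeq, abs_of_nonneg (hb0 v)]
  exact Real.iSup_le (fun x => hf v x x.2) (hb0 v)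

theorem NodeCoordinates.H1.norm_le (ω : H1 G X ρ t ε NV) {b : V → ℝ} {M : ℝ} (hb : NV.Bounded b M)
    (hf : ∀ v, ∀ x ∈ Omega G X ε v, ‖H1.coeff G X ρ t ε NV ω v x‖ ≤ b v) (hb0 : ∀ v, 0 ≤ b v) :
    ‖ω‖ ≤ M := (supSeq_restrictOmega_bounded hb hf hb0).2

theorem NodeCoordinates.H1.exists_coeff_eq {f : V → ℂ → ℂ} (hf : IsRegularDifferential G X ρ t f) {b : V → ℝ}
    {M : ℝ} (hb : NV.Bounded b M) (hfb : ∀ v, ∀ x ∈ Omega G X ε v, ‖f v x‖ ≤ b v)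
    (hb0 : ∀ v, 0 ≤ b v) : ∃ ω : H1 G X ρ t ε NV, H1.coeff G X ρ t ε NV ω = f :=
  ⟨(⟨f, hf, fun v => ⟨b v, by rintro _ ⟨x, rfl⟩; exact hfb v x x.2⟩,
    (supSeq_restrictOmega_bounded hb hfb hb0).1⟩ : h1 G X ρ t ε NV), rfl⟩

end NormH1

section Isomorphism

variable {V E : Type*} {G : OrientedMultigraph V E} {X : NodeCoordinates E}
  {ρ c₁ c₂ ε r τ δ : ℝ} {t : E → ℂ} {NE : MonotoneNorm E} {NV : MonotoneNorm V}

theorem norm_two_pi_I_inv_mul_le (z : ℂ) : ‖(2 * Real.pi * Complex.I)⁻¹ * z‖ ≤ ‖z‖ := by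
  rw [norm_mul]
  refine mul_le_of_le_one_left (norm_nonneg _) ?_
  rw [norm_inv]
  refine inv_le_one_of_one_le₀ ?_
  have := Real.pi_gt_three
  simp only [norm_mul, Complex.norm_ofNat, Complex.norm_real, Complex.norm_I, mul_one,
    Real.norm_eq_abs, abs_of_pos Real.pi_pos]
  linarith

namespace NodeCoordinates.H1

/-- The gluing data of an element of `H¹(Σ_t)`, with bounds. -/
theorem exists_gluingData (hX : AdmissibleCoordinates G X ρ c₁ c₂) (hε : 0 < ε)
    (hε' : ε ≤ ρ * c₁) (hr : AdmissibleRadii ρ c₁ c₂ ε r τ δ)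
    (hδ : 9 * c₂ * (2 / c₁ + 2 * r / ε) / r ^ 2 * δ ≤ 1 / 4) (ht : ∀ e, ‖t e‖ ≤ δ) {K : ℝ}
    (hK : ∀ (b : V → ℝ) (M : ℝ), (∀ v, 0 ≤ b v) → NV.Bounded b M →
      NE.Bounded (fun e => b (G.src e) + b (G.tgt e)) (K * M)) (ω : H1 G X ρ t ε NV) :
    ∃ c R, GluingData G X ρ t r c R ∧
      H1.coeff G X ρ t ε NV ω = GluingData.differential G X ρ t r c R ∧
      (∃ (A : E → ℝ) (M : ℝ), NE.Bounded A M ∧ (∀ e, 0 ≤ A e) ∧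
        (∀ h w, ‖w‖ ≤ τ → ‖R h w‖ ≤ A h.1) ∧
        ∀ e b, (∀ s w, ‖w‖ ≤ τ → ‖R (e, s) w‖ ≤ b) → A e ≤ 2 * b) ∧
      NE.Bounded (fun e => ‖c (e, Side.plus)‖)
        ((ε + 2 * δ / r * (6 * c₂ * ((2 / c₁ + 2 * r / ε) * ε / r + 1))) * (K * ‖ω‖)) := by
  have h0 := hX.c₁_pos
  have h0' := hX.c₂_pos
  have h0r := hr.r_pos
  have h0d := hr.δ_pos
  have ha : 0 ≤ δ / τ := div_nonneg h0d.le hr.τ_pos.le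
  have hta : ∀ e, ‖t e‖ / ρ ≤ δ / τ := fun e => hr.div_rho_le (ht e)
  obtain ⟨c, R, D, hωD⟩ := (H1.isRegularDifferential ω).exists_gluingData hX ha hr.delta_div_lt
    hr.r_lt hta
  set B : V → ℝ := fun v => ⨆ x : Omega G X ε v, ‖H1.coeff G X ρ t ε NV ω v x‖
  have hB0 : ∀ v, 0 ≤ B v := fun v => Real.iSup_nonneg fun _ => norm_nonneg _
  have hB : ∀ v, ∀ x ∈ Omega G X ε v, ‖field G X (parts t c R) r v x‖ ≤ B v := by
    intro v x hx
    rw [← D.differential_of_outside hX ha hr.delta_div_lt hta (hX.outside_of_mem_Omega hε hr hx),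
      ← hωD]
    exact H1.norm_coeff_le_iSup ω v hx
  obtain ⟨A, hA0, hA, hAB, hAb, hc⟩ := D.exists_bound hX hε hε' hr ht hδ hB
  have hends := hK B _ hB0 (H1.bounded_iSup ω)
  set κ := 6 * c₂ * ((2 / c₁ + 2 * r / ε) * ε / r + 1)
  have hκ : 0 ≤ κ := by positivity
  refine ⟨c, R, D, hωD, ⟨A, _, (hends.const_mul hκ).mono_of_nonneg hA0 hAB, hA0, hA, hAb⟩, ?_⟩
  refine (hends.const_mul (by positivity)).mono_of_nonneg (fun e => norm_nonneg _) fun e => ?_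
  have h1 := hc (e, Side.plus)
  have h2 : 2 * δ / r * A e ≤ 2 * δ / r * (κ * (B (G.src e) + B (G.tgt e))) := by
    gcongr
    exact hAB e
  have h3 : 0 ≤ ε * B (G.src e) := mul_nonneg hε.le (hB0 _)
  have e2 : G.vtx (e, Side.plus) = G.tgt e := rfl
  rw [e2] at h1
  simp only at h1
  linarith

/-- The periods of the elements of `H¹(Σ_t)`. -/
noncomputable def periodMap (hX : AdmissibleCoordinates G X ρ c₁ c₂)
    (hr : AdmissibleRadii ρ c₁ c₂ ε r τ δ) (ht : ∀ e, ‖t e‖ ≤ δ) :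
    H1 G X ρ t ε NV →ₗ[ℂ] (E → ℂ) :=
  have hlt : ∀ e, ‖t e‖ / ρ < r := fun e => (hr.div_rho_le (ht e)).trans_lt hr.delta_div_lt
  have hint : ∀ (ω : H1 G X ρ t ε NV) e, CircleIntegrable (fun w =>
      H1.coeff G X ρ t ε NV ω (G.tgt e) (X.param (e, Side.plus) w) *
        deriv (X.param (e, Side.plus)) w) 0 r := fun ω e =>
    ContinuousOn.circleIntegrable hr.r_pos.le fun w hw =>
      ((H1.isRegularDifferential ω).differentiableAt_pullback hX
        (fun e => (hlt e).trans hr.r_lt) (h := (e, Side.plus))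
        (by rw [mem_sphere_zero_iff_norm.1 hw]; exact hlt e)
        (by rw [mem_sphere_zero_iff_norm.1 hw]; exact hr.r_lt)).continuousAt.continuousWithinAt
  { toFun := fun ω e => period G X (H1.coeff G X ρ t ε NV ω) e r
    map_add' := fun ω ω' => funext fun e => by
      rw [Pi.add_apply]
      refine Eq.trans ?_ (circleIntegral.integral_add (hint ω e) (hint ω' e))
      refine congrArg (fun F : ℂ → ℂ => ∮ u in C(0, r), F u) (funext fun u => ?_)
      rw [map_add]
      exact add_mul _ _ _
    map_smul' := fun k ω => funext fun e => by
      rw [Pi.smul_apply, RingHom.id_apply, smul_eq_mul]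
      refine Eq.trans ?_ (circleIntegral.integral_const_mul k _ 0 r)
      refine congrArg (fun F : ℂ → ℂ => ∮ u in C(0, r), F u) (funext fun u => ?_)
      rw [map_smul]
      exact mul_assoc _ _ _ }

end NodeCoordinates.H1

/-- The map sending a differential to its periods is an isomorphism of normed spaces. -/
theorem exists_period_equiv (hX : AdmissibleCoordinates G X ρ c₁ c₂) (hε : 0 < ε)
    (hε' : ε ≤ ρ * c₁) [CompleteSpace NE.Space] {K₁ K₂ K₃ : ℝ}
    (hK₁ : ∀ (a : E → ℝ) (M : ℝ), (∀ e, 0 ≤ a e) → NE.Bounded a M →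
      NV.Bounded (fun v => ∑ h ∈ G.halfEdges v, a h.1) (K₁ * M))
    (hK₂ : ∀ (b : V → ℝ) (M : ℝ), (∀ v, 0 ≤ b v) → NV.Bounded b M →
      NE.Bounded (fun e => b (G.src e) + b (G.tgt e)) (K₂ * M))
    (hK₃ : ∀ (a : E → ℝ) (M : ℝ), (∀ e, 0 ≤ a e) → NE.Bounded a M →
      NE.Bounded (G.endSum a) (K₃ * M))
    (hr : AdmissibleRadii ρ c₁ c₂ ε r τ δ)
    (hδ₁ : 6 * c₂ / c₁ * δ / r ^ 2 * K₃ ≤ 1 / 4)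
    (hδ₂ : 9 * c₂ * (2 / c₁ + 2 * r / ε) / r ^ 2 * δ ≤ 1 / 4) (ht : ∀ e, ‖t e‖ ≤ δ) :
    (∀ ω : H1 G X ρ t ε NV, ‖ω‖ = 0 → ω = 0) ∧
    ∃ L : H1 G X ρ t ε NV ≃L[ℂ] compatibleSubspace G NE,
      ∀ (ω : H1 G X ρ t ε NV) (e : E) (s : ℝ), ‖t e‖ / ρ < s → s < ρ →
        NE.coords (L ω : NE.Space) e = period G X (H1.coeff G X ρ t ε NV ω) e s := by
  have h0 := hX.c₁_pos
  have h0' := hX.c₂_pos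
  have h0r := hr.r_pos
  have h0d := hr.δ_pos
  have ha : 0 ≤ δ / τ := div_nonneg h0d.le hr.τ_pos.le
  have hta : ∀ e, ‖t e‖ / ρ ≤ δ / τ := fun e => hr.div_rho_le (ht e)
  have hlt : ∀ e, ‖t e‖ / ρ < r := fun e => (hta e).trans_lt hr.delta_div_lt
  have hpi : (2 * Real.pi * Complex.I : ℂ) ≠ 0 := Complex.two_pi_I_ne_zero
  have hdata := fun ω => H1.exists_gluingData (NE := NE) hX hε hε' hr hδ₂ ht hK₂ (NV := NV) ω
  set P := H1.periodMap (NV := NV) hX hr ht with hPdef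
  have hper : ∀ (ω : H1 G X ρ t ε NV) c R, GluingData G X ρ t r c R →
      H1.coeff G X ρ t ε NV ω = GluingData.differential G X ρ t r c R → ∀ e s, ‖t e‖ / ρ < s →
        s < ρ → period G X (H1.coeff G X ρ t ε NV ω) e s =
          2 * Real.pi * Complex.I * c (e, Side.plus) := fun ω c R D h e s hs hsρ => by
    rw [h]
    exact D.period_differential hX hs hsρ
  have hPc : ∀ (ω : H1 G X ρ t ε NV) c R, GluingData G X ρ t r c R →
      H1.coeff G X ρ t ε NV ω = GluingData.differential G X ρ t r c R → ∀ e,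
        P ω e = 2 * Real.pi * Complex.I * c (e, Side.plus) := fun ω c R D h e =>
    hper ω c R D h e r (hlt e) hr.r_lt
  -- The factor 2π converts the bound on residues into one on periods.
  set C₁ := 2 * Real.pi * ((ε + 2 * δ / r * (6 * c₂ * ((2 / c₁ + 2 * r / ε) * ε / r + 1))) * K₂)
  have hbound : ∀ ω : H1 G X ρ t ε NV, ∃ h : P ω ∈ NE.space, NE.norm ⟨_, h⟩ ≤ C₁ * ‖ω‖ := by
    intro ω
    obtain ⟨c, R, D, hωD, -, hcB⟩ := hdata ω
    have h2pi : (0 : ℝ) ≤ 2 * Real.pi := Real.two_pi_pos.le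
    obtain ⟨h1, h2⟩ := (hcB.const_mul h2pi).mem (x := P ω) fun e => by
      rw [hPc ω c R D hωD, abs_of_nonneg (mul_nonneg h2pi (norm_nonneg _))]
      simp [abs_of_pos Real.pi_pos]
    refine ⟨h1, h2.trans_eq ?_⟩
    simp only [C₁]
    ring
  have hcompat : ∀ ω : H1 G X ρ t ε NV, ∀ v,
      ∑ e ∈ G.outEdges v, P ω e = ∑ e ∈ G.inEdges v, P ω e := by
    intro ω v
    obtain ⟨c, R, D, hωD, -⟩ := hdata ω
    have h1 := D.sum_residues v
    rw [G.sum_halfEdges] at h1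
    simp only [D.residue_minus, Finset.sum_neg_distrib] at h1
    simp only [hPc ω c R D hωD, ← Finset.mul_sum]
    congr 1
    linear_combination -h1
  let L₁ : H1 G X ρ t ε NV →ₗ[ℂ] compatibleSubspace G NE :=
    LinearMap.codRestrict (compatibleSubspace G NE)
      (LinearMap.codRestrict NE.space P fun ω => (hbound ω).1 : H1 G X ρ t ε NV →ₗ[ℂ] NE.Space)
      fun ω => hcompat ω
  have hL₁ : ∀ ω e, NE.coords (L₁ ω : NE.Space) e = P ω e := fun _ _ => rfl
  have hL₁norm : ∀ ω, ‖L₁ ω‖ ≤ C₁ * ‖ω‖ := fun ω => (hbound ω).2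
  have hcoordsB : ∀ α : compatibleSubspace G NE,
      NE.Bounded (fun e => ‖NE.coords (α : NE.Space) e‖) ‖α‖ := fun α =>
    MonotoneNorm.bounded_norm (N := NE) (α : NE.Space)
  set κ := 6 * c₂ / c₁ / r with hκ
  set q := 6 * c₂ / c₁ * δ / r ^ 2 with hq
  have hκ0 : 0 ≤ κ := by positivity
  have hq0 : 0 ≤ q := by positivity
  set C₂ := 2 / ε * K₁ + 2 * δ / (ε * r) * (K₁ * (4 * κ * K₃)) with hC₂
  have hfieldB : ∀ (c : E × Side → ℂ) (R : E × Side → ℂ → ℂ), GluingData G X ρ t r c R →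
      ∀ A a : E → ℝ, (∀ h, ‖c h‖ ≤ a h.1) → (∀ h w, ‖w‖ ≤ τ → ‖R h w‖ ≤ A h.1) →
        ∀ v, ∀ x ∈ Omega G X ε v, ‖GluingData.differential G X ρ t r c R v x‖ ≤
          2 / ε * ∑ h ∈ G.halfEdges v, a h.1 + 2 * δ / (ε * r) * ∑ h ∈ G.halfEdges v, A h.1 := by
    intro c R D A a hc hA v x hx
    rw [D.differential_of_outside hX ha hr.delta_div_lt hta (hX.outside_of_mem_Omega hε hr hx)]
    exact GluingData.norm_field_le_of_mem_Omega hX hε hr ht hc hA hx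
  have hfieldB' : ∀ (A a : E → ℝ) (M M' : ℝ), (∀ e, 0 ≤ a e) → (∀ e, 0 ≤ A e) → NE.Bounded a M →
      NE.Bounded A M' → NV.Bounded (fun v => 2 / ε * ∑ h ∈ G.halfEdges v, a h.1 +
        2 * δ / (ε * r) * ∑ h ∈ G.halfEdges v, A h.1)
        (2 / ε * (K₁ * M) + 2 * δ / (ε * r) * (K₁ * M')) := fun A a M M' ha0 hA0 haM hAM =>
    ((hK₁ a M ha0 haM).const_mul (by positivity)).add
      ((hK₁ A M' hA0 hAM).const_mul (by positivity))
  have hfieldB0 : ∀ (A a : E → ℝ), (∀ e, 0 ≤ a e) → (∀ e, 0 ≤ A e) → ∀ v,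
      0 ≤ 2 / ε * ∑ h ∈ G.halfEdges v, a h.1 +
        2 * δ / (ε * r) * ∑ h ∈ G.halfEdges v, A h.1 := fun A a ha0 hA0 v =>
    add_nonneg (mul_nonneg (by positivity) (Finset.sum_nonneg fun h _ => ha0 h.1))
      (mul_nonneg (by positivity) (Finset.sum_nonneg fun h _ => hA0 h.1))
  have hnormc : ∀ (c : E × Side → ℂ), (∀ e, c (e, Side.minus) = -c (e, Side.plus)) →
      ∀ h : E × Side, ‖c h‖ = ‖c (h.1, Side.plus)‖ := by
    rintro c hc ⟨e, s⟩
    cases s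
    · rw [hc, norm_neg]
    · rfl
  -- The period bound controls the residues; the gluing equation then controls R, and the field
  -- formula controls ω on Ω.
  have hlower : ∀ ω, ‖ω‖ ≤ C₂ * ‖L₁ ω‖ := by
    intro ω
    obtain ⟨c, R, D, hωD, ⟨A, M, hAM, hA0, hA, hAb⟩, -⟩ := hdata ω
    set a : E → ℝ := fun e => ‖c (e, Side.plus)‖
    have ha0 : ∀ e, 0 ≤ a e := fun e => norm_nonneg _
    have hc : ∀ h, ‖c h‖ ≤ a h.1 := fun h => (hnormc c D.residue_minus h).le
    have haB : NE.Bounded a ‖L₁ ω‖ := by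
      refine (hcoordsB (L₁ ω)).mono_of_nonneg ha0 fun e => ?_
      have h1 := norm_two_pi_I_inv_mul_le (P ω e)
      rw [hPc ω c R D hωD, inv_mul_cancel_left₀ hpi, ← hPc ω c R D hωD] at h1
      exact h1
    obtain ⟨hAs, -⟩ := id hAM
    set nA := NE.norm ⟨_, hAs⟩
    have hAn : NE.Bounded A nA := ⟨hAs, le_rfl⟩
    have hAle : ∀ e, A e ≤ 2 * (κ * G.endSum a e + q * G.endSum A e) := fun e =>
      hAb e _ fun s w hw => (D.norm_regular_le_sum hX hε' hr ht hc hA hw).trans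
        (add_le_add (mul_le_mul_of_nonneg_left (G.sum_le_endSum ha0 (e, s)) hκ0)
          (mul_le_mul_of_nonneg_left (G.sum_le_endSum hA0 (e, s)) hq0))
    have hA2 := (((((hK₃ a _ ha0 haB).const_mul hκ0).add
      ((hK₃ A _ hA0 hAn).const_mul hq0)).const_mul zero_le_two).mono_of_nonneg hA0 hAle)
    -- From nA ≤ 2κK₃‖L₁ ω‖ + 2qK₃ nA and qK₃ ≤ 1 / 4, the last term is absorbed. This is legitimate
    -- because A is already known to lie in B_E.
    have hnA : nA ≤ 4 * κ * K₃ * ‖L₁ ω‖ := by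
      have h1 : nA ≤ _ := hA2.2
      have h2 := mul_le_mul_of_nonneg_right hδ₁ hAn.nonneg
      linarith
    refine (H1.norm_le ω (hfieldB' A a _ _ ha0 hA0 haB (hAn.le hnA))
      (fun v x hx => ?_) (hfieldB0 A a ha0 hA0)).trans_eq ?_
    · rw [hωD]
      exact hfieldB c R D A a hc hA v x hx
    · rw [hC₂]
      ring
  -- Norm zero gives zero periods, hence zero residues. The homogeneous gluing equation then forces
  -- nA ≤ nA / 2, so R vanishes on |w| ≤ τ and, by the identity theorem, on |w| < ρ.
  have hzero : ∀ ω : H1 G X ρ t ε NV, ‖ω‖ = 0 → ω = 0 := by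
    intro ω hω
    obtain ⟨c, R, D, hωD, ⟨A, M, hAM, hA0, hA, hAb⟩, hcB⟩ := hdata ω
    have hP0 : ∀ e, P ω e = 0 := by
      have h1 := hL₁norm ω
      rw [hω, mul_zero] at h1
      have h2 : L₁ ω = 0 := norm_le_zero_iff.1 h1
      intro e
      rw [← hL₁, h2]
      rfl
    have hc0 : ∀ h, c h = 0 := fun h => by
      rw [← norm_eq_zero, hnormc c D.residue_minus h, norm_eq_zero]
      have := hP0 h.1
      rw [hPc ω c R D hωD] at this
      exact (mul_eq_zero.1 this).resolve_left hpi
    have haB : NE.Bounded (fun _ : E => (0 : ℝ)) 0 :=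
      ⟨by simp only [Complex.ofReal_zero]; exact NE.space.zero_mem, (map_zero NE.norm).le⟩
    obtain ⟨hAs, -⟩ := id hAM
    set nA := NE.norm ⟨_, hAs⟩
    have hAn : NE.Bounded A nA := ⟨hAs, le_rfl⟩
    have hAle : ∀ e, A e ≤ 2 * (q * G.endSum A e) := fun e =>
      hAb e _ fun s w hw => (D.norm_regular_le_sum hX hε' hr ht (a := fun _ => 0)
        (fun h => by simp [hc0]) hA hw).trans (by
          simp only [Finset.sum_const_zero, mul_zero, zero_add]
          exact mul_le_mul_of_nonneg_left (G.sum_le_endSum hA0 (e, s)) hq0)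
    have hA2 := ((((hK₃ A _ hA0 hAn).const_mul hq0)).const_mul zero_le_two).mono_of_nonneg hA0 hAle
    have hnA : nA = 0 := by
      have h1 : nA ≤ _ := hA2.2
      have h2 := mul_le_mul_of_nonneg_right hδ₁ hAn.nonneg
      have h3 := hAn.nonneg
      linarith
    have hAzero : ∀ e, A e = 0 := fun e => by
      have := congrFun (congrArg Subtype.val (NE.eq_zero_of_norm_eq_zero _ hnA)) e
      exact Complex.ofReal_eq_zero.1 this
    have hR0 : ∀ h w, ‖w‖ ≤ τ → R h w = 0 := fun h w hw => by
      have := hA h w hw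
      rw [hAzero] at this
      exact norm_le_zero_iff.1 this
    have hR0' : ∀ h w, ‖w‖ < ρ → R h w = 0 := by
      intro h w hw
      have h1 : AnalyticOnNhd ℂ (R h) (ball 0 ρ) :=
        (D.differentiableOn h).analyticOnNhd isOpen_ball
      refine h1.eqOn_zero_of_preconnected_of_eventuallyEq_zero (convex_ball _ _).isPreconnected
        (mem_ball_self hX.rho_pos) ?_ (by simpa using hw)
      filter_upwards [ball_mem_nhds (0 : ℂ) hr.τ_pos] with u hu
      exact hR0 h u (mem_ball_zero_iff.1 hu).le
    have hparts : ∀ h u, ‖t h.1‖ / ρ < ‖u‖ → parts t c R h u = 0 := by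
      intro h u hu
      simp only [parts, principalPart, hc0, zero_div,
        hR0' _ _ (norm_div_lt_of_div_lt hX.rho_pos hu), mul_zero, sub_zero]
    have hcoeff : H1.coeff G X ρ t ε NV ω = 0 := by
      rw [hωD]
      funext v x
      by_cases H : Outside G X r v x
      · rw [D.differential_of_outside hX ha hr.delta_div_lt hta H, Pi.zero_apply, Pi.zero_apply]
        refine Finset.sum_eq_zero fun h _ => ?_
        unfold cauchyTransform
        rw [circleIntegral.integral_congr (g := fun _ => 0) h0r.le fun u hu => ?_]
        · simp [circleIntegral]
        · rw [mem_sphere_zero_iff_norm] at hu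
          simp only [hparts h u (hu ▸ hlt h.1), zero_div]
      · unfold Outside at H
        push Not at H
        obtain ⟨h, rfl, u, hu, rfl⟩ := H
        have huρ := hu.trans_lt hr.r_lt
        by_cases hp : ‖t h.1‖ / ρ < ‖u‖
        · have h1 := GluingData.differential_param (r := r) (c := c) (R := R) hX hp huρ
          rw [hparts h u hp, hR0' h u huρ, add_zero] at h1
          exact (mul_eq_zero.1 h1).resolve_right (hX.deriv_param_ne_zero huρ)
        · refine if_neg fun hpiece => hp ?_
          have := hpiece h.1 h.2 rfl (hX.param_mem huρ)
          rwa [show X.z h.1 h.2 (X.param h u) = u from hX.coord_param huρ] at this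
    exact Subtype.ext hcoeff
  have hinj : Function.Injective L₁ := by
    rw [← LinearMap.ker_eq_bot, LinearMap.ker_eq_bot']
    intro ω hω
    refine hzero ω (le_antisymm ?_ (norm_nonneg _))
    have := hlower ω
    rwa [hω, norm_zero, mul_zero] at this
  have hsurj : Function.Surjective L₁ := by
    intro α
    set β : E → ℂ := NE.coords (α : NE.Space) with hβ
    -- The residues prescribed by the periods; compatibility of α says that they sum to zero at each
    -- vertex.
    set c : E × Side → ℂ := fun h => match h.2 with
      | Side.minus => -((2 * Real.pi * Complex.I)⁻¹ * β h.1)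
      | Side.plus => (2 * Real.pi * Complex.I)⁻¹ * β h.1 with hcdef
    have hcm : ∀ e, c (e, Side.minus) = -c (e, Side.plus) := fun e => rfl
    have hcp : ∀ e, c (e, Side.plus) = (2 * Real.pi * Complex.I)⁻¹ * β e := fun e => rfl
    have hcs : ∀ v, ∑ h ∈ G.halfEdges v, c h = 0 := by
      intro v
      have h1 : ∑ e ∈ G.outEdges v, β e = ∑ e ∈ G.inEdges v, β e := α.2 v
      rw [G.sum_halfEdges]
      simp only [hcm, hcp, Finset.sum_neg_distrib, ← Finset.mul_sum, h1, neg_add_cancel]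
    have hc : ∀ h, ‖c h‖ ≤ ‖β h.1‖ := fun h => by
      rw [hnormc c hcm h, hcp]
      exact norm_two_pi_I_inv_mul_le _
    obtain ⟨R, A, D, hA0, hAB, hA⟩ := hX.exists_gluingData_of_residues hε' hr hK₃
      (by linarith) ht (a := fun e => ‖β e‖) hc (fun e => norm_nonneg _) (hcoordsB α) hcm hcs
    obtain ⟨ω, hω⟩ := H1.exists_coeff_eq (NV := NV) (ε := ε)
      (D.isRegularDifferential hX ha hr.delta_div_lt hr.r_lt hta)
      (hfieldB' A (fun e => ‖β e‖) _ _ (fun e => norm_nonneg _) hA0 (hcoordsB α) hAB)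
      (hfieldB c R D A (fun e => ‖β e‖) hc hA) (hfieldB0 A _ (fun e => norm_nonneg _) hA0)
    refine ⟨ω, Subtype.ext (Subtype.ext (funext fun e => ?_))⟩
    change P ω e = β e
    rw [hPc ω c R D hω, hcp, mul_inv_cancel_left₀ hpi]
  let L₂ := LinearEquiv.ofBijective L₁ ⟨hinj, hsurj⟩
  refine ⟨hzero, L₂.toContinuousLinearEquivOfBounds C₁ C₂ hL₁norm fun α => ?_,
    fun ω e s hs hsρ => ?_⟩
  · obtain ⟨ω, rfl⟩ := L₂.surjective α
    rw [LinearEquiv.symm_apply_apply]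
    exact hlower ω
  · obtain ⟨c, R, D, hωD, -⟩ := hdata ω
    rw [hper ω c R D hωD e s hs hsρ, ← hPc ω c R D hωD e]
    rfl

end Isomorphism

theorem isClosed_compatibleSubspace {V E : Type*} (G : OrientedMultigraph V E)
    (NE : MonotoneNorm E) : IsClosed (compatibleSubspace G NE : Set NE.Space) := by
  have : (compatibleSubspace G NE : Set NE.Space) =
      ⋂ v, {α | ∑ e ∈ G.outEdges v, NE.coords α e = ∑ e ∈ G.inEdges v, NE.coords α e} := by
    ext α
    simp only [mem_iInter]
    rfl
  rw [this]
  exact isClosed_iInter fun v => isClosed_eq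
    (continuous_finsetSum _ fun e _ => NE.continuous_coords e)
    (continuous_finsetSum _ fun e _ => NE.continuous_coords e)

end PeriodIsomorphism

theorem theorem3 {V E : Type*} (G : OrientedMultigraph V E) (hG : G.Connected)
    (X : NodeCoordinates E) (ρ c₁ c₂ : ℝ) (hX : AdmissibleCoordinates G X ρ c₁ c₂)
    (NE : MonotoneNorm E) (NV : MonotoneNorm V) (hN : AdmissibleNorms G NE NV)
    (ε : ℝ) (hε : 0 < ε) (hε' : ε ≤ ρ * c₁) :
    ∃ δ : ℝ, 0 < δ ∧ δ < ρ ^ 2 ∧ ∀ t : E → ℂ, (∀ e, ‖t e‖ ≤ δ) →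
      (∀ ω : NodeCoordinates.H1 G X ρ t ε NV, ‖ω‖ = 0 → ω = 0) ∧
      CompleteSpace (NodeCoordinates.H1 G X ρ t ε NV) ∧
      CompleteSpace (compatibleSubspace G NE) ∧
      ∃ L : NodeCoordinates.H1 G X ρ t ε NV ≃L[ℂ] compatibleSubspace G NE,
        ∀ (ω : NodeCoordinates.H1 G X ρ t ε NV) (e : E) (r : ℝ), ‖t e‖ / ρ < r → r < ρ →
          NE.coords (L ω : NE.Space) e =
            NodeCoordinates.period G X (NodeCoordinates.H1.coeff G X ρ t ε NV ω) e r := by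
  have := hN.complete_edges
  obtain ⟨K₁, -, hK₁⟩ := hN.exists_bounded_vertexSum
  obtain ⟨K₂, -, hK₂⟩ := hN.exists_bounded_endpoints
  obtain ⟨K₃, hK₃0, hK₃⟩ := hN.exists_bounded_endSum
  obtain ⟨r, τ, δ, hr, hδ₁, hδ₂⟩ :=
    exists_admissibleRadii hX.rho_pos hX.c₁_pos hX.c₂_pos hε hK₃0
  refine ⟨δ, hr.δ_pos, ?_, fun t ht => ?_⟩
  · have h1 := mul_lt_mul_of_pos_left hr.τ_lt hr.r_pos
    have h2 := mul_lt_mul'' hr.r_lt hr.r_lt hr.r_pos.le hr.r_pos.le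
    nlinarith [hr.δ_le, hr.δ_pos]
  · obtain ⟨hzero, L, hL⟩ := exists_period_equiv hX hε hε' hK₁ hK₂ hK₃ hr hδ₁ hδ₂ ht
    have hcomplete : CompleteSpace (compatibleSubspace G NE) :=
      (isClosed_compatibleSubspace G NE).completeSpace_coe
    -- Completeness of H¹ is transported back along L from the closed subspace of B_E.
    exact ⟨hzero, (completeSpace_congr (e := L.toEquiv) L.isUniformEmbedding).2 hcomplete, hcomplete, L, hL⟩
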